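/- **Setting.** A function $\phi:\mathbb R\to\mathbb R$ is *tanh-like* if $\phi(-x)=-\phi(x)$ and $|\phi(x)|\le 1$ for all $x$, $\phi(x)\ge 0$ for $x\ge 0$, and $\phi$ is nondecreasing with $\phi(x)\to 1$ as $x\to\infty$. For a tanh-like $\phi$ and constants $\sigma_w,\sigma_b\ge 0$, the *reduced residual network* of width $N$ maps an input $x^{(0)}\in\mathbb R^N$ to the vectors $$h^{(l)}_i=\sum_{j}w^{(l)}_{ij}x^{(l-1)}_j+b^{(l)}_i,\qquad x^{(l)}_i=\phi(h^{(l)}_i)+x^{(l-1)}_i\qquad(l\ge 1),$$ where all $w^{(l)}_{ij}\sim\mathcal N(0,\sigma_w^2/N)$ and $b^{(l)}_i\sim\mathcal N(0,\sigma_b^2)$ are independent. Two inputs $x^{(0)},x^{(0)\prime}$ are fed through the same random network; for each $N$ they are fixed vectors of $\mathbb R^N$ such that, as $N\to\infty$, $\|x^{(0)}\|^2/N\to p^{(0)}$, $\|x^{(0)\prime}\|^2/N\to p^{(0)}$ and $x^{(0)}\cdot x^{(0)\prime}/N\to\gamma^{(0)}$, with $p^{(0)}>0$. Define, with expectations over the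 weights and biases, $$p^{(l)}=\lim_{N\to\infty}\tfrac1N\mathbb E\|x^{(l)}\|^2,\quad p^{(l)\prime}=\lim_{N\to\infty}\tfrac1N\mathbb E\|x^{(l)\prime}\|^2,\quad \gamma^{(l)}=\lim_{N\to\infty}\tfrac1N\mathbb E[x^{(l)}\cdot x^{(l)\prime}],\quad \lambda^{(l)}=\lim_{N\to\infty}\tfrac1N\mathbb E[h^{(l)}\cdot h^{(l)\prime}]\ (l\ge1),$$ $$e^{(l)}=\frac{\gamma^{(l)}}{\sqrt{p^{(l)}p^{(l)\prime}}},\qquad s^{(l)}=\tfrac12\big(p^{(l)}+p^{(l)\prime}\big)-\gamma^{(l)}.$$ Let $V\phi(q)=\mathbb E[\phi(z)^2]$ for $z\sim\mathcal N(0,q)$, and $W\phi(\rho,\nu)=\mathbb E[\phi(z)\phi(z')]$ for a centred Gaussian pair $(z,z')$ with both variances equal to $\rho$ and covariance $\nu$. All asymptotics are as $l\to\infty$ and concern absolute values; $f=\check\Theta(g)$ means that $f(l)=O(g(l)\,l^{\epsilon})$ and $f(l)=\Omega(g(l)\,l^{-\epsilon})$ for every $\epsilon>0$. **Theorem.** Assume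 $e^{(0)}=\gamma^{(0)}/p^{(0)}<1$. Then all the limits above exist, $p^{(l)\prime}=p^{(l)}$ and $s^{(l)}=p^{(l)}(1-e^{(l)})$ for all $l$, and the following holds. 1. If $\sigma_w=0$, then $\gamma^{(l)}=l\,W\phi(\sigma_b^2,\sigma_b^2)+\gamma^{(0)}=l\,V\phi(\sigma_b^2)+\gamma^{(0)}$ for all $l\ge 0$, $\lambda^{(l)}=\sigma_b^2$ for all $l\ge1$, and $s^{(l)}=\Theta(1)$. If moreover $\sigma_b>0$, then $e^{(l)}\to1$ and $1-e^{(l)}=\Theta(l^{-1})$. 2. If $\sigma_w>0$, then $s^{(l)}=\Theta(p^{(l)})=\Theta(l)$. If moreover it is not the case that both $\sigma_b=0$ and $\gamma^{(0)}=-p^{(0)}$, then $e^{(l)}\to0$. If in addition $\sigma_w^2\gamma^{(0)}+\sigma_b^2\ne0$, then $\gamma^{(l)}=\check\Theta(l^{2/\pi})$ and $e^{(l)}=\check\Theta(l^{2/\pi-1})$. -/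

import Mathlib

open MeasureTheory ProbabilityTheory Filter Topology Asymptotics
open scoped NNReal Matrix

noncomputable section

namespace RRN

/-- Tanh-like nonlinearities. Neither continuity nor strict monotonicity is required. -/
structure TanhLike (φ : ℝ → ℝ) : Prop where
  odd : ∀ x, φ (-x) = -φ x
  abs_le_one : ∀ x, |φ x| ≤ 1
  nonneg : ∀ x, 0 ≤ x → 0 ≤ φ x
  monotone : Monotone φ
  tendsto_one : Tendsto φ atTop (𝓝 1)

/-- `V φ q = E[φ(z)²]` for `z ∼ N(0, q)`. -/
def V (φ : ℝ → ℝ) (q : ℝ≥0) : ℝ :=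
  ∫ z, φ z ^ 2 ∂(gaussianReal 0 q)

/-- `W φ ρ ν = E[φ(z) φ(z')]` for a centred Gaussian pair `(z, z')` with variances `ρ` and
covariance `ν`. -/
def W (φ : ℝ → ℝ) (ρ ν : ℝ) : ℝ :=
  ∫ z : EuclideanSpace ℝ (Fin 2), φ (z 0) * φ (z 1) ∂(multivariateGaussian 0 !![ρ, ν; ν, ρ])

/-- The weight matrix and the bias vector of one layer of width `N`. -/
abbrev Layer (N : ℕ) : Type := (Fin N → Fin N → ℝ) × (Fin N → ℝ)

/-- The law of the parameters of one layer: all entries are independent, the weights are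
`N(0, σw² / N)` and the biases are `N(0, σb²)`. -/
def layerLaw (σw σb : ℝ≥0) (N : ℕ) : Measure (Layer N) :=
  (Measure.pi fun _ : Fin N => Measure.pi fun _ : Fin N => gaussianReal 0 (σw ^ 2 / (N : ℝ≥0))).prod
    (Measure.pi fun _ : Fin N => gaussianReal 0 (σb ^ 2))

instance (σw σb : ℝ≥0) (N : ℕ) : IsProbabilityMeasure (layerLaw σw σb N) := by
  unfold layerLaw
  infer_instance

/-- The law of the parameters of a network of width `N`: the layers are independent and
identically distributed. The entry of index `l` holds the parameters of layer `l + 1`. -/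
def initLaw (σw σb : ℝ≥0) (N : ℕ) : Measure (ℕ → Layer N) :=
  Measure.infinitePi fun _ : ℕ => layerLaw σw σb N

/-- The affine map `h_i = ∑ j, w_ij x_j + b_i` of one layer. -/
def affine {N : ℕ} (θ : Layer N) (x : Fin N → ℝ) : Fin N → ℝ :=
  fun i => ∑ j, θ.1 i j * x j + θ.2 i

/-- The activation vector `x^(l)` of a reduced residual network with input `x`:
`x^(0) = x` and `x^(l+1) = φ(h^(l+1)) + x^(l)`. -/
def act (φ : ℝ → ℝ) {N : ℕ} (θ : ℕ → Layer N) (x : Fin N → ℝ) : ℕ → Fin N → ℝ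
  | 0 => x
  | l + 1 => fun i => φ (affine (θ l) (act φ θ x l) i) + act φ θ x l i

/-- The preactivation vector `h^(l+1)` (the argument `l` stands for layer `l + 1`). -/
def preact (φ : ℝ → ℝ) {N : ℕ} (θ : ℕ → Layer N) (x : Fin N → ℝ) (l : ℕ) : Fin N → ℝ :=
  affine (θ l) (act φ θ x l)

/-- `E[x^(l) · x'^(l)] / N` at width `N`, both inputs going through the same random network.
For `x' = x` it is the normalized expected squared length. -/
def actCorr (φ : ℝ → ℝ) (σw σb : ℝ≥0) {N : ℕ} (x x' : Fin N → ℝ) (l : ℕ) : ℝ :=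
  (∫ θ, act φ θ x l ⬝ᵥ act φ θ x' l ∂(initLaw σw σb N)) / N

/-- `E[h^(l+1) · h'^(l+1)] / N` at width `N`. -/
def preactCorr (φ : ℝ → ℝ) (σw σb : ℝ≥0) {N : ℕ} (x x' : Fin N → ℝ) (l : ℕ) : ℝ :=
  (∫ θ, preact φ θ x l ⬝ᵥ preact φ θ x' l ∂(initLaw σw σb N)) / N

/-- `p`, `p'` are the large-width length quantities of the two inputs, `γ` is the large-width
correlation of the activations and `lam` that of the preactivations (at the layers `l ≥ 1`, where
preactivations exist; `lam 0` has no meaning). -/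
structure IsLargeWidthLimit (φ : ℝ → ℝ) (σw σb : ℝ≥0) (x x' : (N : ℕ) → Fin N → ℝ)
    (p p' γ lam : ℕ → ℝ) : Prop where
  length : ∀ l, Tendsto (fun N => actCorr φ σw σb (x N) (x N) l) atTop (𝓝 (p l))
  length' : ∀ l, Tendsto (fun N => actCorr φ σw σb (x' N) (x' N) l) atTop (𝓝 (p' l))
  corr : ∀ l, Tendsto (fun N => actCorr φ σw σb (x N) (x' N) l) atTop (𝓝 (γ l))
  preCorr : ∀ l, Tendsto (fun N => preactCorr φ σw σb (x N) (x' N) l) atTop (𝓝 (lam (l + 1)))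

/-- The cosine distance `e^(l) = γ^(l) / √(p^(l) p'^(l))`. -/
def cosDist (p p' γ : ℕ → ℝ) (l : ℕ) : ℝ := γ l / √(p l * p' l)

/-- The metric expressivity `s^(l) = (p^(l) + p'^(l)) / 2 - γ^(l)`. -/
def metricExpr (p p' γ : ℕ → ℝ) (l : ℕ) : ℝ := (p l + p' l) / 2 - γ l

/-- `f = Θ̌(g)`: for every `ε > 0`, `f(l) = O(g(l) l^ε)` and `f(l) = Ω(g(l) l^(-ε))`. -/
def IsThetaCheck (f g : ℕ → ℝ) : Prop :=
  ∀ ε : ℝ, 0 < ε →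
    f =O[atTop] (fun l : ℕ => g l * (l : ℝ) ^ ε) ∧
    (fun l : ℕ => g l * (l : ℝ) ^ (-ε)) =O[atTop] f

end RRN

end

/-! The randomness enters through one layer at a time. Given the activations of a layer, the neurons
of the next one are independent, and the preactivations of the two inputs at each neuron form a
centred Gaussian pair. Since `φ` is odd, the cross terms between `φ(h)` and the old activation have
mean zero, so the conditional mean of the next normalized dot product is the old one plus `W2`. Its
conditional variance is `O(1/N)`, so induction on the layer gives mean-square convergence to
deterministic sequences (`mse_succ_le`, `tendsto_mse`). With `q = σw² p + σb²`, `c = σw² γ + σb²`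
these obey `p⁺ = p + W(q, q)`, `γ⁺ = γ + W(q, c)`. For `σw = 0` both are arithmetic progressions
with the same step.

For `σw > 0`, multiplication by `w = σw²` gives a closed recurrence for `(q, c)`, called `PreRec`.
As `W(q, q) → 1`, a Cesàro mean yields `q ~ w l`. The gap `q - c` grows linearly: one step adds at
least a constant times `√((q - c) / q)` (`exists_sqrt_le_W_diag_sub_W`), which reproduces a bound `k
(l + 1)` by induction when `k` is small. Hence `c / q` stays below some `ρ₁ < 1`.

The exponent `2/π` is the slope at `0` of the sign correlation `(2/π) arcsin ρ`. On the half-line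
`φ` lies below the sign function and, after scaling by a large `√q`, above nearly full step
functions with small threshold. Gaussian correlations of such odd functions are monotone in the
function when `ρ ≥ 0` (`OddPos.integral_mul_mono`). The upper comparison first gives a factor below
`1` on `[0, ρ₁]`, hence `c = O(l^a)` with `a < 1` and `c / q → 0`. For small ratios both comparisons
have slope near `2/π`, so `c⁺ ≈ c (1 + (2/π) / l)` and `c` grows like `l^(2/π)` up to `l^ε`. Signs
are harmless, because `W` is odd in the covariance and `|c|` satisfies the same recurrence. -/

noncomputable section

namespace RRN

/-! ### Gaussian pairs in coordinates -/

/-- `E[φ(z) φ(z')]` for a centred Gaussian pair with variances `q`, `q'` and covariance `c`. -/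
def W2 (φ : ℝ → ℝ) (q q' c : ℝ) : ℝ :=
  ∫ z : EuclideanSpace ℝ (Fin 2), φ (z 0) * φ (z 1) ∂(multivariateGaussian 0 !![q, c; c, q'])

/-- The standard Gaussian measure on the line. -/
abbrev stdG : Measure ℝ := gaussianReal 0 1

theorem W_eq_W2 (φ : ℝ → ℝ) (q c : ℝ) : W φ q c = W2 φ q q c := rfl

theorem posSemidef_two {A B C : ℝ}
    (h : ∀ s t : ℝ, 0 ≤ s ^ 2 * A + 2 * s * t * B + t ^ 2 * C) :
    (!![A, B; B, C] : Matrix (Fin 2) (Fin 2) ℝ).PosSemidef := by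
  refine .of_dotProduct_mulVec_nonneg ?_ fun x => ?_
  · ext i j
    fin_cases i <;> fin_cases j <;> simp
  · have := h (x 0) (x 1)
    simp [Matrix.mulVec, dotProduct, Fin.sum_univ_two]
    linarith

/-- A pair of random variables whose joint characteristic function is that of a centred Gaussian
pair is such a pair. -/
theorem map_eq_multivariateGaussian {Ω : Type*} [MeasurableSpace Ω] (P : Measure Ω)
    [IsProbabilityMeasure P] {X Y : Ω → ℝ} (hX : Measurable X) (hY : Measurable Y) {A B C : ℝ}
    (hpos : ∀ s t : ℝ, 0 ≤ s ^ 2 * A + 2 * s * t * B + t ^ 2 * C)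
    (h : ∀ s t : ℝ, ∫ ω, Complex.exp ((s * X ω + t * Y ω : ℝ) * Complex.I) ∂P =
      Complex.exp (-((s ^ 2 * A + 2 * s * t * B + t ^ 2 * C : ℝ) / 2))) :
    P.map (fun ω => (!₂[X ω, Y ω] : EuclideanSpace ℝ (Fin 2))) =
      multivariateGaussian 0 !![A, B; B, C] := by
  have hm : Measurable (fun ω => (!₂[X ω, Y ω] : EuclideanSpace ℝ (Fin 2))) := by
    refine (WithLp.measurable_toLp 2 _).comp (measurable_pi_iff.2 fun i => ?_)
    fin_cases i <;> simpa
  have : IsProbabilityMeasure (P.map (fun ω => (!₂[X ω, Y ω] : EuclideanSpace ℝ (Fin 2)))) :=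
    Measure.isProbabilityMeasure_map hm.aemeasurable
  refine Measure.ext_of_charFun (funext fun t => ?_)
  rw [charFun_multivariateGaussian (posSemidef_two hpos), charFun_apply,
    integral_map hm.aemeasurable (by fun_prop)]
  convert h (t 0) (t 1) using 2
  · ext ω
    simp [PiLp.inner_apply, Fin.sum_univ_two]
  · simp [Matrix.mulVec, dotProduct, Fin.sum_univ_two]
    ring

theorem integral_exp_gaussianReal (v : ℝ≥0) (t : ℝ) :
    ∫ x, Complex.exp ((t * x : ℝ) * Complex.I) ∂(gaussianReal 0 v) =
      Complex.exp (-((v * t ^ 2 : ℝ) / 2)) := by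
  have := charFun_gaussianReal (μ := 0) (v := v) t
  rw [charFun_apply_real] at this
  push_cast at this ⊢
  rw [this]
  congr 1
  ring

theorem W2_eq_integral_of_map {Ω : Type*} [MeasurableSpace Ω] (P : Measure Ω)
    [IsProbabilityMeasure P] {X Y : Ω → ℝ} (hX : Measurable X) (hY : Measurable Y) {A B C : ℝ}
    (hpos : ∀ s t : ℝ, 0 ≤ s ^ 2 * A + 2 * s * t * B + t ^ 2 * C)
    (h : ∀ s t : ℝ, ∫ ω, Complex.exp ((s * X ω + t * Y ω : ℝ) * Complex.I) ∂P =
      Complex.exp (-((s ^ 2 * A + 2 * s * t * B + t ^ 2 * C : ℝ) / 2)))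
    {φ : ℝ → ℝ} (hφ : Measurable φ) :
    W2 φ A C B = ∫ ω, φ (X ω) * φ (Y ω) ∂P := by
  have hm : Measurable (fun ω => (!₂[X ω, Y ω] : EuclideanSpace ℝ (Fin 2))) := by
    refine (WithLp.measurable_toLp 2 _).comp (measurable_pi_iff.2 fun i => ?_)
    fin_cases i <;> simpa
  rw [W2, ← map_eq_multivariateGaussian P hX hY hpos h, integral_map hm.aemeasurable]
  · simp
  · exact ((hφ.comp (by fun_prop)).mul (hφ.comp (by fun_prop))).aestronglyMeasurable

/-- Every factorization of the covariance matrix gives a realization of the pair by two independent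
standard Gaussians. Different factorizations serve different estimates below. -/
theorem W2_eq_integral_prod {φ : ℝ → ℝ} (hφ : Measurable φ) (a b c d : ℝ) :
    W2 φ (a ^ 2 + b ^ 2) (c ^ 2 + d ^ 2) (a * c + b * d) =
      ∫ p : ℝ × ℝ, φ (a * p.1 + b * p.2) * φ (c * p.1 + d * p.2) ∂(stdG.prod stdG) := by
  refine W2_eq_integral_of_map (stdG.prod stdG) (X := fun p => a * p.1 + b * p.2)
    (Y := fun p => c * p.1 + d * p.2) (by fun_prop) (by fun_prop) (fun s t => ?_) (fun s t => ?_) hφ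
  · nlinarith [sq_nonneg (s * a + t * c), sq_nonneg (s * b + t * d)]
  · have e : ∀ p : ℝ × ℝ, Complex.exp ((s * (a * p.1 + b * p.2) + t * (c * p.1 + d * p.2) : ℝ)
        * Complex.I) = Complex.exp (((s * a + t * c) * p.1 : ℝ) * Complex.I) *
          Complex.exp (((s * b + t * d) * p.2 : ℝ) * Complex.I) := by
      intro p
      rw [← Complex.exp_add]
      congr 1
      push_cast
      ring
    simp_rw [e]
    rw [integral_prod_mul (fun x : ℝ => Complex.exp (((s * a + t * c) * x : ℝ) * Complex.I))
      (fun x : ℝ => Complex.exp (((s * b + t * d) * x : ℝ) * Complex.I)),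
      integral_exp_gaussianReal, integral_exp_gaussianReal, ← Complex.exp_add]
    congr 1
    push_cast
    ring

/-! ### The Gaussian pair at one neuron -/

/-- The law of the parameters of one neuron: its incoming weights and its bias. -/
def rowLaw (σw σb : ℝ≥0) (N : ℕ) : Measure ((Fin N → ℝ) × ℝ) :=
  (Measure.pi fun _ : Fin N => gaussianReal 0 (σw ^ 2 / (N : ℝ≥0))).prod (gaussianReal 0 (σb ^ 2))

instance (σw σb : ℝ≥0) (N : ℕ) : IsProbabilityMeasure (rowLaw σw σb N) := by
  unfold rowLaw
  infer_instance

/-- The preactivation of one neuron. -/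
def neuron {N : ℕ} (r : (Fin N → ℝ) × ℝ) (x : Fin N → ℝ) : ℝ := ∑ j, r.1 j * x j + r.2

theorem measurable_neuron {N : ℕ} (x : Fin N → ℝ) :
    Measurable fun r : (Fin N → ℝ) × ℝ => neuron r x := by
  unfold neuron
  fun_prop

/-- The covariance of the preactivations of two inputs at one neuron. -/
def preCov (σw σb : ℝ≥0) {N : ℕ} (x y : Fin N → ℝ) : ℝ :=
  (σw : ℝ) ^ 2 * ((x ⬝ᵥ y) / N) + (σb : ℝ) ^ 2

theorem preCov_quadratic (σw σb : ℝ≥0) {N : ℕ} (x y : Fin N → ℝ) (s t : ℝ) :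
    s ^ 2 * preCov σw σb x x + 2 * s * t * preCov σw σb x y + t ^ 2 * preCov σw σb y y =
      (σw : ℝ) ^ 2 / N * ∑ j, (s * x j + t * y j) ^ 2 + (σb : ℝ) ^ 2 * (s + t) ^ 2 := by
  have : ∑ j, (s * x j + t * y j) ^ 2 =
      s ^ 2 * (x ⬝ᵥ x) + 2 * s * t * (x ⬝ᵥ y) + t ^ 2 * (y ⬝ᵥ y) := by
    simp only [dotProduct, Finset.mul_sum, ← Finset.sum_add_distrib]
    exact Finset.sum_congr rfl fun j _ => by ring
  rw [this]
  unfold preCov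
  ring

theorem integral_exp_neuron (σw σb : ℝ≥0) {N : ℕ} (x y : Fin N → ℝ) (s t : ℝ) :
    ∫ r, Complex.exp ((s * neuron r x + t * neuron r y : ℝ) * Complex.I) ∂(rowLaw σw σb N) =
      Complex.exp (-((s ^ 2 * preCov σw σb x x + 2 * s * t * preCov σw σb x y +
        t ^ 2 * preCov σw σb y y : ℝ) / 2)) := by
  have e : ∀ r : (Fin N → ℝ) × ℝ,
      Complex.exp ((s * neuron r x + t * neuron r y : ℝ) * Complex.I) =
      (∏ j, Complex.exp (((s * x j + t * y j) * r.1 j : ℝ) * Complex.I)) *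
        Complex.exp (((s + t) * r.2 : ℝ) * Complex.I) := by
    intro r
    rw [← Complex.exp_sum, ← Complex.exp_add, ← Finset.sum_mul, ← Complex.ofReal_sum, ← add_mul,
      ← Complex.ofReal_add]
    congr 3
    simp only [neuron, mul_add, Finset.mul_sum, add_mul, Finset.sum_add_distrib]
    have h1 : ∀ j, s * x j * r.1 j = s * (r.1 j * x j) := fun j => by ring
    have h2 : ∀ j, t * y j * r.1 j = t * (r.1 j * y j) := fun j => by ring
    simp only [h1, h2]
    ring
  simp_rw [e, rowLaw]
  rw [integral_prod_mul
      (fun w : Fin N → ℝ => ∏ j, Complex.exp (((s * x j + t * y j) * w j : ℝ) * Complex.I))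
      (fun b : ℝ => Complex.exp (((s + t) * b : ℝ) * Complex.I)),
    integral_fintype_prod_eq_prod
      (fun j (w : ℝ) => Complex.exp (((s * x j + t * y j) * w : ℝ) * Complex.I))]
  simp_rw [integral_exp_gaussianReal]
  rw [← Complex.exp_sum, ← Complex.exp_add, preCov_quadratic]
  congr 1
  push_cast
  rw [Finset.sum_neg_distrib, ← Finset.sum_div, ← Finset.mul_sum]
  ring

theorem integral_mul_neuron {φ : ℝ → ℝ} (hφ : Measurable φ) (σw σb : ℝ≥0) {N : ℕ}
    (x y : Fin N → ℝ) :
    ∫ r, φ (neuron r x) * φ (neuron r y) ∂(rowLaw σw σb N) =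
      W2 φ (preCov σw σb x x) (preCov σw σb y y) (preCov σw σb x y) := by
  refine (W2_eq_integral_of_map _ (measurable_neuron x) (measurable_neuron y) (fun s t => ?_)
    (integral_exp_neuron σw σb x y) hφ).symm
  rw [preCov_quadratic]
  positivity

/-! ### Elementary properties of tanh-like functions -/

namespace TanhLike

variable {φ : ℝ → ℝ}

theorem measurable (hφ : TanhLike φ) : Measurable φ := hφ.monotone.measurable

theorem map_zero (hφ : TanhLike φ) : φ 0 = 0 := by
  have := hφ.odd 0
  rw [neg_zero] at this
  linarith

theorem le_one (hφ : TanhLike φ) (x : ℝ) : φ x ≤ 1 := (abs_le.1 (hφ.abs_le_one x)).2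

theorem neg_one_le (hφ : TanhLike φ) (x : ℝ) : -1 ≤ φ x := (abs_le.1 (hφ.abs_le_one x)).1

theorem abs_mul_le_one (hφ : TanhLike φ) (x y : ℝ) : |φ x * φ y| ≤ 1 := by
  rw [abs_mul]
  exact mul_le_one₀ (hφ.abs_le_one x) (abs_nonneg _) (hφ.abs_le_one y)

theorem apply_abs (hφ : TanhLike φ) (x : ℝ) : φ |x| = |φ x| := by
  rcases le_total 0 x with h | h
  · rw [abs_of_nonneg h, abs_of_nonneg (hφ.nonneg x h)]
  · have := hφ.nonneg (-x) (by linarith)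
    rw [abs_of_nonpos h, hφ.odd, abs_of_nonpos]
    rw [hφ.odd] at this
    linarith

theorem exists_le (hφ : TanhLike φ) {a : ℝ} (ha : a < 1) : ∃ T, 0 < T ∧ a ≤ φ T := by
  have h1 := hφ.tendsto_one.eventually (eventually_ge_nhds ha)
  obtain ⟨T, h, h'⟩ := (h1.and (eventually_gt_atTop 0)).exists
  exact ⟨T, h', h⟩

theorem integrable_mul_comp (hφ : TanhLike φ) {Ω : Type*} [MeasurableSpace Ω] {P : Measure Ω}
    [IsFiniteMeasure P] {X Y : Ω → ℝ} (hX : Measurable X) (hY : Measurable Y) :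
    Integrable (fun ω => φ (X ω) * φ (Y ω)) P :=
  .of_bound ((hφ.measurable.comp hX).mul (hφ.measurable.comp hY)).aestronglyMeasurable 1
    (.of_forall fun _ => hφ.abs_mul_le_one _ _)

theorem integrable_sq_comp (hφ : TanhLike φ) {Ω : Type*} [MeasurableSpace Ω] {P : Measure Ω}
    [IsFiniteMeasure P] {X : Ω → ℝ} (hX : Measurable X) :
    Integrable (fun ω => φ (X ω) ^ 2) P := by
  simp_rw [sq]
  exact hφ.integrable_mul_comp hX hX

theorem abs_W2_le_one (hφ : TanhLike φ) (q q' c : ℝ) : |W2 φ q q' c| ≤ 1 := by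
  have h : ∀ z : EuclideanSpace ℝ (Fin 2), ‖φ (z 0) * φ (z 1)‖ ≤ 1 :=
    fun z => hφ.abs_mul_le_one _ _
  have := norm_integral_le_of_norm_le_const
    (μ := multivariateGaussian 0 !![q, c; c, q']) (.of_forall h)
  simpa [W2] using this

theorem integrable_half_sub_sq (hφ : TanhLike φ) {Ω : Type*} [MeasurableSpace Ω] {P : Measure Ω}
    [IsFiniteMeasure P] {X Y : Ω → ℝ} (hX : Measurable X) (hY : Measurable Y) :
    Integrable (fun ω => 1 / 2 * (φ (X ω) - φ (Y ω)) ^ 2) P := by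
  refine Integrable.of_bound (C := 2) ((((hφ.measurable.comp hX).sub
    (hφ.measurable.comp hY)).pow_const 2).const_mul _).aestronglyMeasurable (.of_forall fun p => ?_)
  have := hφ.le_one (X p)
  have := hφ.neg_one_le (X p)
  have := hφ.le_one (Y p)
  have := hφ.neg_one_le (Y p)
  rw [Real.norm_eq_abs, abs_of_nonneg (by positivity)]
  nlinarith

theorem integral_half_sub_sq (hφ : TanhLike φ) {Ω : Type*} [MeasurableSpace Ω] {P : Measure Ω}
    [IsFiniteMeasure P] {X Y : Ω → ℝ} (hX : Measurable X) (hY : Measurable Y) :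
    ∫ ω, 1 / 2 * (φ (X ω) - φ (Y ω)) ^ 2 ∂P = (1 / 2 * ∫ ω, φ (X ω) * φ (X ω) ∂P +
      1 / 2 * ∫ ω, φ (Y ω) * φ (Y ω) ∂P) - ∫ ω, φ (X ω) * φ (Y ω) ∂P := by
  have h : (fun ω => 1 / 2 * (φ (X ω) - φ (Y ω)) ^ 2) = fun ω =>
      (1 / 2 * (φ (X ω) * φ (X ω)) + 1 / 2 * (φ (Y ω) * φ (Y ω))) - φ (X ω) * φ (Y ω) := by
    ext ω
    ring
  have j1 := (hφ.integrable_mul_comp (P := P) hX hX).const_mul (1 / 2)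
  have j2 := (hφ.integrable_mul_comp (P := P) hY hY).const_mul (1 / 2)
  rw [h, integral_sub (by exact j1.add j2) (hφ.integrable_mul_comp hX hY), integral_add j1 j2,
    integral_const_mul, integral_const_mul]

end TanhLike

variable {φ : ℝ → ℝ}

/-! ### The second moment `W φ q q` -/

theorem measurePreserving_const_mul_stdG {r : ℝ} {q : ℝ≥0} (h : r ^ 2 = q) :
    MeasurePreserving (fun x => r * x) stdG (gaussianReal 0 q) where
  measurable := by fun_prop
  map_eq := by
    rw [gaussianReal_map_const_mul]
    congr 1
    · simp
    · ext
      simp [h]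

theorem W_diag_eq_integral (hφ : TanhLike φ) (r : ℝ) :
    W φ (r ^ 2) (r ^ 2) = ∫ x, φ (r * x) ^ 2 ∂stdG := by
  have h := W2_eq_integral_prod hφ.measurable r 0 r 0
  have e : r * r = r ^ 2 := by ring
  simp only [ne_eq, OfNat.ofNat_ne_zero, not_false_eq_true, zero_pow, add_zero,
    zero_mul, ← sq] at h
  rw [W_eq_W2, h, integral_prod _ (hφ.integrable_sq_comp (by fun_prop))]
  simp

theorem W_diag_eq_V (hφ : TanhLike φ) (q : ℝ≥0) : W φ q q = V φ q := by
  have h : (√(q : ℝ)) ^ 2 = q := Real.sq_sqrt q.2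
  have := W_diag_eq_integral hφ √(q : ℝ)
  rw [h] at this
  rw [this, V, ← (measurePreserving_const_mul_stdG h).map_eq, integral_map (by fun_prop)]
  exact (hφ.measurable.pow_const 2).aestronglyMeasurable

theorem W_diag_mono (hφ : TanhLike φ) {q q' : ℝ} (hq : 0 ≤ q) (h : q ≤ q') :
    W φ q q ≤ W φ q' q' := by
  rw [← Real.sq_sqrt hq, ← Real.sq_sqrt (hq.trans h), W_diag_eq_integral hφ,
    W_diag_eq_integral hφ]
  refine integral_mono (hφ.integrable_sq_comp (by fun_prop)) (hφ.integrable_sq_comp (by fun_prop))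
    fun x => ?_
  simp only
  rw [sq_le_sq, ← hφ.apply_abs, ← hφ.apply_abs, abs_mul, abs_mul]
  refine hφ.monotone ?_
  gcongr

theorem W_diag_le_one (hφ : TanhLike φ) (q : ℝ) : W φ q q ≤ 1 :=
  (abs_le.1 (hφ.abs_W2_le_one q q q)).2

theorem W_diag_nonneg (hφ : TanhLike φ) {q : ℝ} (hq : 0 ≤ q) : 0 ≤ W φ q q := by
  rw [← Real.sq_sqrt hq, W_diag_eq_integral hφ]
  positivity

theorem stdG_Ici_pos (a : ℝ) : 0 < stdG (Set.Ici a) := by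
  have h := gaussianReal_absolutelyContinuous' 0 (v := 1) one_ne_zero
  refine pos_iff_ne_zero.2 fun h0 => ?_
  simpa using h h0

theorem W_diag_pos (hφ : TanhLike φ) {q : ℝ} (hq : 0 < q) : 0 < W φ q q := by
  rw [← Real.sq_sqrt hq.le, W_diag_eq_integral hφ, integral_pos_iff_support_of_nonneg
    (fun x => sq_nonneg _) (hφ.integrable_sq_comp (by fun_prop))]
  obtain ⟨T, hT, h⟩ := hφ.exists_le (a := 1 / 2) (by norm_num)
  refine (stdG_Ici_pos (T / √q)).trans_le (measure_mono fun x hx => ?_)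
  have hr : 0 < √q := Real.sqrt_pos.2 hq
  have : T ≤ √q * x := by
    rw [Set.mem_Ici, div_le_iff₀ hr] at hx
    linarith
  have := hφ.monotone this
  simp only [Function.mem_support]
  have : 0 < φ (√q * x) := by linarith
  positivity

/-- Off the null set `x = 0`, `φ(√q x)²` tends to `1`; dominated convergence does the rest. -/
theorem tendsto_W_diag (hφ : TanhLike φ) : Tendsto (fun q => W φ q q) atTop (𝓝 1) := by
  have h : Tendsto (fun q : ℝ => ∫ x, φ (√q * x) ^ 2 ∂stdG) atTop (𝓝 (∫ _, (1 : ℝ) ∂stdG)) := by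
    refine tendsto_integral_filter_of_dominated_convergence (fun _ => 1)
      (.of_forall fun q => (hφ.integrable_sq_comp (by fun_prop)).aestronglyMeasurable)
      (.of_forall fun q => .of_forall fun x => ?_) (integrable_const _) ?_
    · simpa using hφ.abs_le_one _
    · have : ∀ᵐ x ∂stdG, x ≠ 0 := by
        have := nullSingletonClass_gaussianReal (μ := 0) (v := 1) one_ne_zero
        simp [ae_iff]
      filter_upwards [this] with x hx
      have h1 : Tendsto (fun q : ℝ => √q * |x|) atTop atTop :=
        Real.tendsto_sqrt_atTop.atTop_mul_const (abs_pos.2 hx)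
      have h2 := (hφ.tendsto_one.comp h1).pow 2
      rw [one_pow] at h2
      refine h2.congr fun q => ?_
      simp only [Function.comp]
      rw [← abs_of_nonneg (Real.sqrt_nonneg q), ← abs_mul, hφ.apply_abs, sq_abs,
        abs_of_nonneg (Real.sqrt_nonneg q)]
  simp only [integral_const, probReal_univ, smul_eq_mul, mul_one] at h
  refine h.congr' ?_
  filter_upwards [eventually_ge_atTop 0] with q hq
  rw [← W_diag_eq_integral hφ, Real.sq_sqrt hq]

/-! ### Symmetric coordinates and the gap `W φ q q - W φ q c` -/

/-- For equal variances the half-sum and half-difference of the pair are independent. These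
coordinates isolate `z - z'`, whose size governs the gap. -/
theorem W_eq_integral_symm {φ : ℝ → ℝ} (hφ : Measurable φ) {q c : ℝ} (h : |c| ≤ q) :
    W φ q c = ∫ p : ℝ × ℝ, φ (√((q + c) / 2) * p.1 + √((q - c) / 2) * p.2) *
      φ (√((q + c) / 2) * p.1 + -√((q - c) / 2) * p.2) ∂(stdG.prod stdG) := by
  obtain ⟨h1, h2⟩ := abs_le.1 h
  rw [← W2_eq_integral_prod hφ, W_eq_W2]
  have e1 := Real.sq_sqrt (show 0 ≤ (q + c) / 2 by linarith)
  have e2 := Real.sq_sqrt (show 0 ≤ (q - c) / 2 by linarith)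
  congr 1 <;> nlinarith

/-- Replacing `z'` by `-z'` flips the covariance and, `φ` being odd, the sign of the product. -/
theorem W_neg (hφ : TanhLike φ) {q c : ℝ} (h : |c| ≤ q) : W φ q (-c) = -W φ q c := by
  obtain ⟨h1, h2⟩ := abs_le.1 h
  have e1 := Real.sq_sqrt (show 0 ≤ (q + c) / 2 by linarith)
  have e2 := Real.sq_sqrt (show 0 ≤ (q - c) / 2 by linarith)
  have := W2_eq_integral_prod hφ.measurable (√((q + c) / 2)) (√((q - c) / 2)) (-√((q + c) / 2))
    (√((q - c) / 2))
  rw [W_eq_integral_symm hφ.measurable h, ← integral_neg, W_eq_W2]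
  convert this using 1
  · congr 1 <;> nlinarith
  · congr 1
    ext p
    rw [← mul_neg, ← hφ.odd]
    congr 2
    ring

/-- Both marginals have variance `q`, so expanding the square gives the gap; as an integral of a
nonnegative function it can be bounded below on any chosen event. -/
theorem W_diag_sub_W_eq (hφ : TanhLike φ) {q c : ℝ} (hc : |c| ≤ q) :
    W φ q q - W φ q c = ∫ p : ℝ × ℝ, 1 / 2 * (φ (√((q + c) / 2) * p.1 + √((q - c) / 2) * p.2) -
      φ (√((q + c) / 2) * p.1 + -√((q - c) / 2) * p.2)) ^ 2 ∂(stdG.prod stdG) := by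
  obtain ⟨h1, h2⟩ := abs_le.1 hc
  set α := √((q + c) / 2) with hα
  set β := √((q - c) / 2) with hβ
  have e1 : α ^ 2 = (q + c) / 2 := Real.sq_sqrt (by linarith)
  have e2 : β ^ 2 = (q - c) / 2 := Real.sq_sqrt (by linarith)
  have hd1 := W2_eq_integral_prod hφ.measurable α β α β
  have hd2 := W2_eq_integral_prod hφ.measurable α (-β) α (-β)
  have i1 : α ^ 2 + β ^ 2 = q := by linarith
  have i2 : α ^ 2 + (-β) ^ 2 = q := by linarith [neg_sq β]
  have i3 : α * α + β * β = q := by linarith [sq α, sq β]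
  have i4 : α * α + -β * -β = q := by linarith [sq α, sq β]
  rw [i1, i3, ← W_eq_W2] at hd1
  rw [i2, i4, ← W_eq_W2] at hd2
  rw [hφ.integral_half_sub_sq (by fun_prop) (by fun_prop), ← hd1, ← hd2,
    ← W_eq_integral_symm hφ.measurable hc]
  ring

theorem W_le_W_diag (hφ : TanhLike φ) {q c : ℝ} (hc : |c| ≤ q) : W φ q c ≤ W φ q q := by
  have := W_diag_sub_W_eq hφ hc
  have : 0 ≤ W φ q q - W φ q c := by
    rw [this]
    exact integral_nonneg fun p => by positivity
  linarith

theorem abs_W_le_W_diag (hφ : TanhLike φ) {q c : ℝ} (hc : |c| ≤ q) : |W φ q c| ≤ W φ q q := by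
  refine abs_le.2 ⟨?_, W_le_W_diag hφ hc⟩
  have := W_le_W_diag hφ (q := q) (c := -c) (by rwa [abs_neg])
  rw [W_neg hφ hc] at this
  linarith

theorem stdG_Icc_ge {r : ℝ} (h0 : 0 ≤ r) (h1 : r ≤ 1) :
    2 * gaussianPDFReal 0 1 1 * r ≤ stdG.real (Set.Icc (-r) r) := by
  rw [measureReal_def, gaussianReal_apply_eq_integral _ one_ne_zero, ENNReal.toReal_ofReal
    (integral_nonneg fun x => gaussianPDFReal_nonneg _ _ _)]
  have : ∫ _ in Set.Icc (-r) r, gaussianPDFReal 0 1 1 = 2 * gaussianPDFReal 0 1 1 * r := by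
    simp
    rw [max_eq_left (by linarith)]
    ring
  rw [← this]
  refine setIntegral_mono_on (by simp) (integrable_gaussianPDFReal 0 1).integrableOn
    measurableSet_Icc fun x hx => ?_
  rw [gaussianPDFReal, gaussianPDFReal]
  have := abs_le.2 ⟨hx.1, hx.2⟩
  have : x ^ 2 ≤ 1 := by rw [sq_le_one_iff_abs_le_one]; linarith
  have : -(1 - 0) ^ 2 / (2 * ((1 : ℝ≥0) : ℝ)) ≤ -(x - 0) ^ 2 / (2 * ((1 : ℝ≥0) : ℝ)) := by
    simp only [NNReal.coe_one]
    linarith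
  gcongr

/-- The expressivity gain of one layer is at least of the order of the square root of `1 - e`. -/
theorem exists_sqrt_le_W_diag_sub_W (hφ : TanhLike φ) {s₀ : ℝ} (hs : 0 < s₀) :
    ∃ κ > 0, ∀ q c, |c| ≤ q → s₀ ≤ q - c → κ * √((q - c) / q) ≤ W φ q q - W φ q c := by
  obtain ⟨T, hT, hφT⟩ := hφ.exists_le (a := 1 / 2) (by norm_num)
  have hβ₀ : 0 < √(s₀ / 2) := Real.sqrt_pos.2 (by positivity)
  -- Since `β ≥ √(s₀ / 2)`, this threshold ensures `β y ≥ T + β` for `y ≥ A`; the probability `κ` of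
  -- that event does not depend on `q` and `c`.
  set A := T / √(s₀ / 2) + 1 with hA
  set κ := stdG.real (Set.Ici A) with hκ
  have hκ0 : 0 < κ := by
    rw [hκ, measureReal_def]
    exact ENNReal.toReal_pos (stdG_Ici_pos A).ne' (measure_ne_top _ _)
  have hg : 0 < gaussianPDFReal 0 1 1 := gaussianPDFReal_pos 0 1 1 one_ne_zero
  refine ⟨1 / 2 * (2 * gaussianPDFReal 0 1 1 * (1 / √2)) * κ, by positivity, fun q c hc hs' => ?_⟩
  obtain ⟨h1, h2⟩ := abs_le.1 hc
  have hq : 0 < q := by linarith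
  set α := √((q + c) / 2) with hα
  set β := √((q - c) / 2) with hβ
  have e1 : α ^ 2 = (q + c) / 2 := Real.sq_sqrt (by linarith)
  have e2 : β ^ 2 = (q - c) / 2 := Real.sq_sqrt (by linarith)
  have hα0 : 0 ≤ α := Real.sqrt_nonneg _
  have hββ : √(s₀ / 2) ≤ β := Real.sqrt_le_sqrt (by linarith)
  have hβ0 : 0 < β := hβ₀.trans_le hββ
  -- Chosen so that `r² = β² / q`; as `α² ≤ q`, `|x| ≤ r` forces `|α x| ≤ β`. On `S` then `z ≥ T`
  -- and `z' ≤ -T`, so the values of `φ` differ by at least `1`. The probability of `|x| ≤ r`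
  -- supplies the square root.
  set r := √((q - c) / q) * (1 / √2) with hr
  have hr0 : 0 ≤ r := by positivity
  have hrsq : r ^ 2 = β ^ 2 / q := by
    rw [hr, mul_pow, Real.sq_sqrt (div_nonneg (by linarith) hq.le), div_pow,
      Real.sq_sqrt (by norm_num), e2]
    field_simp
  have hr1 : r ≤ 1 := by
    rw [← abs_of_nonneg hr0, ← sq_le_one_iff_abs_le_one, hrsq, div_le_one hq, e2]
    linarith
  set S : Set (ℝ × ℝ) := Set.Icc (-r) r ×ˢ Set.Ici A with hS
  have hSm : MeasurableSet S := measurableSet_Icc.prod measurableSet_Ici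
  have hSmeas : (stdG.prod stdG).real S = stdG.real (Set.Icc (-r) r) * κ := by
    rw [measureReal_def, hS, Measure.prod_prod, ENNReal.toReal_mul]
    rfl
  have hαr : α * r ≤ β := by
    refine abs_le_of_sq_le_sq' ?_ hβ0.le |>.2
    rw [mul_pow, hrsq, e1]
    rw [mul_div_assoc', div_le_iff₀ hq]
    nlinarith [sq_nonneg β]
  have hlow : ∀ p ∈ S, 1 / 2 ≤ 1 / 2 * (φ (α * p.1 + β * p.2) - φ (α * p.1 + -β * p.2)) ^ 2 := by
    rintro ⟨x, y⟩ ⟨hx, hy⟩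
    simp only [Set.mem_Icc, Set.mem_Ici] at hx hy ⊢
    have hax : |α * x| ≤ β := by
      rw [abs_mul, abs_of_nonneg hα0]
      exact (mul_le_mul_of_nonneg_left (abs_le.2 hx) hα0).trans hαr
    have hby : T + β ≤ β * y := by
      have k1 : T ≤ β * (T / √(s₀ / 2)) := by
        rw [mul_div_assoc', le_div_iff₀ hβ₀, mul_comm]
        gcongr
      calc T + β ≤ β * A := by rw [hA]; linarith
        _ ≤ β * y := by gcongr
    obtain ⟨l1, l2⟩ := abs_le.1 hax
    have m1 := hφ.monotone (show T ≤ α * x + β * y by linarith)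
    have m2 := hφ.monotone (show α * x + -β * y ≤ -T by linarith)
    rw [hφ.odd] at m2
    nlinarith
  calc 1 / 2 * (2 * gaussianPDFReal 0 1 1 * (1 / √2)) * κ * √((q - c) / q)
      = (2 * gaussianPDFReal 0 1 1 * r) * κ * (1 / 2) := by rw [hr]; ring
    _ ≤ stdG.real (Set.Icc (-r) r) * κ * (1 / 2) := by
      gcongr
      exact stdG_Icc_ge hr0 hr1
    _ = ∫ p in S, (1 / 2 : ℝ) ∂(stdG.prod stdG) := by
      rw [setIntegral_const, hSmeas, smul_eq_mul]
    _ ≤ ∫ p in S, 1 / 2 * (φ (α * p.1 + β * p.2) - φ (α * p.1 + -β * p.2)) ^ 2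
          ∂(stdG.prod stdG) := by
      refine setIntegral_mono_on (by simp) ?_ hSm hlow
      exact (hφ.integrable_half_sub_sq (by fun_prop) (by fun_prop)).integrableOn
    _ ≤ W φ q q - W φ q c := by
      rw [W_diag_sub_W_eq hφ hc]
      exact setIntegral_le_integral (hφ.integrable_half_sub_sq (by fun_prop) (by fun_prop))
        (.of_forall fun p => by positivity)

/-! ### Continuity of the correlation integral -/

instance : NullSingletonClass stdG := nullSingletonClass_gaussianReal one_ne_zero

theorem ae_linear_ne {a b : ℝ} (h : a ≠ 0 ∨ b ≠ 0) (d : ℝ) :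
    ∀ᵐ p : ℝ × ℝ ∂(stdG.prod stdG), a * p.1 + b * p.2 ≠ d := by
  have hm : MeasurableSet {p : ℝ × ℝ | a * p.1 + b * p.2 = d} :=
    measurableSet_eq_fun (by fun_prop) (by fun_prop)
  rw [ae_iff]
  simp only [ne_eq, not_not]
  rw [Measure.measure_prod_null hm]
  by_cases hb : b = 0
  · have ha : a ≠ 0 := by tauto
    have : ∀ᵐ x ∂stdG, x ≠ d / a := by simp [ae_iff]
    filter_upwards [this] with x hx
    have : Prod.mk x ⁻¹' {p : ℝ × ℝ | a * p.1 + b * p.2 = d} = ∅ := by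
      ext y
      simp only [Set.mem_preimage, Set.mem_ofPred_eq, Set.mem_empty_iff_false, iff_false, hb]
      intro h
      exact hx (by field_simp; linarith)
    simp [this]
  · refine .of_forall fun x => ?_
    refine Set.Subsingleton.measure_zero (fun y hy y' hy' => ?_) _
    simp only [Set.mem_preimage, Set.mem_ofPred_eq] at hy hy'
    exact mul_left_cancel₀ hb (by linarith)

/-- A monotone function has countably many discontinuities, and a nonzero linear form of the
Gaussian vector almost surely avoids each of them. This replaces continuity of `φ`. -/
theorem ae_continuousAt_linear (hφ : TanhLike φ) {a b : ℝ} (h : a ≠ 0 ∨ b ≠ 0) :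
    ∀ᵐ p : ℝ × ℝ ∂(stdG.prod stdG), ContinuousAt φ (a * p.1 + b * p.2) := by
  have : ∀ᵐ p : ℝ × ℝ ∂(stdG.prod stdG), ∀ d ∈ {x | ¬ContinuousAt φ x}, a * p.1 + b * p.2 ≠ d :=
    (ae_ball_iff hφ.monotone.countable_not_continuousAt).2 fun d _ => ae_linear_ne h d
  filter_upwards [this] with p hp
  by_contra hc
  exact hp _ hc rfl

/-- The triangular factorization also covers unequal variances, which occur at finite width. The
idle term `0 * p.2` makes both arguments linear forms in the sense of `ae_continuousAt_linear`. -/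
theorem W2_eq_integral_cholesky (hφ : Measurable φ) {q q' c : ℝ} (hq : 0 < q)
    (h : c ^ 2 ≤ q * q') :
    W2 φ q q' c = ∫ p : ℝ × ℝ, φ (√q * p.1 + 0 * p.2) *
      φ (c / √q * p.1 + √(q' - c ^ 2 / q) * p.2) ∂(stdG.prod stdG) := by
  rw [← W2_eq_integral_prod hφ]
  have h1 := Real.sq_sqrt hq.le
  have h2 : 0 < √q := Real.sqrt_pos.2 hq
  have h3 := Real.sq_sqrt (show 0 ≤ q' - c ^ 2 / q by
    rw [sub_nonneg, div_le_iff₀ hq]; linarith)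
  congr 1
  · rw [h1]; ring
  · rw [h3, div_pow, h1]; ring
  · field_simp
    ring

theorem continuousAt_integral_cholesky (hφ : TanhLike φ) {q : ℝ} (hq : 0 < q) (c : ℝ) :
    ContinuousAt (fun u : ℝ × ℝ × ℝ => ∫ p : ℝ × ℝ, φ (√u.1 * p.1 + 0 * p.2) *
      φ (u.2.2 / √u.1 * p.1 + √(u.2.1 - u.2.2 ^ 2 / u.1) * p.2) ∂(stdG.prod stdG)) (q, q, c) := by
  have h2 : 0 < √q := Real.sqrt_pos.2 hq
  have h1 := Real.sq_sqrt hq.le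
  -- The second linear form is nonzero even in the degenerate case `c = ±q`, where its second
  -- coefficient vanishes.
  have hne : c / √q ≠ 0 ∨ √(q - c ^ 2 / q) ≠ 0 := by
    by_cases hc : c = 0
    · right
      simp [hc, h2.ne']
    · left
      positivity
  refine continuousAt_of_dominated (bound := fun _ => 1) (.of_forall fun u => ?_)
    (.of_forall fun u => .of_forall fun p => hφ.abs_mul_le_one _ _) (integrable_const _) ?_
  · exact (hφ.integrable_mul_comp (by fun_prop) (by fun_prop)).aestronglyMeasurable
  · filter_upwards [ae_continuousAt_linear hφ (Or.inl h2.ne' : √q ≠ 0 ∨ (0 : ℝ) ≠ 0),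
      ae_continuousAt_linear hφ hne] with p hp1 hp2
    have c1 : ContinuousAt (fun u : ℝ × ℝ × ℝ => √u.1 * p.1 + 0 * p.2) (q, q, c) := by
      fun_prop
    have c2 : ContinuousAt (fun u : ℝ × ℝ × ℝ =>
        u.2.2 / √u.1 * p.1 + √(u.2.1 - u.2.2 ^ 2 / u.1) * p.2) (q, q, c) := by
      have d1 : ContinuousAt (fun u : ℝ × ℝ × ℝ => u.2.2 / √u.1) (q, q, c) :=
        ContinuousAt.div (by fun_prop) (by fun_prop) h2.ne'
      have d2 : ContinuousAt (fun u : ℝ × ℝ × ℝ => u.2.2 ^ 2 / u.1) (q, q, c) :=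
        ContinuousAt.div (by fun_prop) (by fun_prop) hq.ne'
      have d3 : ContinuousAt (fun u : ℝ × ℝ × ℝ => √(u.2.1 - u.2.2 ^ 2 / u.1)) (q, q, c) :=
        Real.continuous_sqrt.continuousAt.comp (ContinuousAt.sub (by fun_prop) d2)
      exact (d1.mul_const _).add (d3.mul_const _)
    exact (ContinuousAt.comp (f := fun u : ℝ × ℝ × ℝ => √u.1 * p.1 + 0 * p.2) hp1 c1).mul
      (ContinuousAt.comp (f := fun u : ℝ × ℝ × ℝ =>
        u.2.2 / √u.1 * p.1 + √(u.2.1 - u.2.2 ^ 2 / u.1) * p.2) hp2 c2)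

/-- Continuity of the Gaussian correlation integral at nondegenerate variances. -/
theorem exists_delta_W2 (hφ : TanhLike φ) {q c : ℝ} (hq : 0 < q) (h : |c| ≤ q) {ε : ℝ}
    (hε : 0 < ε) :
    ∃ δ > 0, ∀ q₁ q₂ c', |q₁ - q| < δ → |q₂ - q| < δ → |c' - c| < δ → c' ^ 2 ≤ q₁ * q₂ →
      |W2 φ q₁ q₂ c' - W φ q c| < ε := by
  obtain ⟨δ, hδ, H⟩ := Metric.continuousAt_iff.1 (continuousAt_integral_cholesky hφ hq c) ε hε
  -- Taking the radius at most `q` keeps `q₁` positive, as the triangular factorization requires.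
  refine ⟨min δ q, lt_min hδ hq, fun q₁ q₂ c' h1 h2 h3 h4 => ?_⟩
  have hq1 : 0 < q₁ := by
    have := (abs_lt.1 (h1.trans_le (min_le_right _ _))).1
    linarith
  have hcc : c ^ 2 ≤ q * q := by
    rw [← sq]
    exact sq_le_sq' (by linarith [(abs_le.1 h).1]) (abs_le.1 h).2
  rw [W_eq_W2, W2_eq_integral_cholesky hφ.measurable hq1 h4,
    W2_eq_integral_cholesky hφ.measurable hq hcc]
  refine H (x := (q₁, q₂, c')) ?_
  simp only [Prod.dist_eq, Real.dist_eq]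
  exact max_lt (h1.trans_le (min_le_left _ _))
    (max_lt (h2.trans_le (min_le_left _ _)) (h3.trans_le (min_le_left _ _)))

/-! ### Comparison of Gaussian correlations of odd functions -/

/-- Odd measurable functions that are bounded by `1` and nonnegative on the half-line. -/
structure OddPos (f : ℝ → ℝ) : Prop where
  measurable : Measurable f
  odd : ∀ x, f (-x) = -f x
  abs_le_one : ∀ x, |f x| ≤ 1
  nonneg : ∀ x, 0 ≤ x → 0 ≤ f x

theorem TanhLike.oddPos (hφ : TanhLike φ) {r : ℝ} (hr : 0 ≤ r) : OddPos fun x => φ (r * x) where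
  measurable := hφ.measurable.comp (by fun_prop)
  odd x := by rw [mul_neg, hφ.odd]
  abs_le_one x := hφ.abs_le_one _
  nonneg x hx := hφ.nonneg _ (mul_nonneg hr hx)

/-- The Gaussian mean of an odd function that is nonnegative on the half-line has the sign of the
centre. -/
theorem integral_gaussianReal_nonneg {f : ℝ → ℝ} (hodd : ∀ x, f (-x) = -f x)
    (hpos : ∀ x, 0 ≤ x → 0 ≤ f x) {m : ℝ} (hm : 0 ≤ m) {v : ℝ≥0}
    (hf : Integrable f (gaussianReal m v)) :
    0 ≤ ∫ x, f x ∂(gaussianReal m v) := by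
  by_cases hv : v = 0
  · subst hv
    simpa [gaussianReal_zero_var] using hpos m hm
  have hi : Integrable (fun x => gaussianPDFReal m v x * f x) := by
    rw [gaussianReal_of_var_ne_zero _ hv, integrable_withDensity_iff_integrable_smul'
      (measurable_gaussianPDF m v) (.of_forall fun _ => gaussianPDF_lt_top)] at hf
    simpa [toReal_gaussianPDF] using hf
  rw [integral_gaussianReal_eq_integral_smul hv]
  simp only [smul_eq_mul]
  -- Reflection shows that twice the integral is that of `f(x)` times density at `x` minus density
  -- at `-x`. For `m ≥ 0` this difference has the sign of `x`, as does `f`.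
  have h1 : ∫ x, gaussianPDFReal m v x * f x = -∫ x, gaussianPDFReal m v (-x) * f x := by
    rw [← integral_neg_eq_self, ← integral_neg]
    congr 1
    ext x
    rw [hodd]
    ring
  have hi' : Integrable (fun x => gaussianPDFReal m v (-x) * f x) := by
    have := hi.comp_neg.neg
    refine this.congr (.of_forall fun x => ?_)
    simp [hodd]
  have h2 : 0 ≤ ∫ x, (gaussianPDFReal m v x * f x - gaussianPDFReal m v (-x) * f x) := by
    refine integral_nonneg fun x => ?_
    simp only [Pi.zero_apply, ← sub_mul]
    rcases le_total 0 x with hx | hx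
    · refine mul_nonneg (sub_nonneg.2 ?_) (hpos x hx)
      simp only [gaussianPDFReal]
      have : -(-x - m) ^ 2 / (2 * v) ≤ -(x - m) ^ 2 / (2 * v) :=
        div_le_div_of_nonneg_right (by nlinarith) (by positivity)
      gcongr
    · have := hpos (-x) (by linarith)
      rw [hodd] at this
      refine mul_nonneg_of_nonpos_of_nonpos (sub_nonpos.2 ?_) (by linarith)
      simp only [gaussianPDFReal]
      have : -(x - m) ^ 2 / (2 * v) ≤ -(-x - m) ^ 2 / (2 * v) :=
        div_le_div_of_nonneg_right (by nlinarith) (by positivity)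
      gcongr
  rw [integral_sub hi hi'] at h2
  linarith

theorem measurePreserving_affine_stdG (m τ : ℝ) :
    MeasurePreserving (fun y => m + τ * y) stdG (gaussianReal m (τ ^ 2).toNNReal) where
  measurable := by fun_prop
  map_eq := by
    have : (fun y => m + τ * y) = (fun y => m + y) ∘ (fun y => τ * y) := rfl
    rw [this, ← Measure.map_map (by fun_prop) (by fun_prop), gaussianReal_map_const_mul,
      gaussianReal_map_const_add]
    congr 1
    · simp
    · ext
      simp [sq_nonneg]

/-- The bound `C` is left free because the lemma is applied to a difference `g - f`, which is only
bounded by `2`. -/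
theorem integral_affine_stdG_nonneg {f : ℝ → ℝ} (hmeas : Measurable f) {C : ℝ}
    (hC : ∀ x, |f x| ≤ C) (hodd : ∀ x, f (-x) = -f x)
    (hpos : ∀ x, 0 ≤ x → 0 ≤ f x) {m : ℝ} (hm : 0 ≤ m) (τ : ℝ) :
    0 ≤ ∫ y, f (m + τ * y) ∂stdG := by
  have := integral_gaussianReal_nonneg hodd hpos hm (v := (τ ^ 2).toNNReal)
    (.of_bound hmeas.aestronglyMeasurable C (.of_forall hC))
  rwa [← (measurePreserving_affine_stdG m τ).map_eq,
    integral_map (by fun_prop) hmeas.aestronglyMeasurable] at this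

namespace OddPos

variable {f g : ℝ → ℝ}

theorem integrable_affine (hf : OddPos f) (m τ : ℝ) : Integrable (fun y => f (m + τ * y)) stdG :=
  .of_bound (hf.measurable.comp (by fun_prop)).aestronglyMeasurable 1
    (.of_forall fun _ => hf.abs_le_one _)

theorem integral_affine_nonneg (hf : OddPos f) {m : ℝ} (hm : 0 ≤ m) (τ : ℝ) :
    0 ≤ ∫ y, f (m + τ * y) ∂stdG :=
  integral_affine_stdG_nonneg hf.measurable hf.abs_le_one hf.odd hf.nonneg hm τ

theorem integral_affine_neg (hf : OddPos f) (m τ : ℝ) :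
    ∫ y, f (-m + τ * y) ∂stdG = -∫ y, f (m + τ * y) ∂stdG := by
  have hneg : stdG.map (fun x => -x) = stdG := by rw [gaussianReal_map_neg, neg_zero]
  rw [← integral_neg]
  nth_rw 1 [← hneg]
  rw [integral_map (f := fun y => f (-m + τ * y)) (by fun_prop)
    (hf.measurable.comp (by fun_prop)).aestronglyMeasurable]
  congr 1
  ext y
  rw [← hf.odd]
  congr 1
  ring

theorem integral_affine_mono (hf : OddPos f) (hg : OddPos g) (h : ∀ x, 0 ≤ x → f x ≤ g x)
    {m : ℝ} (hm : 0 ≤ m) (τ : ℝ) :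
    ∫ y, f (m + τ * y) ∂stdG ≤ ∫ y, g (m + τ * y) ∂stdG := by
  have := integral_affine_stdG_nonneg (f := fun x => g x - f x) (hg.measurable.sub hf.measurable)
    (C := 2) (fun x => (abs_sub _ _).trans (by linarith [hf.abs_le_one x, hg.abs_le_one x]))
    (fun x => by rw [hf.odd, hg.odd]; ring) (fun x hx => sub_nonneg.2 (h x hx)) hm τ
  rw [integral_sub (hg.integrable_affine m τ) (hf.integrable_affine m τ)] at this
  linarith

/-- The correlation `E[f(z) f(z')]` of a Gaussian pair `z`, `z' = ρ z + τ y`. -/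
theorem integrable_mul (hf : OddPos f) (ρ τ : ℝ) :
    Integrable (fun p : ℝ × ℝ => f p.1 * f (ρ * p.1 + τ * p.2)) (stdG.prod stdG) := by
  refine .of_bound ((hf.measurable.comp measurable_fst).mul
    (hf.measurable.comp (by fun_prop))).aestronglyMeasurable 1 (.of_forall fun p => ?_)
  rw [Real.norm_eq_abs, abs_mul]
  exact mul_le_one₀ (hf.abs_le_one _) (abs_nonneg _) (hf.abs_le_one _)

theorem integral_mul_eq (hf : OddPos f) (ρ τ : ℝ) :
    ∫ p : ℝ × ℝ, f p.1 * f (ρ * p.1 + τ * p.2) ∂(stdG.prod stdG) =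
      ∫ x, f x * ∫ y, f (ρ * x + τ * y) ∂stdG ∂stdG := by
  rw [integral_prod _ (hf.integrable_mul ρ τ)]
  simp only [integral_const_mul]

theorem integrable_mul_integral (hf : OddPos f) (ρ τ : ℝ) :
    Integrable (fun x => f x * ∫ y, f (ρ * x + τ * y) ∂stdG) stdG := by
  have := (hf.integrable_mul ρ τ).integral_prod_left
  simpa only [integral_const_mul] using this

theorem mul_integral_neg (hf : OddPos f) (ρ τ x : ℝ) :
    f (-x) * ∫ y, f (ρ * -x + τ * y) ∂stdG = f x * ∫ y, f (ρ * x + τ * y) ∂stdG := by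
  rw [mul_neg, hf.integral_affine_neg, hf.odd]
  ring

/-- Conditioning on the first variable turns the correlation into `E[f(x) F(x)]` with `F(x) = E f(ρ
x + τ y)`. Both factors are odd in `x`, so the product is even; for `x ≥ 0` both are nonnegative and
increase with `f`, where `ρ ≥ 0` keeps the centre `ρ x` nonnegative. -/
theorem integral_mul_mono (hf : OddPos f) (hg : OddPos g) (h : ∀ x, 0 ≤ x → f x ≤ g x)
    {ρ : ℝ} (hρ : 0 ≤ ρ) (τ : ℝ) :
    ∫ p : ℝ × ℝ, f p.1 * f (ρ * p.1 + τ * p.2) ∂(stdG.prod stdG) ≤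
      ∫ p : ℝ × ℝ, g p.1 * g (ρ * p.1 + τ * p.2) ∂(stdG.prod stdG) := by
  rw [hf.integral_mul_eq, hg.integral_mul_eq]
  refine integral_mono (hf.integrable_mul_integral ρ τ) (hg.integrable_mul_integral ρ τ) ?_
  have key : ∀ x, 0 ≤ x → f x * ∫ y, f (ρ * x + τ * y) ∂stdG ≤
      g x * ∫ y, g (ρ * x + τ * y) ∂stdG := fun x hx =>
    mul_le_mul (h x hx) (hf.integral_affine_mono hg h (mul_nonneg hρ hx) τ)
      (hf.integral_affine_nonneg (mul_nonneg hρ hx) τ) (hg.nonneg x hx)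
  intro x
  rcases le_total 0 x with hx | hx
  · exact key x hx
  · have := key (-x) (by linarith)
    rwa [hf.mul_integral_neg, hg.mul_integral_neg] at this

theorem integral_mul_nonneg (hf : OddPos f) {ρ : ℝ} (hρ : 0 ≤ ρ) (τ : ℝ) :
    0 ≤ ∫ p : ℝ × ℝ, f p.1 * f (ρ * p.1 + τ * p.2) ∂(stdG.prod stdG) := by
  have h0 : OddPos fun _ => (0 : ℝ) := ⟨measurable_const, by simp, by simp, by simp⟩
  simpa using h0.integral_mul_mono hf hf.nonneg hρ τ

end OddPos

/-- The variance is moved into the function `φ(r ·)`, so that functions can be compared under one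
fixed Gaussian law. -/
theorem W_eq_integral_scaled (hφ : Measurable φ) {r ρ τ : ℝ} (h : ρ ^ 2 + τ ^ 2 = 1) :
    W φ (r ^ 2) (ρ * r ^ 2) =
      ∫ p : ℝ × ℝ, φ (r * p.1) * φ (r * (ρ * p.1 + τ * p.2)) ∂(stdG.prod stdG) := by
  have := W2_eq_integral_prod hφ r 0 (r * ρ) (r * τ)
  rw [W_eq_W2]
  convert this using 1
  · congr 1
    · ring
    · linear_combination (-r ^ 2) * h
    · ring
  · congr 1
    ext p
    congr 2 <;> ring

theorem W_nonneg (hφ : TanhLike φ) {q c : ℝ} (hc : 0 ≤ c) (h : c ≤ q) : 0 ≤ W φ q c := by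
  -- Zero covariance is settled by oddness; it includes the case `q = 0`, where the ratio `c / q`
  -- would be meaningless.
  rcases hc.eq_or_lt with rfl | hc'
  · have := W_neg hφ (c := 0) (q := q) (by simpa using h)
    rw [neg_zero] at this
    linarith
  have hq : 0 < q := hc'.trans_le h
  have h1 : (c / q) ^ 2 + √(1 - (c / q) ^ 2) ^ 2 = 1 := by
    rw [Real.sq_sqrt]
    · ring
    · rw [sub_nonneg, sq_le_one_iff_abs_le_one, abs_of_nonneg (by positivity), div_le_one hq]
      exact h
  have := W_eq_integral_scaled (r := √q) hφ.measurable h1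
  rw [Real.sq_sqrt hq.le, div_mul_cancel₀ _ hq.ne'] at this
  rw [this]
  exact (hφ.oddPos (Real.sqrt_nonneg q)).integral_mul_nonneg (by positivity) _

/-! ### The arcsine law and the upper bound -/

theorem gaussianPDFReal_std (x : ℝ) :
    gaussianPDFReal 0 1 x = (√(2 * Real.pi))⁻¹ * Real.exp (-(1 / 2) * x ^ 2) := by
  simp only [gaussianPDFReal, NNReal.coe_one, sub_zero, mul_one]
  congr 2
  ring

theorem gaussianPDFReal_std_le (x : ℝ) : gaussianPDFReal 0 1 x ≤ gaussianPDFReal 0 1 0 := by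
  rw [gaussianPDFReal_std, gaussianPDFReal_std]
  have : -(1 / 2) * x ^ 2 ≤ -(1 / 2) * 0 ^ 2 := by nlinarith [sq_nonneg x]
  gcongr

theorem continuous_gaussianPDFReal_std : Continuous (gaussianPDFReal 0 1) := by
  simp_rw [funext gaussianPDFReal_std]
  fun_prop

theorem integral_Ioi_mul_exp {b : ℝ} (hb : 0 < b) :
    ∫ x in Set.Ioi (0 : ℝ), x * Real.exp (-b * x ^ 2) = (2 * b)⁻¹ := by
  have := integral_mul_cexp_neg_mul_sq (b := (b : ℂ)) (by simpa using hb)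
  rw [← Complex.ofReal_inj, ← integral_complex_ofReal]
  push_cast
  exact this

/-- The substitution `x = |y| u` makes the range of integration independent of `y`, ready for
Fubini. -/
theorem stdG_real_abs_lt {t : ℝ} (ht : 0 ≤ t) (y : ℝ) :
    stdG.real {x | |x| < t * |y|} = ∫ u in Set.Ioc (-t) t, |y| * gaussianPDFReal 0 1 (|y| * u) := by
  have e : {x : ℝ | |x| < t * |y|} = Set.Ioo (-(t * |y|)) (t * |y|) := by
    ext x
    simp [abs_lt]
  rw [e, measureReal_def, gaussianReal_apply_eq_integral _ one_ne_zero, ENNReal.toReal_ofReal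
    (integral_nonneg fun x => gaussianPDFReal_nonneg _ _ _), integral_const_mul,
    ← intervalIntegral.integral_of_le (by linarith), intervalIntegral.mul_integral_comp_mul_left,
    intervalIntegral.integral_of_le (by nlinarith [abs_nonneg y]), integral_Ioc_eq_integral_Ioo]
  congr 2
  ring_nf

/-- This is the Cauchy density, obtained as the density of a ratio of two Gaussians. -/
theorem integral_abs_gaussianPDFReal (u : ℝ) :
    ∫ y, gaussianPDFReal 0 1 y * (|y| * gaussianPDFReal 0 1 (|y| * u)) =
      Real.pi⁻¹ * (1 + u ^ 2)⁻¹ := by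
  have h : ∀ y, gaussianPDFReal 0 1 y * (|y| * gaussianPDFReal 0 1 (|y| * u)) =
      (fun z => (2 * Real.pi)⁻¹ * (z * Real.exp (-((1 + u ^ 2) / 2) * z ^ 2))) |y| := by
    intro y
    have h1 : (√(2 * Real.pi))⁻¹ * (√(2 * Real.pi))⁻¹ = (2 * Real.pi)⁻¹ := by
      rw [← mul_inv, Real.mul_self_sqrt (by positivity)]
    rw [gaussianPDFReal_std, gaussianPDFReal_std]
    simp only
    rw [← h1, show -((1 + u ^ 2) / 2) * |y| ^ 2 = -(1 / 2) * y ^ 2 + -(1 / 2) * (|y| * u) ^ 2 by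
      rw [mul_pow, sq_abs]; ring, Real.exp_add]
    ring
  simp_rw [h]
  rw [integral_comp_abs (f := fun z => (2 * Real.pi)⁻¹ *
    (z * Real.exp (-((1 + u ^ 2) / 2) * z ^ 2))), integral_const_mul, integral_Ioi_mul_exp (by positivity)]
  field_simp

/-- The ratio of two independent standard Gaussian variables has the Cauchy law. -/
theorem stdG_prod_abs_lt {t : ℝ} (ht : 0 ≤ t) :
    (stdG.prod stdG).real {p : ℝ × ℝ | |p.1| < t * |p.2|} = 2 / Real.pi * Real.arctan t := by
  set S := {p : ℝ × ℝ | |p.1| < t * |p.2|} with hS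
  have hSm : MeasurableSet S := measurableSet_lt (by fun_prop) (by fun_prop)
  have hSi : Integrable (S.indicator (1 : ℝ × ℝ → ℝ)) (stdG.prod stdG) :=
    (integrable_const (1 : ℝ)).indicator hSm
  rw [← integral_indicator_one hSm, integral_prod_symm _ hSi]
  have h1 : ∀ y, ∫ x, S.indicator (1 : ℝ × ℝ → ℝ) (x, y) ∂stdG =
      ∫ u in Set.Ioc (-t) t, |y| * gaussianPDFReal 0 1 (|y| * u) := by
    intro y
    rw [← stdG_real_abs_lt ht, ← integral_indicator_one (measurableSet_lt (by fun_prop)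
      (by fun_prop))]
    rfl
  simp_rw [h1]
  rw [integral_gaussianReal_eq_integral_smul one_ne_zero]
  simp_rw [smul_eq_mul, ← integral_const_mul]
  rw [integral_integral_swap]
  · simp_rw [integral_abs_gaussianPDFReal]
    rw [integral_const_mul, ← intervalIntegral.integral_of_le (by linarith),
      integral_inv_one_add_sq, Real.arctan_neg]
    ring
  · have hg := continuous_gaussianPDFReal_std
    have i1 : Integrable (fun y => gaussianPDFReal 0 1 y * |y|) := by
      have := ((integrable_mul_exp_neg_mul_sq (b := 1 / 2) (by norm_num)).norm).const_mul
        (√(2 * Real.pi))⁻¹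
      refine this.congr (.of_forall fun y => ?_)
      simp only [norm_mul, Real.norm_eq_abs, Real.abs_exp, gaussianPDFReal_std]
      ring
    have i2 := i1.mul_prod (integrable_const (μ := volume.restrict (Set.Ioc (-t) t))
      (gaussianPDFReal 0 1 0))
    refine i2.mono' ?_ (.of_forall fun p => ?_)
    · refine Continuous.aestronglyMeasurable ?_
      simp only [Function.uncurry_def]
      fun_prop
    · simp only [Function.uncurry]
      rw [Real.norm_eq_abs, abs_mul, abs_mul, abs_abs,
        abs_of_nonneg (gaussianPDFReal_nonneg _ _ _), abs_of_nonneg (gaussianPDFReal_nonneg _ _ _),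
        ← mul_assoc]
      have := gaussianPDFReal_nonneg 0 1 p.1
      gcongr
      exact gaussianPDFReal_std_le _

theorem oddPos_sign : OddPos Real.sign where
  measurable := by
    unfold Real.sign
    exact Measurable.ite measurableSet_Iio measurable_const
      (Measurable.ite measurableSet_Ioi measurable_const measurable_const)
  odd x := Real.sign_neg
  abs_le_one x := by
    rcases Real.sign_apply_eq x with h | h | h <;> simp [h]
  nonneg x hx := by
    rcases hx.eq_or_lt with rfl | hx
    · simp
    · simp [Real.sign_of_pos hx]

theorem sign_mul_sign_le (u v : ℝ) :
    Real.sign (u + v) * Real.sign (u - v) ≤ 1 - 2 * {p : ℝ × ℝ | |p.1| < |p.2|}.indicator 1 (u, v) := by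
  by_cases h : |u| < |v|
  · have h0 : (u + v) * (u - v) < 0 := by
      have := sq_lt_sq.2 h
      nlinarith
    rw [Set.indicator_of_mem (by exact h)]
    rcases mul_neg_iff.1 h0 with ⟨h1, h2⟩ | ⟨h1, h2⟩
    · rw [Real.sign_of_pos h1, Real.sign_of_neg h2]
      norm_num
    · rw [Real.sign_of_pos h2, Real.sign_of_neg h1]
      norm_num
  · rw [Set.indicator_of_notMem (by exact h)]
    have h1 := oddPos_sign.abs_le_one (u + v)
    have h2 := oddPos_sign.abs_le_one (u - v)
    have := mul_le_one₀ h1 (abs_nonneg _) h2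
    rw [← abs_mul] at this
    linarith [le_abs_self (Real.sign (u + v) * Real.sign (u - v))]

/-- The orthant bound for the correlation of signs of a Gaussian pair. -/
theorem W2_sign_le {ρ : ℝ} (h0 : 0 ≤ ρ) (h1 : ρ ≤ 1) :
    W2 Real.sign 1 1 ρ ≤ 2 / Real.pi * Real.arcsin ρ := by
  -- With the half-angle, `cos² θ - sin² θ = ρ`, so the pair is `cos θ x ± sin θ y`. The signs
  -- differ when `|x| < tan θ |y|`, an event of probability `2θ/π`, and `1 - 4θ/π = (2/π) arcsin ρ`.
  set θ := Real.arccos ρ / 2 with hθ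
  have hθ0 : 0 ≤ θ := by have := Real.arccos_nonneg ρ; positivity
  have hθ1 : θ ≤ Real.pi / 4 := by
    have := Real.arccos_le_pi_div_two.2 h0
    linarith
  have hpi := Real.pi_pos
  have hc : 0 < Real.cos θ := Real.cos_pos_of_mem_Ioo ⟨by linarith, by linarith⟩
  have hcos : Real.cos θ ^ 2 - Real.sin θ ^ 2 = ρ := by
    rw [← Real.cos_two_mul', hθ, mul_div_cancel₀ _ two_ne_zero, Real.cos_arccos (by linarith) h1]
  have hs := Real.sin_sq_add_cos_sq θ
  have hs0 : 0 ≤ Real.sin θ := Real.sin_nonneg_of_nonneg_of_le_pi hθ0 (by linarith)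
  have hrep := W2_eq_integral_prod oddPos_sign.measurable (Real.cos θ) (Real.sin θ) (Real.cos θ)
    (-Real.sin θ)
  have e1 : Real.cos θ ^ 2 + Real.sin θ ^ 2 = 1 := by linarith
  have e2 : Real.cos θ ^ 2 + (-Real.sin θ) ^ 2 = 1 := by linarith [neg_sq (Real.sin θ)]
  have e3 : Real.cos θ * Real.cos θ + Real.sin θ * -Real.sin θ = ρ := by nlinarith
  rw [e1, e2, e3] at hrep
  set S := {p : ℝ × ℝ | |p.1| < Real.tan θ * |p.2|} with hS
  have hSm : MeasurableSet S := measurableSet_lt (by fun_prop) (by fun_prop)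
  have hSi : Integrable (S.indicator (1 : ℝ × ℝ → ℝ)) (stdG.prod stdG) :=
    (integrable_const (1 : ℝ)).indicator hSm
  have hi : Integrable (fun p => 1 - 2 * S.indicator (1 : ℝ × ℝ → ℝ) p) (stdG.prod stdG) :=
    (integrable_const _).sub (hSi.const_mul 2)
  have hval : ∫ p, (1 - 2 * S.indicator (1 : ℝ × ℝ → ℝ) p) ∂(stdG.prod stdG) =
      2 / Real.pi * Real.arcsin ρ := by
    rw [integral_sub (integrable_const _) (hSi.const_mul 2),
      integral_const_mul, integral_indicator_one hSm, stdG_prod_abs_lt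
      (Real.tan_nonneg_of_nonneg_of_le_pi_div_two hθ0 (by linarith)),
      Real.arctan_tan (by linarith) (by linarith), hθ, Real.arccos]
    simp
    field_simp
    ring
  rw [hrep, ← hval]
  refine integral_mono ?_ hi fun p => ?_
  · refine .of_bound ((oddPos_sign.measurable.comp (by fun_prop)).mul
      (oddPos_sign.measurable.comp (by fun_prop))).aestronglyMeasurable 1 (.of_forall fun p => ?_)
    rw [Real.norm_eq_abs, abs_mul]
    exact mul_le_one₀ (oddPos_sign.abs_le_one _) (abs_nonneg _) (oddPos_sign.abs_le_one _)
  · have := sign_mul_sign_le (Real.cos θ * p.1) (Real.sin θ * p.2)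
    simp only
    have hmem : p ∈ S ↔ (Real.cos θ * p.1, Real.sin θ * p.2) ∈ {p : ℝ × ℝ | |p.1| < |p.2|} := by
      simp only [hS, Set.mem_ofPred_eq, abs_mul, abs_of_pos hc, abs_of_nonneg hs0,
        Real.tan_eq_sin_div_cos]
      rw [div_mul_eq_mul_div, lt_div_iff₀ hc, mul_comm]
    have hind : S.indicator (1 : ℝ × ℝ → ℝ) p = {p : ℝ × ℝ | |p.1| < |p.2|}.indicator 1
        (Real.cos θ * p.1, Real.sin θ * p.2) := by
      by_cases hp : p ∈ S
      · rw [Set.indicator_of_mem hp, Set.indicator_of_mem (hmem.1 hp)]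
        rfl
      · rw [Set.indicator_of_notMem hp, Set.indicator_of_notMem (mt hmem.2 hp)]
    rw [neg_mul, ← sub_eq_add_neg, hind]
    exact this

theorem cholesky_sq {ρ : ℝ} (h0 : 0 ≤ ρ) (h1 : ρ ≤ 1) : ρ ^ 2 + √(1 - ρ ^ 2) ^ 2 = 1 := by
  rw [Real.sq_sqrt]
  · ring
  · nlinarith

/-- The sign function dominates `φ(√q ·)` on the half-line, whatever `q` is. -/
theorem W_le_arcsin (hφ : TanhLike φ) {q ρ : ℝ} (hq : 0 ≤ q) (h0 : 0 ≤ ρ) (h1 : ρ ≤ 1) :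
    W φ q (ρ * q) ≤ 2 / Real.pi * Real.arcsin ρ := by
  refine le_trans ?_ (W2_sign_le h0 h1)
  have h := cholesky_sq h0 h1
  have e1 := W_eq_integral_scaled (r := √q) hφ.measurable h
  have e2 := W_eq_integral_scaled (r := 1) oddPos_sign.measurable h
  simp only [one_pow, mul_one, one_mul] at e2
  rw [Real.sq_sqrt hq] at e1
  rw [e1, ← W_eq_W2, e2]
  refine (hφ.oddPos (Real.sqrt_nonneg q)).integral_mul_mono oddPos_sign (fun x hx => ?_) h0 _
  rcases hx.eq_or_lt with rfl | hx
  · simp [hφ.map_zero]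
  · rw [Real.sign_of_pos hx]
    exact hφ.le_one _

/-- The concave function `sin` lies above its chord on `[0, arcsin ρ₁]`. -/
theorem arcsin_le_mul {ρ ρ₁ : ℝ} (h0 : 0 ≤ ρ) (h : ρ ≤ ρ₁) (hpos : 0 < ρ₁) (h1 : ρ₁ ≤ 1) :
    Real.arcsin ρ ≤ Real.arcsin ρ₁ / ρ₁ * ρ := by
  have ha : 0 < Real.arcsin ρ₁ := Real.arcsin_pos.2 hpos
  have hb : Real.arcsin ρ ≤ Real.arcsin ρ₁ := Real.monotone_arcsin h
  have hc := Real.arcsin_nonneg.2 h0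
  have hpi := Real.arcsin_le_pi_div_two ρ₁
  have hpp := Real.pi_pos
  have hconc := strictConcaveOn_sin_Icc.concaveOn.2
    (show (0 : ℝ) ∈ Set.Icc 0 Real.pi from ⟨le_rfl, by linarith⟩)
    (show Real.arcsin ρ₁ ∈ Set.Icc 0 Real.pi from ⟨ha.le, by linarith⟩)
    (show 0 ≤ 1 - Real.arcsin ρ / Real.arcsin ρ₁ from sub_nonneg.2 ((div_le_one ha).2 hb))
    (show 0 ≤ Real.arcsin ρ / Real.arcsin ρ₁ by positivity) (by ring)
  simp only [smul_eq_mul, mul_zero, zero_add, Real.sin_zero] at hconc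
  rw [div_mul_cancel₀ _ ha.ne', Real.sin_arcsin (by linarith) h1,
    Real.sin_arcsin (by linarith) (h.trans h1), div_mul_eq_mul_div, div_le_iff₀ ha] at hconc
  rw [div_mul_eq_mul_div, le_div_iff₀ hpos]
  linarith

/-- The contraction factor of the correlation for correlations at most `ρ₁`. -/
def arcsinFactor (ρ₁ : ℝ) : ℝ := 2 / Real.pi * (Real.arcsin ρ₁ / ρ₁)

theorem W_le_factor (hφ : TanhLike φ) {q ρ ρ₁ : ℝ} (hq : 0 ≤ q) (h0 : 0 ≤ ρ) (h : ρ ≤ ρ₁)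
    (hpos : 0 < ρ₁) (h1 : ρ₁ ≤ 1) : W φ q (ρ * q) ≤ arcsinFactor ρ₁ * ρ := by
  refine (W_le_arcsin hφ hq h0 (h.trans h1)).trans ?_
  rw [arcsinFactor, mul_assoc]
  have := Real.pi_pos
  gcongr
  exact arcsin_le_mul h0 h hpos h1

/-- This is the strict Jordan inequality `(2/π) t < sin t` at `t = arcsin ρ₁`. -/
theorem arcsinFactor_lt_one {ρ₁ : ℝ} (hpos : 0 < ρ₁) (h1 : ρ₁ < 1) : arcsinFactor ρ₁ < 1 := by
  have h := Real.mul_lt_sin (Real.arcsin_pos.2 hpos) (Real.arcsin_lt_pi_div_two.2 h1)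
  rw [Real.sin_arcsin (by linarith) h1.le] at h
  rw [arcsinFactor, ← mul_div_assoc, div_lt_one hpos]
  exact h

theorem tendsto_arcsinFactor : Tendsto arcsinFactor (𝓝[>] 0) (𝓝 (2 / Real.pi)) := by
  have h := (Real.hasDerivAt_arcsin (x := 0) (by norm_num) (by norm_num)).tendsto_slope_zero_right
  simp only [zero_add, Real.arcsin_zero, sub_zero, smul_eq_mul] at h
  have := h.const_mul (2 / Real.pi)
  norm_num at this
  refine this.congr fun x => ?_
  simp only [arcsinFactor]
  ring

/-! ### Step functions and the lower bound -/

theorem gaussianPDFReal_std_anti {x y : ℝ} (h : |x| ≤ |y|) :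
    gaussianPDFReal 0 1 y ≤ gaussianPDFReal 0 1 x := by
  rw [gaussianPDFReal_std, gaussianPDFReal_std]
  have := sq_le_sq.2 h
  have : -(1 / 2) * y ^ 2 ≤ -(1 / 2) * x ^ 2 := by linarith
  gcongr

theorem stdG_Ico_ge {u v b : ℝ} (huv : u ≤ v) (hb : ∀ y ∈ Set.Ico u v, |y| ≤ b) :
    (v - u) * gaussianPDFReal 0 1 b ≤ stdG.real (Set.Ico u v) := by
  rw [measureReal_def, gaussianReal_apply_eq_integral _ one_ne_zero, ENNReal.toReal_ofReal
    (integral_nonneg fun x => gaussianPDFReal_nonneg _ _ _)]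
  have : ∫ _ in Set.Ico u v, gaussianPDFReal 0 1 b = (v - u) * gaussianPDFReal 0 1 b := by
    simp [huv]
  rw [← this]
  refine setIntegral_mono_on (by simp) (integrable_gaussianPDFReal 0 1).integrableOn
    measurableSet_Ico fun x hx => gaussianPDFReal_std_anti ((hb x hx).trans (le_abs_self b))

/-- The odd step function with threshold `a`. -/
def oddStep (a x : ℝ) : ℝ := (Set.Ici a).indicator 1 x - (Set.Iic (-a)).indicator 1 x

theorem oddStep_of_le {a x : ℝ} (ha : 0 < a) (h : a ≤ x) : oddStep a x = 1 := by
  have : ¬ x ≤ -a := by linarith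
  simp [oddStep, h, this]

theorem oddStep_of_abs_lt {a x : ℝ} (h : |x| < a) : oddStep a x = 0 := by
  obtain ⟨h1, h2⟩ := abs_lt.1 h
  simp [oddStep, h1, h2]

theorem oddStep_neg (a x : ℝ) : oddStep a (-x) = -oddStep a x := by
  have h1 : a ≤ -x ↔ x ≤ -a := ⟨fun h => by linarith, fun h => by linarith⟩
  simp only [oddStep, Set.indicator_apply, Set.mem_Ici, Set.mem_Iic, h1, neg_le_neg_iff,
    Pi.one_apply]
  ring

theorem oddPos_const_mul_oddStep {a b : ℝ} (ha : 0 < a) (hb0 : 0 ≤ b) (hb1 : b ≤ 1) :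
    OddPos fun x => b * oddStep a x where
  measurable := by
    unfold oddStep
    exact ((measurable_one.indicator measurableSet_Ici).sub
      (measurable_one.indicator measurableSet_Iic)).const_mul b
  odd x := by rw [oddStep_neg, mul_neg]
  abs_le_one x := by
    rw [abs_mul, abs_of_nonneg hb0]
    refine mul_le_one₀ hb1 (abs_nonneg _) ?_
    simp only [oddStep, Set.indicator_apply, Pi.one_apply]
    split_ifs <;> simp
  nonneg x hx := by
    refine mul_nonneg hb0 ?_
    have : ¬ x ≤ -a := by linarith
    simp only [oddStep, Set.indicator_apply, Set.mem_Iic, this, if_false, sub_zero]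
    split_ifs <;> simp

/-- The mean is the probability of exceeding `a` minus that of falling below `-a`; reflecting the
second tail leaves a difference of two upper tails. -/
theorem integral_oddStep_affine {a m τ : ℝ} (hm : 0 ≤ m) (hτ : 0 < τ) :
    ∫ y, oddStep a (m + τ * y) ∂stdG = stdG.real (Set.Ico ((a - m) / τ) ((a + m) / τ)) := by
  have hA : ∀ y, (Set.Ici a).indicator (1 : ℝ → ℝ) (m + τ * y) =
      (Set.Ici ((a - m) / τ)).indicator 1 y := by
    intro y
    have : a ≤ m + τ * y ↔ (a - m) / τ ≤ y := by
      rw [div_le_iff₀ hτ, mul_comm y]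
      constructor <;> intro h <;> linarith
    simp only [Set.indicator_apply, Set.mem_Ici, this, Pi.one_apply]
  have hB : ∀ y, (Set.Iic (-a)).indicator (1 : ℝ → ℝ) (m + τ * y) =
      (Set.Ici ((a + m) / τ)).indicator 1 (-y) := by
    intro y
    have : m + τ * y ≤ -a ↔ (a + m) / τ ≤ -y := by
      rw [div_le_iff₀ hτ, neg_mul, mul_comm y]
      constructor <;> intro h <;> linarith
    simp only [Set.indicator_apply, Set.mem_Ici, Set.mem_Iic, this, Pi.one_apply]
  have i1 : ∀ u : ℝ, Integrable ((Set.Ici u).indicator (1 : ℝ → ℝ)) stdG := fun u =>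
    (integrable_const (1 : ℝ)).indicator measurableSet_Ici
  have hneg : MeasurePreserving (fun y : ℝ => -y) stdG stdG :=
    ⟨measurable_neg, by rw [gaussianReal_map_neg, neg_zero]⟩
  have h2 : ∫ y, (Set.Ici ((a + m) / τ)).indicator (1 : ℝ → ℝ) (-y) ∂stdG =
      stdG.real (Set.Ici ((a + m) / τ)) := by
    rw [← integral_indicator_one measurableSet_Ici]
    exact hneg.integral_comp (Homeomorph.neg ℝ).measurableEmbedding _
  simp only [oddStep, hA, hB]
  rw [integral_sub (i1 _) (by exact hneg.integrable_comp_of_integrable (i1 _)), h2,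
    integral_indicator_one measurableSet_Ici]
  have hle : (a - m) / τ ≤ (a + m) / τ := by gcongr; linarith
  rw [← Set.Ici_sdiff_Ici, measureReal_sdiff (Set.Ici_subset_Ici.2 hle) measurableSet_Ici]

/-- The interval has length `2m/τ ≥ 2m` and lies in `|y| ≤ (a + b)/τ₁`, where the density is at
least its value at the endpoint. -/
theorem integral_oddStep_affine_ge {a m τ τ₁ : ℝ} (ha : 0 < a) (hm : 0 ≤ m) (hτ₁ : 0 < τ₁)
    (h : τ₁ ≤ τ) (hτ : τ ≤ 1) {b : ℝ} (hb : m ≤ b) :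
    2 * m * gaussianPDFReal 0 1 ((a + b) / τ₁) ≤ ∫ y, oddStep a (m + τ * y) ∂stdG := by
  have hτ0 := hτ₁.trans_le h
  rw [integral_oddStep_affine hm hτ0]
  refine le_trans ?_ (stdG_Ico_ge (b := (a + b) / τ₁) (by gcongr; linarith) fun y hy => ?_)
  · have := gaussianPDFReal_nonneg 0 1 ((a + b) / τ₁)
    gcongr
    rw [← sub_div, le_div_iff₀ hτ0]
    nlinarith
  · have h1 : |y| ≤ (a + m) / τ := by
      refine abs_le.2 ⟨?_, hy.2.le⟩
      refine le_trans ?_ hy.1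
      rw [← neg_div]
      gcongr
      linarith
    have : 0 ≤ a + b := by linarith
    refine h1.trans ?_
    gcongr

/-- A lower bound for the slope of the correlation map. -/
def slopeBound (a : ℝ) : ℝ :=
  ∫ x, {x : ℝ | a ≤ |x|}.indicator (fun x => (1 - a) ^ 2 * (2 * |x| *
    gaussianPDFReal 0 1 ((a + a * |x|) / √(1 - a ^ 2)))) x ∂stdG

theorem integrable_abs_stdG : Integrable (fun x : ℝ => |x|) stdG :=
  ((memLp_id_gaussianReal (μ := 0) (v := 1) 1).integrable (by norm_num)).abs

theorem aestronglyMeasurable_slopeBound (a : ℝ) :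
    AEStronglyMeasurable ({x : ℝ | a ≤ |x|}.indicator (fun x => (1 - a) ^ 2 * (2 * |x| *
      gaussianPDFReal 0 1 ((a + a * |x|) / √(1 - a ^ 2))))) stdG := by
  refine AEStronglyMeasurable.indicator ?_ (measurableSet_le (by fun_prop) (by fun_prop))
  refine Measurable.aestronglyMeasurable ?_
  have := measurable_gaussianPDFReal 0 1
  fun_prop

theorem norm_slopeBound_le {a : ℝ} (h0 : 0 ≤ a) (h1 : a ≤ 1) (x : ℝ) :
    ‖{x : ℝ | a ≤ |x|}.indicator (fun x => (1 - a) ^ 2 * (2 * |x| *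
      gaussianPDFReal 0 1 ((a + a * |x|) / √(1 - a ^ 2)))) x‖ ≤
      2 * gaussianPDFReal 0 1 0 * |x| := by
  refine (norm_indicator_le_norm_self _ _).trans ?_
  have hg := gaussianPDFReal_nonneg 0 1 ((a + a * |x|) / √(1 - a ^ 2))
  have hg' := gaussianPDFReal_std_le ((a + a * |x|) / √(1 - a ^ 2))
  rw [Real.norm_of_nonneg (by positivity)]
  have h2 : (1 - a) ^ 2 ≤ 1 := by nlinarith
  calc (1 - a) ^ 2 * (2 * |x| * gaussianPDFReal 0 1 ((a + a * |x|) / √(1 - a ^ 2)))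
      ≤ 1 * (2 * |x| * gaussianPDFReal 0 1 0) := by gcongr
    _ = _ := by ring

/-- As `a → 0` the integrand tends to `2 |x| g(0)`, with `g` the Gaussian density. Its mean is twice
the Cauchy density at `0`, that is `2/π`. -/
theorem tendsto_slopeBound : Tendsto slopeBound (𝓝[>] 0) (𝓝 (2 / Real.pi)) := by
  have hlim : ∫ x, 2 * |x| * gaussianPDFReal 0 1 0 ∂stdG = 2 / Real.pi := by
    rw [integral_gaussianReal_eq_integral_smul one_ne_zero]
    have := integral_abs_gaussianPDFReal 0
    simp only [mul_zero, ne_eq, OfNat.ofNat_ne_zero, not_false_eq_true, zero_pow, add_zero, inv_one,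
      mul_one] at this
    have h2 : ∀ x, gaussianPDFReal 0 1 x • (2 * |x| * gaussianPDFReal 0 1 0) =
        2 * (gaussianPDFReal 0 1 x * (|x| * gaussianPDFReal 0 1 0)) := by
      intro x
      rw [smul_eq_mul]
      ring
    simp_rw [h2]
    rw [integral_const_mul, this]
    ring
  rw [← hlim]
  have hev : ∀ᶠ a : ℝ in 𝓝[>] 0, 0 < a ∧ a ≤ 1 := by
    filter_upwards [Ioc_mem_nhdsGT (zero_lt_one' ℝ)] with a ha using ha
  refine tendsto_integral_filter_of_dominated_convergence
    (fun x => 2 * gaussianPDFReal 0 1 0 * |x|)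
    (.of_forall aestronglyMeasurable_slopeBound) ?_ (integrable_abs_stdG.const_mul _) ?_
  · filter_upwards [hev] with a ha
    exact .of_forall fun x => norm_slopeBound_le ha.1.le ha.2 x
  · have : ∀ᵐ x ∂stdG, x ≠ 0 := by simp [ae_iff]
    filter_upwards [this] with x hx
    have hcont : ContinuousAt (fun a : ℝ => (1 - a) ^ 2 * (2 * |x| *
        gaussianPDFReal 0 1 ((a + a * |x|) / √(1 - a ^ 2)))) 0 := by
      have hd : ContinuousAt (fun a : ℝ => (a + a * |x|) / √(1 - a ^ 2)) 0 :=
        ContinuousAt.div (by fun_prop) (by fun_prop) (by simp)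
      have := continuous_gaussianPDFReal_std.continuousAt.comp hd
      exact ContinuousAt.mul (by fun_prop) (ContinuousAt.mul (by fun_prop) this)
    have ht := hcont.tendsto.mono_left (nhdsWithin_le_nhds (s := Set.Ioi 0))
    simp only [sub_zero, one_pow, zero_mul, add_zero, zero_div, one_mul] at ht
    refine ht.congr' ?_
    filter_upwards [Ioc_mem_nhdsGT (abs_pos.2 hx)] with a ha
    rw [Set.indicator_of_mem (by exact ha.2)]

theorem slopeBound_mul_le_W (hφ : TanhLike φ) {a : ℝ} (ha : 0 < a) (ha1 : a < 1) :
    ∃ Q, 0 < Q ∧ ∀ q, Q ≤ q → ∀ ρ, 0 ≤ ρ → ρ ≤ a → slopeBound a * ρ ≤ W φ q (ρ * q) := by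
  obtain ⟨T, hT, hφT⟩ := hφ.exists_le (a := 1 - a) (by linarith)
  -- For `q ≥ (T / a)²` and `x ≥ a` one has `√q x ≥ T`, so `φ(√q ·)` dominates `(1 - a)` times the
  -- step function with threshold `a`.
  refine ⟨(T / a) ^ 2, by positivity, fun q hq ρ h0 h1 => ?_⟩
  have hq0 : 0 ≤ q := (sq_nonneg _).trans hq
  have hρ1 : ρ ≤ 1 := h1.trans ha1.le
  have hTq : T ≤ √q * a := by
    rw [← div_le_iff₀ ha]
    exact Real.le_sqrt_of_sq_le hq
  have hf := oddPos_const_mul_oddStep (b := 1 - a) ha (by linarith) (by linarith)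
  have hW := W_eq_integral_scaled (r := √q) hφ.measurable (cholesky_sq h0 hρ1)
  rw [Real.sq_sqrt hq0] at hW
  rw [hW]
  set τ := √(1 - ρ ^ 2) with hτ
  have hτ1 : τ ≤ 1 := by
    rw [hτ, Real.sqrt_le_one]
    nlinarith [sq_nonneg ρ]
  have hτa : √(1 - a ^ 2) ≤ τ := Real.sqrt_le_sqrt (by nlinarith)
  have hτ0 : 0 < √(1 - a ^ 2) := Real.sqrt_pos.2 (by nlinarith)
  refine le_trans ?_ (hf.integral_mul_mono (hφ.oddPos (Real.sqrt_nonneg q)) (fun x hx => ?_) h0 τ)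
  · rw [hf.integral_mul_eq, slopeBound, ← integral_mul_const]
    have hi : Integrable (fun x => {x : ℝ | a ≤ |x|}.indicator (fun x => (1 - a) ^ 2 * (2 * |x| *
        gaussianPDFReal 0 1 ((a + a * |x|) / √(1 - a ^ 2)))) x) stdG :=
      (integrable_abs_stdG.const_mul _).mono' (aestronglyMeasurable_slopeBound a)
        (.of_forall fun x => norm_slopeBound_le ha.le ha1.le x)
    refine integral_mono (hi.mul_const ρ) (hf.integrable_mul_integral ρ τ) ?_
    have key : ∀ x, 0 ≤ x → {x : ℝ | a ≤ |x|}.indicator (fun x => (1 - a) ^ 2 * (2 * |x| *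
        gaussianPDFReal 0 1 ((a + a * |x|) / √(1 - a ^ 2)))) x * ρ ≤
        (1 - a) * oddStep a x * ∫ y, (1 - a) * oddStep a (ρ * x + τ * y) ∂stdG := by
      intro x hx
      by_cases hxa : a ≤ |x|
      · rw [Set.indicator_of_mem (by exact hxa), abs_of_nonneg hx, integral_const_mul,
          oddStep_of_le ha (by rwa [abs_of_nonneg hx] at hxa)]
        -- The centre is `ρ x ≤ a x` and the scale `τ ≥ √(1 - a²)`, so the density factor is free of
        -- `ρ` and the bound is linear in `ρ`.
        have := integral_oddStep_affine_ge ha (mul_nonneg h0 hx) hτ0 hτa hτ1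
          (b := a * x) (by gcongr)
        calc (1 - a) ^ 2 * (2 * x * gaussianPDFReal 0 1 ((a + a * x) / √(1 - a ^ 2))) * ρ
            = (1 - a) ^ 2 * (2 * (ρ * x) * gaussianPDFReal 0 1 ((a + a * x) / √(1 - a ^ 2))) := by
              ring
          _ ≤ (1 - a) ^ 2 * ∫ y, oddStep a (ρ * x + τ * y) ∂stdG := by gcongr
          _ = _ := by ring
      · rw [Set.indicator_of_notMem (by exact hxa), oddStep_of_abs_lt (not_le.1 hxa)]
        simp
    intro x
    rcases le_total 0 x with hx | hx
    · exact key x hx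
    · have := key (-x) (by linarith)
      rw [hf.mul_integral_neg] at this
      refine le_trans (le_of_eq ?_) this
      simp only [Set.indicator_apply, Set.mem_ofPred_eq, abs_neg]
  · by_cases hxa : a ≤ x
    · simp only [oddStep_of_le ha hxa, mul_one]
      exact hφT.trans (hφ.monotone (hTq.trans (by gcongr)))
    · simp only [oddStep_of_abs_lt (show |x| < a by rw [abs_of_nonneg hx]; linarith), mul_zero]
      exact hφ.nonneg _ (by positivity)

/-- The linear lower bound for the correlation map at large variance and small correlation. -/
theorem exists_mul_le_W (hφ : TanhLike φ) {κ : ℝ} (hκ : κ < 2 / Real.pi) :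
    ∃ Q > 0, ∃ ρ₁ > 0, ∀ q, Q ≤ q → ∀ ρ, 0 ≤ ρ → ρ ≤ ρ₁ → κ * ρ ≤ W φ q (ρ * q) := by
  obtain ⟨a, h1, h2⟩ := ((tendsto_slopeBound.eventually (eventually_gt_nhds hκ)).and
    (Ioo_mem_nhdsGT (zero_lt_one' ℝ))).exists
  obtain ⟨Q, hQ, H⟩ := slopeBound_mul_le_W hφ h2.1 h2.2
  exact ⟨Q, hQ, a, h2.1, fun q hq ρ h0 h => (mul_le_mul_of_nonneg_right h1.le h0).trans
    (H q hq ρ h0 h)⟩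

/-- The linear upper bound for the correlation map at small correlation. -/
theorem exists_W_le_mul (hφ : TanhLike φ) {κ : ℝ} (hκ : 2 / Real.pi < κ) :
    ∃ ρ₁ > 0, ∀ q, 0 ≤ q → ∀ ρ, 0 ≤ ρ → ρ ≤ ρ₁ → W φ q (ρ * q) ≤ κ * ρ := by
  obtain ⟨a, h1, h2⟩ := ((tendsto_arcsinFactor.eventually (eventually_lt_nhds hκ)).and
    (Ioo_mem_nhdsGT (zero_lt_one' ℝ))).exists
  exact ⟨a, h2.1, fun q hq ρ h0 h => (W_le_factor hφ hq h0 h h2.1 h2.2.le).trans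
    (mul_le_mul_of_nonneg_right h1.le h0)⟩

/-! ### Discrete growth: `1 + a / l` per step gives `l ^ a` -/

theorem one_add_div_le {a x : ℝ} (ha0 : 0 ≤ a) (ha1 : a ≤ 1) (hx : 1 < x) :
    1 + a / x ≤ (x / (x - 1)) ^ a := by
  have hx0 : 0 < x := by linarith
  have h1 : (1 - 1 / x) ^ a ≤ 1 - a / x := by
    have := rpow_one_add_le_one_add_mul_self (s := -(1 / x))
      (by rw [neg_le_neg_iff, div_le_one hx0]; exact hx.le) ha0 ha1
    calc (1 - 1 / x) ^ a = (1 + -(1 / x)) ^ a := by rw [sub_eq_add_neg]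
      _ ≤ 1 + a * -(1 / x) := this
      _ = 1 - a / x := by ring
  have h2 : x / (x - 1) = (1 - 1 / x)⁻¹ := by
    have : x - 1 ≠ 0 := by linarith
    field_simp
  have h3 : 0 < 1 - 1 / x := by
    rw [sub_pos, div_lt_one hx0]
    exact hx
  rw [h2, Real.inv_rpow h3.le, le_inv_comm₀ (by positivity) (Real.rpow_pos_of_pos h3 a)]
  refine h1.trans ?_
  rw [le_inv_comm₀ _ (by positivity)]
  · rw [← one_div, le_div_iff₀]
    · nlinarith [sq_nonneg (a / x)]
    · rw [sub_pos, div_lt_one hx0]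
      linarith
  · rw [sub_pos, div_lt_one hx0]
    linarith

theorem le_one_add_div {a x : ℝ} (ha0 : 0 ≤ a) (ha1 : a ≤ 1) (hx : 0 < x) :
    ((x + 1) / x) ^ a ≤ 1 + a / x := by
  have := rpow_one_add_le_one_add_mul_self (s := 1 / x)
    (by have : 0 < 1 / x := by positivity
        linarith) ha0 ha1
  calc ((x + 1) / x) ^ a = (1 + 1 / x) ^ a := by congr 1; field_simp
    _ ≤ 1 + a * (1 / x) := this
    _ = 1 + a / x := by ring

/-- The comparison sequence is `(l - 1)^a`: its growth ratio is at least `1 + a / l` by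
`one_add_div_le`, whereas that of `l^a` is at most `1 + a / l` by `le_one_add_div` and serves the
lower bound. -/
theorem exists_le_rpow_of_growth {d : ℕ → ℝ} (hd : ∀ l, 0 ≤ d l) {a : ℝ} (ha0 : 0 ≤ a)
    (ha1 : a ≤ 1) (h : ∀ᶠ l : ℕ in atTop, d (l + 1) ≤ d l * (1 + a / l)) :
    ∃ C, 0 ≤ C ∧ ∀ᶠ l : ℕ in atTop, d l ≤ C * (l : ℝ) ^ a := by
  obtain ⟨L, hL⟩ := eventually_atTop.1 (h.and (eventually_ge_atTop 2))
  have hL2 : (2 : ℝ) ≤ L := by exact_mod_cast (hL L le_rfl).2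
  refine ⟨d L / ((L : ℝ) - 1) ^ a, div_nonneg (hd L) (Real.rpow_nonneg (by linarith) a), ?_⟩
  have key : ∀ l ≥ L, d l ≤ d L / ((L : ℝ) - 1) ^ a * ((l : ℝ) - 1) ^ a := by
    intro l hl
    induction l, hl using Nat.le_induction with
    | base => rw [div_mul_cancel₀ _ (Real.rpow_pos_of_pos (by linarith) a).ne']
    | succ l hl ih =>
      have hl2 : (2 : ℝ) ≤ l := by exact_mod_cast (hL l hl).2
      have h3 := one_add_div_le ha0 ha1 (show (1 : ℝ) < l by linarith)
      rw [Real.div_rpow (by linarith) (by linarith)] at h3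
      have hp : 0 < ((l : ℝ) - 1) ^ a := Real.rpow_pos_of_pos (by linarith) a
      have hpl : 0 ≤ 1 + a / (l : ℝ) := by positivity
      calc d (l + 1) ≤ d l * (1 + a / l) := (hL l hl).1
        _ ≤ (d L / ((L : ℝ) - 1) ^ a * ((l : ℝ) - 1) ^ a) *
            ((l : ℝ) ^ a / ((l : ℝ) - 1) ^ a) := by
          refine mul_le_mul ih h3 hpl ((hd l).trans ih)
        _ = _ := by
          push_cast
          rw [add_sub_cancel_right]
          field_simp
  filter_upwards [eventually_ge_atTop L] with l hl
  have hlL : (L : ℝ) ≤ l := by exact_mod_cast hl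
  refine (key l hl).trans (mul_le_mul_of_nonneg_left ?_
    (div_nonneg (hd L) (Real.rpow_nonneg (by linarith) a)))
  exact Real.rpow_le_rpow (by linarith) (by linarith) ha0

theorem exists_rpow_le_of_growth {d : ℕ → ℝ} (hd : ∀ l, 0 < d l) {a : ℝ} (ha0 : 0 ≤ a)
    (ha1 : a ≤ 1) (h : ∀ᶠ l : ℕ in atTop, d l * (1 + a / l) ≤ d (l + 1)) :
    ∃ C, 0 < C ∧ ∀ᶠ l : ℕ in atTop, C * (l : ℝ) ^ a ≤ d l := by
  obtain ⟨L, hL⟩ := eventually_atTop.1 (h.and (eventually_ge_atTop 1))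
  have hL1 : (1 : ℝ) ≤ L := by exact_mod_cast (hL L le_rfl).2
  have hLp : 0 < (L : ℝ) ^ a := Real.rpow_pos_of_pos (by linarith) a
  refine ⟨d L / (L : ℝ) ^ a, div_pos (hd L) hLp, ?_⟩
  filter_upwards [eventually_ge_atTop L] with l hl
  induction l, hl using Nat.le_induction with
  | base => rw [div_mul_cancel₀ _ hLp.ne']
  | succ l hl ih =>
    have hl1 : (1 : ℝ) ≤ l := by exact_mod_cast (hL l hl).2
    have h3 := le_one_add_div ha0 ha1 (show (0 : ℝ) < l by linarith)
    rw [Real.div_rpow (by linarith) (by linarith)] at h3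
    have hp : 0 < (l : ℝ) ^ a := Real.rpow_pos_of_pos (by linarith) a
    refine le_trans ?_ (hL l hl).1
    calc d L / (L : ℝ) ^ a * ((l + 1 : ℕ) : ℝ) ^ a
        = (d L / (L : ℝ) ^ a * (l : ℝ) ^ a) * (((l : ℝ) + 1) ^ a / (l : ℝ) ^ a) := by
          push_cast
          field_simp
      _ ≤ d l * (1 + a / l) := by
          refine mul_le_mul ih h3 (by positivity) (hd l).le

/-! ### Asymptotics of the preactivation recurrences -/

/-- The recurrences of the preactivation variances and covariances in the large-width limit. -/
structure PreRec (φ : ℝ → ℝ) (w : ℝ) (q c : ℕ → ℝ) : Prop where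
  w_pos : 0 < w
  q_zero : 0 < q 0
  abs_zero : |c 0| ≤ q 0
  q_succ : ∀ l, q (l + 1) = q l + w * W φ (q l) (q l)
  c_succ : ∀ l, c (l + 1) = c l + w * W φ (q l) (c l)

namespace PreRec

variable {w : ℝ} {q c : ℕ → ℝ}

theorem q_ge (h : PreRec φ w q c) (hφ : TanhLike φ) (l : ℕ) : q 0 ≤ q l := by
  induction l with
  | zero => rfl
  | succ l ih =>
    rw [h.q_succ]
    have := W_diag_nonneg hφ (h.q_zero.le.trans ih)
    have := mul_nonneg h.w_pos.le this
    linarith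

theorem q_pos (h : PreRec φ w q c) (hφ : TanhLike φ) (l : ℕ) : 0 < q l :=
  h.q_zero.trans_le (h.q_ge hφ l)

theorem q_le (h : PreRec φ w q c) (hφ : TanhLike φ) (l : ℕ) : q l ≤ (q 0 + w) * (l + 1) := by
  have : q l ≤ q 0 + w * l := by
    induction l with
    | zero => simp
    | succ l ih =>
      rw [h.q_succ]
      have := mul_le_mul_of_nonneg_left (W_diag_le_one hφ (q l)) h.w_pos.le
      push_cast
      linarith
  have h1 := h.q_zero
  have h2 := h.w_pos
  have h3 : (0 : ℝ) ≤ l := l.cast_nonneg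
  nlinarith

theorem le_q (h : PreRec φ w q c) (hφ : TanhLike φ) (l : ℕ) :
    w * W φ (q 0) (q 0) * l ≤ q l := by
  have : q 0 + w * W φ (q 0) (q 0) * l ≤ q l := by
    induction l with
    | zero => simp
    | succ l ih =>
      rw [h.q_succ]
      have := mul_le_mul_of_nonneg_left (W_diag_mono hφ h.q_zero.le (h.q_ge hφ l)) h.w_pos.le
      push_cast
      linarith
  linarith [h.q_zero]

theorem tendsto_q (h : PreRec φ w q c) (hφ : TanhLike φ) : Tendsto q atTop atTop := by
  have hpos : 0 < w * W φ (q 0) (q 0) := mul_pos h.w_pos (W_diag_pos hφ h.q_zero)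
  exact tendsto_atTop_mono (h.le_q hφ) (tendsto_natCast_atTop_atTop.const_mul_atTop hpos)

theorem tendsto_q_div (h : PreRec φ w q c) (hφ : TanhLike φ) :
    Tendsto (fun l : ℕ => q l / l) atTop (𝓝 w) := by
  have h1 := ((tendsto_W_diag hφ).comp (h.tendsto_q hφ)).cesaro
  have hq : ∀ l : ℕ, q l = q 0 + w * ∑ i ∈ Finset.range l, W φ (q i) (q i) := by
    intro l
    induction l with
    | zero => simp
    | succ l ih =>
      rw [h.q_succ, Finset.sum_range_succ, mul_add, ← add_assoc, ← ih]
  have h2 : Tendsto (fun l : ℕ => q 0 / (l : ℝ)) atTop (𝓝 0) :=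
    tendsto_const_div_atTop_nhds_zero_nat _
  have h3 := h2.add (h1.const_mul w)
  rw [zero_add, mul_one] at h3
  refine h3.congr fun l => ?_
  rw [hq l]
  simp only [Function.comp]
  ring

theorem abs_c_le (h : PreRec φ w q c) (hφ : TanhLike φ) (l : ℕ) : |c l| ≤ q l := by
  induction l with
  | zero => exact h.abs_zero
  | succ l ih =>
    rw [h.q_succ, h.c_succ]
    refine (abs_add_le _ _).trans ?_
    rw [abs_mul, abs_of_pos h.w_pos]
    have := mul_le_mul_of_nonneg_left (abs_W_le_W_diag hφ ih) h.w_pos.le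
    linarith

theorem sub_ge (h : PreRec φ w q c) (hφ : TanhLike φ) (l : ℕ) : q 0 - c 0 ≤ q l - c l := by
  induction l with
  | zero => rfl
  | succ l ih =>
    rw [h.q_succ, h.c_succ]
    have := mul_le_mul_of_nonneg_left (W_le_W_diag hφ (h.abs_c_le hφ l)) h.w_pos.le
    linarith

/-- Linear growth of the metric expressivity. -/
theorem exists_linear_le_sub (h : PreRec φ w q c) (hφ : TanhLike φ) (h0 : c 0 < q 0) :
    ∃ k > 0, ∀ l : ℕ, k * (l + 1) ≤ q l - c l := by
  obtain ⟨κ, hκ, H⟩ := exists_sqrt_le_W_diag_sub_W hφ (sub_pos.2 h0)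
  have hw := h.w_pos
  have hq0 := h.q_zero
  set A := q 0 + w with hA
  have hA0 : 0 < A := by positivity
  -- The first entry starts the induction. The second makes it self-sustaining: a gap `k (l + 1)`
  -- against `q ≤ A (l + 1)` yields an increment `w κ √(k / A)`, which is at least `k` exactly when
  -- `k ≤ (w κ)² / A`.
  set k := min (q 0 - c 0) ((w * κ) ^ 2 / A) with hk
  have hk0 : 0 < k := lt_min (sub_pos.2 h0) (by positivity)
  refine ⟨k, hk0, fun l => ?_⟩
  induction l with
  | zero =>
    simp only [Nat.cast_zero, zero_add, mul_one]
    exact min_le_left _ _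
  | succ l ih =>
    have hql := h.q_pos hφ l
    have h1 := H (q l) (c l) (h.abs_c_le hφ l) (h.sub_ge hφ l)
    have h2 : k / A ≤ (q l - c l) / q l := by
      rw [div_le_div_iff₀ hA0 hql]
      have := h.q_le hφ l
      calc k * q l ≤ k * (A * (l + 1)) := by gcongr
        _ = k * (l + 1) * A := by ring
        _ ≤ (q l - c l) * A := by gcongr
    have h3 : k ≤ w * κ * √(k / A) := by
      refine (sq_le_sq₀ hk0.le (by positivity)).1 ?_
      rw [mul_pow, Real.sq_sqrt (by positivity)]
      have : k ≤ (w * κ) ^ 2 / A := min_le_right _ _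
      calc k ^ 2 = k * k := sq k
        _ ≤ (w * κ) ^ 2 / A * k := by gcongr
        _ = _ := by ring
    have h4 : w * κ * √(k / A) ≤ w * (W φ (q l) (q l) - W φ (q l) (c l)) := by
      rw [mul_assoc]
      refine mul_le_mul_of_nonneg_left (le_trans ?_ h1) hw.le
      gcongr
    rw [h.q_succ, h.c_succ]
    push_cast
    linarith

/-- `W` is odd in the covariance and nonnegative for nonnegative covariance, so an increment never
opposes the sign of `c`. This reduces everything to `c ≥ 0`. -/
theorem abs (h : PreRec φ w q c) (hφ : TanhLike φ) : PreRec φ w q fun l => |c l| where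
  w_pos := h.w_pos
  q_zero := h.q_zero
  abs_zero := by rw [abs_abs]; exact h.abs_zero
  q_succ := h.q_succ
  c_succ l := by
    have hc := h.abs_c_le hφ l
    have hn := W_nonneg hφ (abs_nonneg (c l)) hc
    have hw := h.w_pos.le
    rw [h.c_succ]
    rcases abs_choice (c l) with h' | h'
    · rw [h'] at hn ⊢
      have := abs_eq_self.1 h'
      exact abs_of_nonneg (by positivity)
    · rw [h'] at hn ⊢
      rw [W_neg hφ hc] at hn ⊢
      have := abs_eq_neg_self.1 h'
      rw [abs_of_nonpos]
      · ring
      · have := mul_nonneg hw hn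
        linarith

theorem c_ge (h : PreRec φ w q c) (hφ : TanhLike φ) (h0 : 0 ≤ c 0) (l : ℕ) : c 0 ≤ c l := by
  induction l with
  | zero => rfl
  | succ l ih =>
    rw [h.c_succ]
    have := W_nonneg hφ (h0.trans ih) (abs_le.1 (h.abs_c_le hφ l)).2
    have := mul_nonneg h.w_pos.le this
    linarith

theorem eventually_div_le (h : PreRec φ w q c) (hφ : TanhLike φ) {κ a : ℝ} (hκ : κ < a)
    (ha : 0 < a) : ∀ᶠ l : ℕ in atTop, w * κ / q l ≤ a / l := by
  have h1 : w * κ / a < w := by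
    rw [div_lt_iff₀ ha]
    exact mul_lt_mul_of_pos_left hκ h.w_pos
  filter_upwards [(h.tendsto_q_div hφ).eventually (eventually_gt_nhds h1),
    eventually_gt_atTop 0] with l hl hl0
  have hl0' : (0 : ℝ) < l := by exact_mod_cast hl0
  rw [div_lt_div_iff₀ ha hl0'] at hl
  rw [div_le_div_iff₀ (h.q_pos hφ l) hl0']
  linarith

theorem eventually_le_div (h : PreRec φ w q c) (hφ : TanhLike φ) {κ a : ℝ} (hκ : a < κ)
    (ha : 0 < a) : ∀ᶠ l : ℕ in atTop, a / l ≤ w * κ / q l := by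
  have h1 : w < w * κ / a := by
    rw [lt_div_iff₀ ha]
    exact mul_lt_mul_of_pos_left hκ h.w_pos
  filter_upwards [(h.tendsto_q_div hφ).eventually (eventually_lt_nhds h1),
    eventually_gt_atTop 0] with l hl hl0
  have hl0' : (0 : ℝ) < l := by exact_mod_cast hl0
  rw [div_lt_div_iff₀ hl0' ha] at hl
  rw [div_le_div_iff₀ hl0' (h.q_pos hφ l)]
  linarith

/-- As `q ~ w l`, a slope `κ` gives the relative increment `w κ / q ~ κ / l`; the strict inequality
`κ < a` absorbs the error in `q`. -/
theorem exists_le_rpow_of_slope (h : PreRec φ w q c) (hφ : TanhLike φ) (h0 : 0 ≤ c 0) {κ a : ℝ}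
    (hκ : κ < a) (ha0 : 0 < a) (ha1 : a ≤ 1)
    (hW : ∀ᶠ l in atTop, W φ (q l) (c l) ≤ κ * (c l / q l)) :
    ∃ C, 0 ≤ C ∧ ∀ᶠ l : ℕ in atTop, c l ≤ C * (l : ℝ) ^ a := by
  have hc : ∀ l, 0 ≤ c l := fun l => h0.trans (h.c_ge hφ h0 l)
  refine exists_le_rpow_of_growth hc ha0.le ha1 ?_
  filter_upwards [hW, h.eventually_div_le hφ hκ ha0] with l h1 h2
  rw [h.c_succ]
  have h3 := mul_le_mul_of_nonneg_left h1 h.w_pos.le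
  have h4 := mul_le_mul_of_nonneg_left h2 (hc l)
  calc c l + w * W φ (q l) (c l) ≤ c l + w * (κ * (c l / q l)) := by gcongr
    _ = c l + c l * (w * κ / q l) := by ring
    _ ≤ c l + c l * (a / l) := by gcongr
    _ = _ := by ring

theorem exists_rpow_le_of_slope (h : PreRec φ w q c) (hφ : TanhLike φ) (h0 : 0 < c 0) {κ a : ℝ}
    (hκ : a < κ) (ha0 : 0 < a) (ha1 : a ≤ 1)
    (hW : ∀ᶠ l in atTop, κ * (c l / q l) ≤ W φ (q l) (c l)) :
    ∃ C, 0 < C ∧ ∀ᶠ l : ℕ in atTop, C * (l : ℝ) ^ a ≤ c l := by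
  have hc : ∀ l, 0 < c l := fun l => h0.trans_le (h.c_ge hφ h0.le l)
  refine exists_rpow_le_of_growth hc ha0.le ha1 ?_
  filter_upwards [hW, h.eventually_le_div hφ hκ ha0] with l h1 h2
  rw [h.c_succ]
  have h3 := mul_le_mul_of_nonneg_left h1 h.w_pos.le
  have h4 := mul_le_mul_of_nonneg_left h2 (hc l).le
  calc c l * (1 + a / l) = c l + c l * (a / l) := by ring
    _ ≤ c l + c l * (w * κ / q l) := by gcongr
    _ = c l + w * (κ * (c l / q l)) := by ring
    _ ≤ _ := by gcongr

/-- Linear growth of the gap keeps the ratio below some `ρ₁ < 1`, where the slope of `W` is at most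
`arcsinFactor ρ₁ < 1`. Hence `c` grows like a power below `1`, while `q` grows linearly. -/
theorem tendsto_ratio (h : PreRec φ w q c) (hφ : TanhLike φ) (h0 : 0 ≤ c 0) (h1 : c 0 < q 0) :
    Tendsto (fun l => c l / q l) atTop (𝓝 0) := by
  have hc : ∀ l, 0 ≤ c l := fun l => h0.trans (h.c_ge hφ h0 l)
  obtain ⟨k, hk, H⟩ := h.exists_linear_le_sub hφ h1
  have hw := h.w_pos
  have hq0 := h.q_zero
  set A := q 0 + w with hA
  have hA0 : 0 < A := by positivity
  have hkA : k ≤ A := by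
    have h2 := H 0
    have h3 := h.q_le hφ 0
    simp only [Nat.cast_zero, zero_add, mul_one] at h2 h3
    linarith
  -- The bound `1 - k / A` would also hold; halving keeps `ρ₁` positive when `k = A`.
  set ρ₁ := 1 - k / (2 * A) with hρ₁
  have e1 : k / (2 * A) ≤ 1 / 2 := by
    rw [div_le_div_iff₀ (by positivity) (by norm_num)]
    linarith
  have e2 : 0 < k / (2 * A) := by positivity
  have hρ0 : 0 < ρ₁ := by linarith
  have hρ1 : ρ₁ < 1 := by linarith
  have hρ : ∀ l, c l / q l ≤ ρ₁ := by
    intro l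
    have hql := h.q_pos hφ l
    rw [div_le_iff₀ hql, hρ₁]
    have h2 := H l
    have h3 := h.q_le hφ l
    have h4 : k / (2 * A) * q l ≤ k * (l + 1) := by
      calc k / (2 * A) * q l ≤ k / (2 * A) * (A * (l + 1)) := by gcongr
        _ = k * (l + 1) / 2 := by field_simp
        _ ≤ k * (l + 1) := by
          have : 0 ≤ k * ((l : ℝ) + 1) := by positivity
          linarith
    linarith
  have hK := arcsinFactor_lt_one hρ0 hρ1
  -- An exponent strictly between the factor and `1`; the maximum with `1/2` makes it positive
  -- without a lower bound on the factor.
  set a := max ((arcsinFactor ρ₁ + 1) / 2) (1 / 2) with ha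
  have ha1 : a < 1 := max_lt (by linarith) (by norm_num)
  have ha0 : 0 < a := (by norm_num : (0 : ℝ) < 1 / 2).trans_le (le_max_right _ _)
  have hKa : arcsinFactor ρ₁ < a := (by linarith : arcsinFactor ρ₁ <
    (arcsinFactor ρ₁ + 1) / 2).trans_le (le_max_left _ _)
  obtain ⟨C, hC, hev⟩ := h.exists_le_rpow_of_slope hφ h0 hKa ha0 ha1.le (.of_forall fun l => by
    have hql := h.q_pos hφ l
    have := W_le_factor hφ hql.le (div_nonneg (hc l) hql.le) (hρ l) hρ0 hρ1.le
    rwa [div_mul_cancel₀ _ hql.ne'] at this)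
  set v := w * W φ (q 0) (q 0) with hv
  have hv0 : 0 < v := mul_pos hw (W_diag_pos hφ hq0)
  have hlim : Tendsto (fun l : ℕ => C / v * (l : ℝ) ^ (a - 1)) atTop (𝓝 0) := by
    have := (tendsto_rpow_neg_atTop (show 0 < 1 - a by linarith)).comp
      (tendsto_natCast_atTop_atTop (R := ℝ))
    have := this.const_mul (C / v)
    rw [mul_zero] at this
    refine this.congr fun l => ?_
    simp only [Function.comp, neg_sub]
  refine squeeze_zero' (.of_forall fun l => div_nonneg (hc l) (h.q_pos hφ l).le) ?_ hlim
  filter_upwards [hev, eventually_gt_atTop 0] with l hl hl0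
  have hl0' : (0 : ℝ) < l := by exact_mod_cast hl0
  rw [Real.rpow_sub_one hl0'.ne', div_mul_div_comm]
  have := h.le_q hφ l
  gcongr

/-- Second pass: once the ratio tends to `0`, any slope above `2/π` is eventually available. An
intermediate `κ` leaves room on both sides. -/
theorem exists_le_rpow (h : PreRec φ w q c) (hφ : TanhLike φ) (h0 : 0 ≤ c 0) (h1 : c 0 < q 0)
    {a : ℝ} (ha : 2 / Real.pi < a) (ha1 : a ≤ 1) :
    ∃ C, 0 ≤ C ∧ ∀ᶠ l : ℕ in atTop, c l ≤ C * (l : ℝ) ^ a := by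
  obtain ⟨κ, hκ, hκa⟩ := exists_between ha
  obtain ⟨ρ₁, hρ, H⟩ := exists_W_le_mul hφ hκ
  have ha0 : 0 < a := (div_pos two_pos Real.pi_pos).trans ha
  refine h.exists_le_rpow_of_slope hφ h0 hκa ha0 ha1 ?_
  filter_upwards [(h.tendsto_ratio hφ h0 h1).eventually (eventually_le_nhds hρ)] with l hl
  have hql := h.q_pos hφ l
  have := H (q l) hql.le (c l / q l) (div_nonneg (h0.trans (h.c_ge hφ h0 l)) hql.le) hl
  rwa [div_mul_cancel₀ _ hql.ne'] at this

theorem exists_rpow_le (h : PreRec φ w q c) (hφ : TanhLike φ) (h0 : 0 < c 0) (h1 : c 0 < q 0)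
    {a : ℝ} (ha : a < 2 / Real.pi) (ha0 : 0 < a) :
    ∃ C, 0 < C ∧ ∀ᶠ l : ℕ in atTop, C * (l : ℝ) ^ a ≤ c l := by
  obtain ⟨κ, hκa, hκ⟩ := exists_between ha
  obtain ⟨Q, hQ, ρ₁, hρ, H⟩ := exists_mul_le_W hφ hκ
  have hpi : 2 / Real.pi < 1 := by
    rw [div_lt_one Real.pi_pos]
    linarith [Real.pi_gt_three]
  refine h.exists_rpow_le_of_slope hφ h0 hκa ha0 (by linarith) ?_
  filter_upwards [(h.tendsto_ratio hφ h0.le h1).eventually (eventually_le_nhds hρ),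
    (h.tendsto_q hφ).eventually (eventually_ge_atTop Q)] with l hl hlQ
  have hql := h.q_pos hφ l
  have := H (q l) hlQ (c l / q l) (div_nonneg (h0.le.trans (h.c_ge hφ h0.le l)) hql.le) hl
  rwa [div_mul_cancel₀ _ hql.ne'] at this

end PreRec

/-! ### One random layer: mean and variance -/

theorem measurePreserving_neg_gaussianReal (v : ℝ≥0) :
    MeasurePreserving (fun x : ℝ => -x) (gaussianReal 0 v) (gaussianReal 0 v) :=
  ⟨measurable_neg, by rw [gaussianReal_map_neg, neg_zero]⟩

theorem measurePreserving_neg_rowLaw (σw σb : ℝ≥0) (N : ℕ) :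
    MeasurePreserving (fun r : (Fin N → ℝ) × ℝ => -r) (rowLaw σw σb N) (rowLaw σw σb N) :=
  (measurePreserving_pi _ _ fun _ => measurePreserving_neg_gaussianReal _).prod
    (measurePreserving_neg_gaussianReal _)

theorem neuron_neg {N : ℕ} (r : (Fin N → ℝ) × ℝ) (x : Fin N → ℝ) : neuron (-r) x = -neuron r x := by
  simp [neuron, Finset.sum_neg_distrib]
  ring

theorem integral_comp_neuron (hφ : TanhLike φ) (σw σb : ℝ≥0) {N : ℕ} (x : Fin N → ℝ) :
    ∫ r, φ (neuron r x) ∂(rowLaw σw σb N) = 0 := by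
  have := (measurePreserving_neg_rowLaw σw σb N).integral_comp
    (MeasurableEquiv.neg _).measurableEmbedding (fun r => φ (neuron r x))
  simp only [neuron_neg, hφ.odd] at this
  rw [integral_neg] at this
  linarith

/-- Regroups a layer into independent neurons, so that variances add. -/
theorem measurePreserving_layer (σw σb : ℝ≥0) (N : ℕ) :
    MeasurePreserving (MeasurableEquiv.arrowProdEquivProdArrow (Fin N → ℝ) ℝ (Fin N))
      (Measure.pi fun _ => rowLaw σw σb N) (layerLaw σw σb N) :=
  measurePreserving_arrowProdEquivProdArrow (Fin N → ℝ) ℝ (Fin N) _ _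

/-- One step of the network. -/
def step (φ : ℝ → ℝ) {N : ℕ} (η : Layer N) (x : Fin N → ℝ) : Fin N → ℝ :=
  fun i => φ (affine η x i) + x i

/-- The centred contribution of one neuron to the correlation of the next layer. -/
def incr (φ : ℝ → ℝ) {N : ℕ} (x y : Fin N → ℝ) (i : Fin N) (r : (Fin N → ℝ) × ℝ) : ℝ :=
  φ (neuron r x) * φ (neuron r y) + (φ (neuron r x) * y i + φ (neuron r y) * x i)

theorem step_dotProduct_step (φ : ℝ → ℝ) {N : ℕ} (R : Fin N → (Fin N → ℝ) × ℝ) (x y : Fin N → ℝ) :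
    step φ (MeasurableEquiv.arrowProdEquivProdArrow (Fin N → ℝ) ℝ (Fin N) R) x ⬝ᵥ
      step φ (MeasurableEquiv.arrowProdEquivProdArrow (Fin N → ℝ) ℝ (Fin N) R) y =
      ∑ i, incr φ x y i (R i) + x ⬝ᵥ y := by
  simp only [dotProduct, ← Finset.sum_add_distrib]
  refine Finset.sum_congr rfl fun i _ => ?_
  change (φ (neuron (R i) x) + x i) * (φ (neuron (R i) y) + y i) = _
  rw [incr]
  ring

theorem measurable_incr (hφ : TanhLike φ) {N : ℕ} (x y : Fin N → ℝ) (i : Fin N) :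
    Measurable (incr φ x y i) := by
  have h1 := hφ.measurable.comp (measurable_neuron x)
  have h2 := hφ.measurable.comp (measurable_neuron y)
  exact (h1.mul h2).add ((h1.mul_const _).add (h2.mul_const _))

theorem abs_incr_le (hφ : TanhLike φ) {N : ℕ} (x y : Fin N → ℝ) (i : Fin N)
    (r : (Fin N → ℝ) × ℝ) : |incr φ x y i r| ≤ 1 + |x i| + |y i| := by
  rw [incr]
  have h1 := hφ.abs_mul_le_one (neuron r x) (neuron r y)
  have h2 : |φ (neuron r x) * y i| ≤ |y i| := by
    rw [abs_mul]
    exact mul_le_of_le_one_left (abs_nonneg _) (hφ.abs_le_one _)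
  have h3 : |φ (neuron r y) * x i| ≤ |x i| := by
    rw [abs_mul]
    exact mul_le_of_le_one_left (abs_nonneg _) (hφ.abs_le_one _)
  linarith [abs_add_le (φ (neuron r x) * φ (neuron r y)) (φ (neuron r x) * y i + φ (neuron r y) * x i),
    abs_add_le (φ (neuron r x) * y i) (φ (neuron r y) * x i)]

theorem memLp_incr (hφ : TanhLike φ) (σw σb : ℝ≥0) {N : ℕ} (x y : Fin N → ℝ) (i : Fin N) :
    MemLp (incr φ x y i) 2 (rowLaw σw σb N) :=
  .of_bound (measurable_incr hφ x y i).aestronglyMeasurable _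
    (.of_forall fun r => abs_incr_le hφ x y i r)

/-- The cross terms vanish because the row law is symmetric and `φ` is odd. The identity is exact at
finite width. -/
theorem integral_incr (hφ : TanhLike φ) (σw σb : ℝ≥0) {N : ℕ} (x y : Fin N → ℝ) (i : Fin N) :
    ∫ r, incr φ x y i r ∂(rowLaw σw σb N) =
      W2 φ (preCov σw σb x x) (preCov σw σb y y) (preCov σw σb x y) := by
  have hi : ∀ z : Fin N → ℝ, Integrable (fun r => φ (neuron r z)) (rowLaw σw σb N) := fun z =>
    .of_bound (hφ.measurable.comp (measurable_neuron z)).aestronglyMeasurable 1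
      (.of_forall fun _ => hφ.abs_le_one _)
  simp only [incr]
  rw [integral_add (hφ.integrable_mul_comp (measurable_neuron x) (measurable_neuron y))
    (by exact ((hi x).mul_const _).add ((hi y).mul_const _)), integral_add ((hi x).mul_const _)
    ((hi y).mul_const _), integral_mul_const, integral_mul_const, integral_comp_neuron hφ,
    integral_comp_neuron hφ, integral_mul_neuron hφ.measurable]
  ring

theorem variance_incr_le (hφ : TanhLike φ) (σw σb : ℝ≥0) {N : ℕ} (x y : Fin N → ℝ) (i : Fin N) :
    Var[incr φ x y i; rowLaw σw σb N] ≤ 3 * (1 + x i * x i + y i * y i) := by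
  refine (variance_le_expectation_sq (measurable_incr hφ x y i).aestronglyMeasurable).trans ?_
  have : ∀ r, (incr φ x y i ^ 2) r ≤ 3 * (1 + x i * x i + y i * y i) := by
    intro r
    have h := abs_incr_le hφ x y i r
    have h1 := sq_le_sq' (by linarith [abs_nonneg (incr φ x y i r)]) h
    rw [sq_abs] at h1
    have h2 := abs_mul_abs_self (x i)
    have h3 := abs_mul_abs_self (y i)
    simp only [Pi.pow_apply]
    nlinarith [sq_nonneg (1 - |x i|), sq_nonneg (1 - |y i|), sq_nonneg (|x i| - |y i|)]
  calc ∫ r, (incr φ x y i ^ 2) r ∂(rowLaw σw σb N)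
      ≤ ∫ _, 3 * (1 + x i * x i + y i * y i) ∂(rowLaw σw σb N) :=
        integral_mono (memLp_incr hφ σw σb x y i).integrable_sq (integrable_const _) this
    _ = _ := by simp

/-- The mean square deviation of the next correlation, given the current activations. -/
theorem integral_step_sub_sq_le (hφ : TanhLike φ) (σw σb : ℝ≥0) {N : ℕ} (hN : 0 < N)
    (x y : Fin N → ℝ) (K : ℝ) :
    ∫ η, ((step φ η x ⬝ᵥ step φ η y) / N - K) ^ 2 ∂(layerLaw σw σb N) ≤
      3 * (1 + (x ⬝ᵥ x) / N + (y ⬝ᵥ y) / N) / N + ((x ⬝ᵥ y) / N +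
        W2 φ (preCov σw σb x x) (preCov σw σb y y) (preCov σw σb x y) - K) ^ 2 := by
  have hN' : (0 : ℝ) < N := by exact_mod_cast hN
  rw [← (measurePreserving_layer σw σb N).integral_comp (MeasurableEquiv.measurableEmbedding _)]
  simp_rw [step_dotProduct_step]
  set P := Measure.pi fun _ : Fin N => rowLaw σw σb N with hP
  set T : (Fin N → (Fin N → ℝ) × ℝ) → ℝ := ∑ i, fun R => incr φ x y i (R i) with hT
  set ω := W2 φ (preCov σw σb x x) (preCov σw σb y y) (preCov σw σb x y) with hω
  have hmem : ∀ i, MemLp (fun R : Fin N → (Fin N → ℝ) × ℝ => incr φ x y i (R i)) 2 P := fun i =>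
    (memLp_incr hφ σw σb x y i).comp_measurePreserving (measurePreserving_eval _ i)
  have hTmem : MemLp T 2 P := memLp_finsetSum' _ fun i _ => hmem i
  have hTvar : Var[T; P] ≤ 3 * (N + x ⬝ᵥ x + y ⬝ᵥ y) := by
    rw [hT, variance_sum_pi (memLp_incr hφ σw σb x y)]
    refine (Finset.sum_le_sum fun i _ => variance_incr_le hφ σw σb x y i).trans (le_of_eq ?_)
    rw [← Finset.mul_sum, Finset.sum_add_distrib, Finset.sum_add_distrib]
    simp [dotProduct]
  have hTint : ∫ R, T R ∂P = N * ω := by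
    simp only [hT, Finset.sum_apply]
    rw [integral_finsetSum _ fun i _ => (hmem i).integrable one_le_two]
    have : ∀ i, ∫ R, incr φ x y i (R i) ∂P = ω := by
      intro i
      rw [hω, ← integral_incr hφ σw σb x y i,
        ← (measurePreserving_eval (fun _ : Fin N => rowLaw σw σb N) i).map_eq, integral_map
        (measurable_pi_apply i).aemeasurable (measurable_incr hφ x y i).aestronglyMeasurable]
    simp [this]
  have hTi := hTmem.integrable one_le_two
  -- Decomposition into variance and squared bias; the variance is of order `N`, so after division
  -- by `N²` it is `O(1/N)`.
  have hE : ∫ R, (T R / N + ((x ⬝ᵥ y) / N - K)) ^ 2 ∂P =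
      Var[T; P] / N ^ 2 + (ω + ((x ⬝ᵥ y) / N - K)) ^ 2 := by
    rw [variance_eq_sub hTmem, hTint]
    have e : ∀ R, (T R / N + ((x ⬝ᵥ y) / N - K)) ^ 2 = (T ^ 2) R / N ^ 2 +
        (T R * (2 / N * ((x ⬝ᵥ y) / N - K)) + ((x ⬝ᵥ y) / N - K) ^ 2) := by
      intro R
      simp only [Pi.pow_apply]
      ring
    simp_rw [e]
    have i1 : Integrable (fun R => (T ^ 2) R / (N : ℝ) ^ 2) P := hTmem.integrable_sq.div_const _
    have i2 : Integrable (fun R => T R * (2 / N * ((x ⬝ᵥ y) / N - K))) P := hTi.mul_const _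
    have i3 : Integrable (fun R => T R * (2 / N * ((x ⬝ᵥ y) / N - K)) + ((x ⬝ᵥ y) / N - K) ^ 2) P :=
      i2.add (integrable_const _)
    rw [integral_add i1 i3, integral_add i2 (integrable_const _), integral_div,
      integral_mul_const, hTint]
    simp
    field_simp
    ring
  have e : ∀ R : Fin N → (Fin N → ℝ) × ℝ, ((∑ i, incr φ x y i (R i) + x ⬝ᵥ y) / N - K) ^ 2 =
      (T R / N + ((x ⬝ᵥ y) / N - K)) ^ 2 := by
    intro R
    rw [hT, Finset.sum_apply]
    ring
  simp_rw [e]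
  rw [hE]
  have h1 : Var[T; P] / N ^ 2 ≤ 3 * (1 + (x ⬝ᵥ x) / N + (y ⬝ᵥ y) / N) / N := by
    rw [div_le_iff₀ (by positivity)]
    refine hTvar.trans (le_of_eq ?_)
    field_simp
  have h2 : (ω + ((x ⬝ᵥ y) / N - K)) ^ 2 = ((x ⬝ᵥ y) / N + ω - K) ^ 2 := by ring
  rw [h2]
  linarith

/-! ### Conditioning on a layer and concentration -/

instance (σw σb : ℝ≥0) (N : ℕ) : IsProbabilityMeasure (initLaw σw σb N) := by
  unfold initLaw
  infer_instance

theorem act_succ (φ : ℝ → ℝ) {N : ℕ} (θ : ℕ → Layer N) (x : Fin N → ℝ) (l : ℕ) :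
    act φ θ x (l + 1) = step φ (θ l) (act φ θ x l) := rfl

theorem measurable_affine {N : ℕ} :
    Measurable fun p : Layer N × (Fin N → ℝ) => affine p.1 p.2 := by
  unfold affine
  fun_prop

theorem measurable_step (hφ : TanhLike φ) {N : ℕ} :
    Measurable fun p : Layer N × (Fin N → ℝ) => step φ p.1 p.2 := by
  refine measurable_pi_iff.2 fun i => ?_
  exact (hφ.measurable.comp ((measurable_pi_apply i).comp measurable_affine)).add
    ((measurable_pi_apply i).comp measurable_snd)

theorem measurable_act (hφ : TanhLike φ) {N : ℕ} (x : Fin N → ℝ) (l : ℕ) :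
    Measurable fun θ : ℕ → Layer N => act φ θ x l := by
  induction l with
  | zero => exact measurable_const
  | succ l ih =>
    have hl : Measurable fun θ : ℕ → Layer N => θ l := measurable_pi_apply l
    exact (measurable_step hφ).comp (hl.prodMk ih)

theorem abs_act_le (hφ : TanhLike φ) {N : ℕ} (θ : ℕ → Layer N) (x : Fin N → ℝ) (l : ℕ) (i : Fin N) :
    |act φ θ x l i| ≤ |x i| + l := by
  induction l with
  | zero => simp [act]
  | succ l ih =>
    rw [act_succ]
    have := abs_add_le (φ (affine (θ l) (act φ θ x l) i)) (act φ θ x l i)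
    have := hφ.abs_le_one (affine (θ l) (act φ θ x l) i)
    simp only [step]
    push_cast
    linarith

theorem act_congr (φ : ℝ → ℝ) {N : ℕ} {θ θ' : ℕ → Layer N} (x : Fin N → ℝ) {l : ℕ}
    (h : ∀ k < l, θ k = θ' k) : act φ θ x l = act φ θ' x l := by
  induction l with
  | zero => rfl
  | succ l ih =>
    rw [act_succ, act_succ, ih fun k hk => h k (by omega), h l (by omega)]

theorem measurable_dotProduct {N : ℕ} :
    Measurable fun p : (Fin N → ℝ) × (Fin N → ℝ) => p.1 ⬝ᵥ p.2 := by
  unfold dotProduct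
  fun_prop

theorem measurable_act_dotProduct (hφ : TanhLike φ) {N : ℕ} (x y : Fin N → ℝ) (l : ℕ) :
    Measurable fun θ : ℕ → Layer N => act φ θ x l ⬝ᵥ act φ θ y l :=
  measurable_dotProduct.comp ((measurable_act hφ x l).prodMk (measurable_act hφ y l))

theorem exists_abs_act_dotProduct_le (hφ : TanhLike φ) {N : ℕ} (x y : Fin N → ℝ) (l : ℕ) :
    ∃ B, ∀ θ, |act φ θ x l ⬝ᵥ act φ θ y l| ≤ B := by
  refine ⟨∑ i, (|x i| + l) * (|y i| + l), fun θ => ?_⟩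
  refine (Finset.abs_sum_le_sum_abs _ _).trans (Finset.sum_le_sum fun i _ => ?_)
  rw [abs_mul]
  exact mul_le_mul (abs_act_le hφ θ x l i) (abs_act_le hφ θ y l i) (abs_nonneg _) (by positivity)

theorem memLp_act_dotProduct (hφ : TanhLike φ) (σw σb : ℝ≥0) {N : ℕ} (x y : Fin N → ℝ) (l : ℕ) :
    MemLp (fun θ => act φ θ x l ⬝ᵥ act φ θ y l) 2 (initLaw σw σb N) := by
  obtain ⟨B, hB⟩ := exists_abs_act_dotProduct_le hφ x y l
  exact .of_bound (measurable_act_dotProduct hφ x y l).aestronglyMeasurable B (.of_forall hB)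

/-- The activations at a layer are independent of the parameters of the next one. -/
theorem indepFun_act (hφ : TanhLike φ) (σw σb : ℝ≥0) {N : ℕ} (x y : Fin N → ℝ) (l : ℕ) :
    IndepFun (fun θ : ℕ → Layer N => (act φ θ x l, act φ θ y l)) (fun θ => θ l)
      (initLaw σw σb N) := by
  have h : iIndepFun (fun (i : ℕ) (θ : ℕ → Layer N) => θ i) (initLaw σw σb N) :=
    iIndepFun_infinitePi (P := fun _ : ℕ => layerLaw σw σb N) (X := fun _ η => η)
      fun _ => measurable_id
  have h2 := h.indepFun_finset (Finset.range l) {l} (by simp) fun i => measurable_pi_apply i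
  -- The parameters below layer index `l` are padded by `0`; the activations at `l` do not see the
  -- padding.
  let ext : ((i : Finset.range l) → Layer N) → ℕ → Layer N :=
    fun r n => if hn : n ∈ Finset.range l then r ⟨n, hn⟩ else 0
  have hext : Measurable ext := by
    refine measurable_pi_iff.2 fun n => ?_
    by_cases hn : n ∈ Finset.range l
    · simp only [ext, hn, dite_true]
      exact measurable_pi_apply _
    · simp only [ext, hn, dite_false]
      exact measurable_const
  have hl : Measurable fun r : (i : ({l} : Finset ℕ)) → Layer N =>
      r ⟨l, Finset.mem_singleton_self l⟩ := measurable_pi_apply _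
  have h3 := h2.comp (φ := fun r => (act φ (ext r) x l, act φ (ext r) y l))
    (ψ := fun r => r ⟨l, Finset.mem_singleton_self l⟩)
    (((measurable_act hφ x l).comp hext).prodMk ((measurable_act hφ y l).comp hext))
    hl
  have e : ∀ (z : Fin N → ℝ) (θ : ℕ → Layer N),
      act φ (ext fun i : Finset.range l => θ i) z l = act φ θ z l := by
    intro z θ
    refine act_congr φ z fun k hk => ?_
    simp [ext, hk]
  have e1 : (fun θ : ℕ → Layer N => (act φ θ x l, act φ θ y l)) =
      (fun r => (act φ (ext r) x l, act φ (ext r) y l)) ∘ fun θ (i : Finset.range l) => θ i := by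
    ext θ : 1
    simp only [Function.comp, e]
  rw [e1]
  exact h3

theorem map_eval_initLaw (σw σb : ℝ≥0) (N l : ℕ) :
    (initLaw σw σb N).map (fun θ => θ l) = layerLaw σw σb N :=
  Measure.infinitePi_map_eval (fun _ : ℕ => layerLaw σw σb N) l

/-- Conditioning on the activations of a layer. -/
theorem integral_act_layer (hφ : TanhLike φ) (σw σb : ℝ≥0) {N : ℕ} (x y : Fin N → ℝ) (l : ℕ)
    {F : ((Fin N → ℝ) × (Fin N → ℝ)) × Layer N → ℝ} (hF : Measurable F)
    (hi : Integrable (fun θ => F ((act φ θ x l, act φ θ y l), θ l)) (initLaw σw σb N)) :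
    ∫ θ, F ((act φ θ x l, act φ θ y l), θ l) ∂(initLaw σw σb N) =
      ∫ θ, ∫ η, F ((act φ θ x l, act φ θ y l), η) ∂(layerLaw σw σb N) ∂(initLaw σw σb N) := by
  set μ := initLaw σw σb N with hμ
  have hA : Measurable fun θ : ℕ → Layer N => (act φ θ x l, act φ θ y l) :=
    (measurable_act hφ x l).prodMk (measurable_act hφ y l)
  have hl : Measurable fun θ : ℕ → Layer N => θ l := measurable_pi_apply l
  have hmap := (indepFun_iff_map_prod_eq_prod_map_map hA.aemeasurable hl.aemeasurable).1
    (indepFun_act hφ σw σb x y l)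
  rw [map_eval_initLaw] at hmap
  have hprob : IsProbabilityMeasure (μ.map fun θ => (act φ θ x l, act φ θ y l)) :=
    Measure.isProbabilityMeasure_map hA.aemeasurable
  have hi' : Integrable F ((μ.map fun θ => (act φ θ x l, act φ θ y l)).prod (layerLaw σw σb N)) := by
    rw [← hmap, integrable_map_measure hF.aestronglyMeasurable (hA.prodMk hl).aemeasurable]
    exact hi
  rw [← integral_map (f := F) (hA.prodMk hl).aemeasurable hF.aestronglyMeasurable, hmap,
    integral_prod _ hi', integral_map hA.aemeasurable]
  exact hF.stronglyMeasurable.integral_prod_right'.aestronglyMeasurable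

/-- `integral_mul_neuron` needs only measurability, so it applies to the identity and leaves a
covariance entry of the Gaussian law. -/
theorem integral_mul_neuron_id (σw σb : ℝ≥0) {N : ℕ} (x y : Fin N → ℝ) :
    ∫ r, neuron r x * neuron r y ∂(rowLaw σw σb N) = preCov σw σb x y := by
  have h := integral_mul_neuron measurable_id σw σb x y
  simp only [id] at h
  rw [h, W2]
  have hS := posSemidef_two (A := preCov σw σb x x) (B := preCov σw σb x y)
    (C := preCov σw σb y y) fun s t => by
      rw [preCov_quadratic]
      positivity
  have hc := covariance_eval_multivariateGaussian (μ := 0) hS 0 1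
  have hm : ∀ i : Fin 2, MemLp (fun z : EuclideanSpace ℝ (Fin 2) => z i) 2 (multivariateGaussian 0
      !![preCov σw σb x x, preCov σw σb x y; preCov σw σb x y, preCov σw σb y y]) := fun i =>
    (IsGaussian.memLp_two_id (μ := multivariateGaussian 0
      !![preCov σw σb x x, preCov σw σb x y; preCov σw σb x y, preCov σw σb y y])).continuousLinearMap_comp
      (EuclideanSpace.proj (𝕜 := ℝ) i)
  have h0 : ∀ i : Fin 2, ∫ z : EuclideanSpace ℝ (Fin 2), z i ∂(multivariateGaussian 0
      !![preCov σw σb x x, preCov σw σb x y; preCov σw σb x y, preCov σw σb y y]) = 0 := by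
    intro i
    have := (EuclideanSpace.proj (𝕜 := ℝ) i).integral_comp_comm (IsGaussian.integrable_fun_id
      (μ := multivariateGaussian (0 : EuclideanSpace ℝ (Fin 2))
      !![preCov σw σb x x, preCov σw σb x y; preCov σw σb x y, preCov σw σb y y]))
    rw [integral_id_multivariateGaussian] at this
    simpa using this
  rw [covariance_eq_sub (hm 0) (hm 1), h0, h0] at hc
  simpa using hc

theorem preCov_sq_le (σw σb : ℝ≥0) {N : ℕ} (x y : Fin N → ℝ) :
    preCov σw σb x y ^ 2 ≤ preCov σw σb x x * preCov σw σb y y := by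
  have h : ∀ t : ℝ, 0 ≤ preCov σw σb x x * (t * t) + 2 * preCov σw σb x y * t +
      preCov σw σb y y := by
    intro t
    have := preCov_quadratic σw σb x y t 1
    have h2 : 0 ≤ (σw : ℝ) ^ 2 / N * ∑ j, (t * x j + 1 * y j) ^ 2 + (σb : ℝ) ^ 2 * (t + 1) ^ 2 := by
      positivity
    rw [← this] at h2
    linarith
  have := discrim_le_zero h
  rw [discrim] at this
  linarith

/-- The mean square deviation of the normalized correlation of the activations from `K`. -/
def mse (φ : ℝ → ℝ) (σw σb : ℝ≥0) {N : ℕ} (x y : Fin N → ℝ) (l : ℕ) (K : ℝ) : ℝ :=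
  ∫ θ, ((act φ θ x l ⬝ᵥ act φ θ y l) / N - K) ^ 2 ∂(initLaw σw σb N)

theorem memLp_act_corr_sub (hφ : TanhLike φ) (σw σb : ℝ≥0) {N : ℕ} (x y : Fin N → ℝ) (l : ℕ)
    (K : ℝ) :
    MemLp (fun θ => (act φ θ x l ⬝ᵥ act φ θ y l) / N - K) 2 (initLaw σw σb N) := by
  have := ((memLp_act_dotProduct hφ σw σb x y l).mul_const (N : ℝ)⁻¹).sub (memLp_const K)
  simp only [div_eq_mul_inv]
  exact this

theorem integrable_mse (hφ : TanhLike φ) (σw σb : ℝ≥0) {N : ℕ} (x y : Fin N → ℝ) (l : ℕ) (K : ℝ) :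
    Integrable (fun θ => ((act φ θ x l ⬝ᵥ act φ θ y l) / N - K) ^ 2) (initLaw σw σb N) :=
  (memLp_act_corr_sub hφ σw σb x y l K).integrable_sq

theorem mse_nonneg (φ : ℝ → ℝ) (σw σb : ℝ≥0) {N : ℕ} (x y : Fin N → ℝ) (l : ℕ) (K : ℝ) :
    0 ≤ mse φ σw σb x y l K :=
  integral_nonneg fun _ => sq_nonneg _

theorem sq_actCorr_sub_le (hφ : TanhLike φ) (σw σb : ℝ≥0) {N : ℕ} (x y : Fin N → ℝ) (l : ℕ)
    (K : ℝ) : (actCorr φ σw σb x y l - K) ^ 2 ≤ mse φ σw σb x y l K := by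
  have hm := memLp_act_corr_sub hφ σw σb x y l K
  have h := variance_nonneg (fun θ => (act φ θ x l ⬝ᵥ act φ θ y l) / N - K) (initLaw σw σb N)
  rw [variance_eq_sub hm] at h
  have e : ∫ θ, ((act φ θ x l ⬝ᵥ act φ θ y l) / N - K) ∂(initLaw σw σb N) =
      actCorr φ σw σb x y l - K := by
    rw [integral_sub (((memLp_act_dotProduct hφ σw σb x y l).integrable one_le_two).div_const _)
      (integrable_const _), integral_div]
    simp [actCorr]
  rw [e] at h
  exact sub_nonneg.1 h

/-- Given layer `l`, the one-layer estimate bounds the error by an `O(1/N)` variance and the bias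
`(G - γ) + (W2 - ω)`. The form of `H`, with an additive `ε`, suits a `W2` that is continuous without
a known modulus. -/
theorem mse_succ_le (hφ : TanhLike φ) (σw σb : ℝ≥0) {N : ℕ} (hN : 0 < N) (x y : Fin N → ℝ) (l : ℕ)
    {p γ ω ε C : ℝ}
    (H : ∀ u v : Fin N → ℝ,
      (W2 φ (preCov σw σb u u) (preCov σw σb v v) (preCov σw σb u v) - ω) ^ 2 ≤
        ε + C * (((u ⬝ᵥ u) / N - p) ^ 2 + ((v ⬝ᵥ v) / N - p) ^ 2 + ((u ⬝ᵥ v) / N - γ) ^ 2)) :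
    mse φ σw σb x y (l + 1) (γ + ω) ≤
      3 * (3 + 2 * p + (mse φ σw σb x x l p + mse φ σw σb y y l p)) / N +
        2 * mse φ σw σb x y l γ +
        2 * (ε + C * (mse φ σw σb x x l p + mse φ σw σb y y l p + mse φ σw σb x y l γ)) := by
  set μ := initLaw σw σb N with hμ
  have hN' : (0 : ℝ) < N := by exact_mod_cast hN
  let F : ((Fin N → ℝ) × (Fin N → ℝ)) × Layer N → ℝ := fun a =>
    ((step φ a.2 a.1.1 ⬝ᵥ step φ a.2 a.1.2) / N - (γ + ω)) ^ 2
  have hF : Measurable F := by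
    have h1 : Measurable fun a : ((Fin N → ℝ) × (Fin N → ℝ)) × Layer N => step φ a.2 a.1.1 :=
      (measurable_step hφ).comp (f := fun a : ((Fin N → ℝ) × (Fin N → ℝ)) × Layer N =>
        (a.2, a.1.1)) (by fun_prop)
    have h2 : Measurable fun a : ((Fin N → ℝ) × (Fin N → ℝ)) × Layer N => step φ a.2 a.1.2 :=
      (measurable_step hφ).comp (f := fun a : ((Fin N → ℝ) × (Fin N → ℝ)) × Layer N =>
        (a.2, a.1.2)) (by fun_prop)
    exact (((measurable_dotProduct.comp (h1.prodMk h2)).div_const _).sub_const _).pow_const 2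
  have hcond := integral_act_layer hφ σw σb x y l hF (integrable_mse hφ σw σb x y (l + 1) (γ + ω))
  have hlhs : mse φ σw σb x y (l + 1) (γ + ω) =
      ∫ θ, F ((act φ θ x l, act φ θ y l), θ l) ∂μ := rfl
  rw [hlhs, hcond]
  have i1 := integrable_mse hφ σw σb x x l p
  have i2 := integrable_mse hφ σw σb y y l p
  have i3 := integrable_mse hφ σw σb x y l γ
  set a1 : (ℕ → Layer N) → ℝ := fun θ => ((act φ θ x l ⬝ᵥ act φ θ x l) / N - p) ^ 2 with ha1
  set a2 : (ℕ → Layer N) → ℝ := fun θ => ((act φ θ y l ⬝ᵥ act φ θ y l) / N - p) ^ 2 with ha2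
  set a3 : (ℕ → Layer N) → ℝ := fun θ => ((act φ θ x l ⬝ᵥ act φ θ y l) / N - γ) ^ 2 with ha3
  have j1 : Integrable (fun θ => a1 θ + a2 θ) μ := i1.add i2
  have j2 : Integrable (fun θ => a1 θ + a2 θ + a3 θ) μ := j1.add i3
  have k1 : Integrable (fun θ => 3 * (3 + 2 * p + (a1 θ + a2 θ)) / N) μ :=
    (((integrable_const (3 + 2 * p)).add j1).const_mul 3).div_const _
  have k2 : Integrable (fun θ => 2 * a3 θ) μ := i3.const_mul 2
  have k3 : Integrable (fun θ => ε + C * (a1 θ + a2 θ + a3 θ)) μ :=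
    (integrable_const ε).add (j2.const_mul C)
  have hRint : ∫ θ, (3 * (3 + 2 * p + (a1 θ + a2 θ)) / N + 2 * a3 θ +
      2 * (ε + C * (a1 θ + a2 θ + a3 θ))) ∂μ =
      3 * (3 + 2 * p + (mse φ σw σb x x l p + mse φ σw σb y y l p)) / N +
        2 * mse φ σw σb x y l γ +
        2 * (ε + C * (mse φ σw σb x x l p + mse φ σw σb y y l p + mse φ σw σb x y l γ)) := by
    rw [integral_add (by exact k1.add k2) (k3.const_mul 2), integral_add k1 k2, integral_div,
      integral_const_mul, integral_add (integrable_const _) j1, integral_add i1 i2,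
      integral_const_mul, integral_const_mul, integral_add (integrable_const _) (j2.const_mul C),
      integral_const_mul, integral_add j1 i3, integral_add i1 i2]
    simp [mse, ha1, ha2, ha3, hμ]
  rw [← hRint]
  refine integral_mono_of_nonneg (.of_forall fun θ => integral_nonneg fun η => sq_nonneg _)
    ((k1.add k2).add (k3.const_mul 2)) (.of_forall fun θ => ?_)
  have h1 := integral_step_sub_sq_le hφ σw σb hN (act φ θ x l) (act φ θ y l) (γ + ω)
  have h2 := H (act φ θ x l) (act φ θ y l)
  refine h1.trans ?_
  simp only [ha1, ha2, ha3]
  set P := (act φ θ x l ⬝ᵥ act φ θ x l) / (N : ℝ)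
  set P' := (act φ θ y l ⬝ᵥ act φ θ y l) / (N : ℝ)
  set G := (act φ θ x l ⬝ᵥ act φ θ y l) / (N : ℝ)
  set w := W2 φ (preCov σw σb (act φ θ x l) (act φ θ x l))
    (preCov σw σb (act φ θ y l) (act φ θ y l)) (preCov σw σb (act φ θ x l) (act φ θ y l))
  have h3 : (G + w - (γ + ω)) ^ 2 ≤ 2 * (G - γ) ^ 2 + 2 * (w - ω) ^ 2 := by
    nlinarith [sq_nonneg (G - γ - (w - ω))]
  -- From `P ≤ p + 1 + (P - p)²`: the random lengths in the variance bound are thus controlled by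
  -- the mean-square errors themselves.
  have h4 : 3 * (1 + P + P') / (N : ℝ) ≤ 3 * (3 + 2 * p + ((P - p) ^ 2 + (P' - p) ^ 2)) / N := by
    have : 1 + P + P' ≤ 3 + 2 * p + ((P - p) ^ 2 + (P' - p) ^ 2) := by
      nlinarith [sq_nonneg (P - p - 1), sq_nonneg (P' - p - 1), sq_nonneg (P - p),
        sq_nonneg (P' - p)]
    refine div_le_div_of_nonneg_right ?_ hN'.le
    linarith
  linarith

/-- Local continuity becomes a global quadratic bound: either all three deviations are small and the
squared error is below `ε`, or one is large and the trivial bound `4` is at most a multiple of its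
square. -/
theorem exists_W2_modulus (hφ : TanhLike φ) (σw σb : ℝ≥0) {p γ : ℝ} (hp : 0 < p) (hγ : |γ| ≤ p)
    {ε : ℝ} (hε : 0 < ε) :
    ∃ C, 0 ≤ C ∧ ∀ (N : ℕ) (u v : Fin N → ℝ),
      (W2 φ (preCov σw σb u u) (preCov σw σb v v) (preCov σw σb u v) -
        W φ ((σw : ℝ) ^ 2 * p + (σb : ℝ) ^ 2) ((σw : ℝ) ^ 2 * γ + (σb : ℝ) ^ 2)) ^ 2 ≤
        ε + C * (((u ⬝ᵥ u) / N - p) ^ 2 + ((v ⬝ᵥ v) / N - p) ^ 2 + ((u ⬝ᵥ v) / N - γ) ^ 2) := by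
  -- For `σw = 0` the limiting variance may vanish, where continuity is unavailable, but then the
  -- covariances are constant and the error is `0`.
  rcases (zero_le : 0 ≤ σw).eq_or_lt with h0 | h0
  · refine ⟨0, le_rfl, fun N u v => ?_⟩
    simp only [← h0, preCov, W_eq_W2, NNReal.coe_zero, ne_eq, OfNat.ofNat_ne_zero,
      not_false_eq_true, zero_pow, zero_mul, zero_add, sub_self, add_zero]
    exact hε.le
  have hw : (0 : ℝ) < (σw : ℝ) ^ 2 := by positivity
  set w := (σw : ℝ) ^ 2 with hw'
  set b := (σb : ℝ) ^ 2 with hb'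
  have hb : 0 ≤ b := by positivity
  have hq : 0 < w * p + b := by positivity
  have hc : |w * γ + b| ≤ w * p + b := by
    obtain ⟨h1, h2⟩ := abs_le.1 hγ
    rw [abs_le]
    constructor <;> nlinarith
  obtain ⟨δ, hδ, H⟩ := exists_delta_W2 hφ hq hc (Real.sqrt_pos.2 hε)
  refine ⟨4 * w ^ 2 / δ ^ 2, by positivity, fun N u v => ?_⟩
  set P := (u ⬝ᵥ u) / (N : ℝ) with hP
  set P' := (v ⬝ᵥ v) / (N : ℝ) with hP'
  set G := (u ⬝ᵥ v) / (N : ℝ) with hG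
  have e1 : preCov σw σb u u - (w * p + b) = w * (P - p) := by simp only [preCov]; ring
  have e2 : preCov σw σb v v - (w * p + b) = w * (P' - p) := by simp only [preCov]; ring
  have e3 : preCov σw σb u v - (w * γ + b) = w * (G - γ) := by simp only [preCov]; ring
  have hnn : 0 ≤ 4 * w ^ 2 / δ ^ 2 * ((P - p) ^ 2 + (P' - p) ^ 2 + (G - γ) ^ 2) := by positivity
  by_cases hall : |w * (P - p)| < δ ∧ |w * (P' - p)| < δ ∧ |w * (G - γ)| < δ
  · have := H (preCov σw σb u u) (preCov σw σb v v) (preCov σw σb u v) (by rw [e1]; exact hall.1)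
      (by rw [e2]; exact hall.2.1) (by rw [e3]; exact hall.2.2) (preCov_sq_le σw σb u v)
    have h2 := sq_lt_sq.2 (this.trans_le (le_abs_self _))
    rw [Real.sq_sqrt hε.le] at h2
    linarith
  · have h4 : (W2 φ (preCov σw σb u u) (preCov σw σb v v) (preCov σw σb u v) -
        W φ (w * p + b) (w * γ + b)) ^ 2 ≤ 4 := by
      obtain ⟨a1, a2⟩ := abs_le.1 (hφ.abs_W2_le_one (preCov σw σb u u) (preCov σw σb v v)
        (preCov σw σb u v))
      obtain ⟨a3, a4⟩ := abs_le.1 (hφ.abs_W2_le_one (w * p + b) (w * p + b) (w * γ + b))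
      rw [← W_eq_W2] at a3 a4
      nlinarith
    have h5 : δ ^ 2 ≤ w ^ 2 * ((P - p) ^ 2 + (P' - p) ^ 2 + (G - γ) ^ 2) := by
      have key : ∀ t : ℝ, δ ≤ |w * t| → δ ^ 2 ≤ w ^ 2 * t ^ 2 := by
        intro t ht
        rw [← mul_pow, ← sq_abs (w * t)]
        gcongr
      have n1 : 0 ≤ w ^ 2 * (P - p) ^ 2 := by positivity
      have n2 : 0 ≤ w ^ 2 * (P' - p) ^ 2 := by positivity
      have n3 : 0 ≤ w ^ 2 * (G - γ) ^ 2 := by positivity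
      simp only [not_and_or, not_lt] at hall
      rcases hall with h | h | h
      · linarith [key _ h]
      · linarith [key _ h]
      · linarith [key _ h]
    have h6 : 4 ≤ 4 * w ^ 2 / δ ^ 2 * ((P - p) ^ 2 + (P' - p) ^ 2 + (G - γ) ^ 2) := by
      rw [div_mul_eq_mul_div, le_div_iff₀ (by positivity)]
      linarith
    linarith

theorem tendsto_mse_succ (hφ : TanhLike φ) (σw σb : ℝ≥0) {x y : (N : ℕ) → Fin N → ℝ} {l : ℕ}
    {p γ : ℝ} (hp : 0 < p) (hγ : |γ| ≤ p)
    (hxx : Tendsto (fun N => mse φ σw σb (x N) (x N) l p) atTop (𝓝 0))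
    (hyy : Tendsto (fun N => mse φ σw σb (y N) (y N) l p) atTop (𝓝 0))
    (hxy : Tendsto (fun N => mse φ σw σb (x N) (y N) l γ) atTop (𝓝 0)) :
    Tendsto (fun N => mse φ σw σb (x N) (y N) (l + 1) (γ +
      W φ ((σw : ℝ) ^ 2 * p + (σb : ℝ) ^ 2) ((σw : ℝ) ^ 2 * γ + (σb : ℝ) ^ 2))) atTop (𝓝 0) := by
  rw [tendsto_order]
  refine ⟨fun a ha => .of_forall fun N => ha.trans_le (mse_nonneg _ _ _ _ _ _ _), fun a ha => ?_⟩
  obtain ⟨C, hC, H⟩ := exists_W2_modulus hφ σw σb hp hγ (ε := a / 4) (by linarith)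
  have hlim : Tendsto (fun N : ℕ => 3 * (3 + 2 * p + (mse φ σw σb (x N) (x N) l p +
      mse φ σw σb (y N) (y N) l p)) / N + 2 * mse φ σw σb (x N) (y N) l γ +
        2 * (a / 4 + C * (mse φ σw σb (x N) (x N) l p + mse φ σw σb (y N) (y N) l p +
          mse φ σw σb (x N) (y N) l γ))) atTop (𝓝 (0 + 2 * 0 + 2 * (a / 4 + C * (0 + 0 + 0)))) := by
    refine (Tendsto.add ?_ (hxy.const_mul 2)).add
      ((((hxx.add hyy).add hxy).const_mul C).const_add (a / 4) |>.const_mul 2)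
    exact (((hxx.add hyy).const_add (3 + 2 * p)).const_mul 3).div_atTop
      tendsto_natCast_atTop_atTop
  have hlt : 0 + 2 * 0 + 2 * (a / 4 + C * (0 + 0 + 0)) < a := by linarith
  filter_upwards [hlim.eventually (eventually_lt_nhds hlt), eventually_gt_atTop 0] with N h1 h2
  exact (mse_succ_le hφ σw σb h2 (x N) (y N) l (H N)).trans_lt h1

theorem tendsto_actCorr_of_mse (hφ : TanhLike φ) (σw σb : ℝ≥0) {x y : (N : ℕ) → Fin N → ℝ} {l : ℕ}
    {K : ℝ} (h : Tendsto (fun N => mse φ σw σb (x N) (y N) l K) atTop (𝓝 0)) :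
    Tendsto (fun N => actCorr φ σw σb (x N) (y N) l) atTop (𝓝 K) := by
  rw [← tendsto_sub_nhds_zero_iff]
  have h2 := (Real.continuous_sqrt.tendsto 0).comp h
  rw [Real.sqrt_zero] at h2
  refine squeeze_zero_norm (fun N => ?_) h2
  exact Real.abs_le_sqrt (sq_actCorr_sub_le hφ σw σb (x N) (y N) l K)

theorem mse_zero (φ : ℝ → ℝ) (σw σb : ℝ≥0) {N : ℕ} (x y : Fin N → ℝ) (K : ℝ) :
    mse φ σw σb x y 0 K = ((x ⬝ᵥ y) / N - K) ^ 2 := by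
  simp [mse, act]

/-- The preactivation correlation of a layer in terms of the activations below it. -/
theorem preactCorr_eq (hφ : TanhLike φ) (σw σb : ℝ≥0) {N : ℕ} (hN : 0 < N) (x y : Fin N → ℝ)
    (l : ℕ) : preactCorr φ σw σb x y l =
      (σw : ℝ) ^ 2 * actCorr φ σw σb x y l + (σb : ℝ) ^ 2 := by
  have hN' : (N : ℝ) ≠ 0 := by exact_mod_cast hN.ne'
  set μ := initLaw σw σb N with hμ
  have hnm : ∀ z : Fin N → ℝ, MemLp (fun r => neuron r z) 2 (rowLaw σw σb N) := by
    intro z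
    refine MemLp.add (f := fun r : (Fin N → ℝ) × ℝ => ∑ j, r.1 j * z j) (g := fun r => r.2) ?_ ?_
    · refine memLp_finsetSum _ fun j _ => MemLp.mul_const ?_ _
      have h1 : MeasurePreserving (fun r : (Fin N → ℝ) × ℝ => r.1 j) (rowLaw σw σb N)
          (gaussianReal 0 (σw ^ 2 / (N : ℝ≥0))) :=
        (measurePreserving_eval (fun _ : Fin N => gaussianReal 0 (σw ^ 2 / (N : ℝ≥0))) j).comp
          measurePreserving_fst
      exact (memLp_id_gaussianReal' 2 (by simp)).comp_measurePreserving h1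
    · exact (memLp_id_gaussianReal' 2 (by simp)).comp_measurePreserving
        (measurePreserving_snd (μ := Measure.pi fun _ : Fin N =>
          gaussianReal 0 (σw ^ 2 / (N : ℝ≥0))) (ν := gaussianReal 0 (σb ^ 2)))
  let F : ((Fin N → ℝ) × (Fin N → ℝ)) × Layer N → ℝ := fun a =>
    affine a.2 a.1.1 ⬝ᵥ affine a.2 a.1.2
  have hF : Measurable F := by
    have h1 : Measurable fun a : ((Fin N → ℝ) × (Fin N → ℝ)) × Layer N => affine a.2 a.1.1 :=
      measurable_affine.comp (f := fun a : ((Fin N → ℝ) × (Fin N → ℝ)) × Layer N =>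
        (a.2, a.1.1)) (by fun_prop)
    have h2 : Measurable fun a : ((Fin N → ℝ) × (Fin N → ℝ)) × Layer N => affine a.2 a.1.2 :=
      measurable_affine.comp (f := fun a : ((Fin N → ℝ) × (Fin N → ℝ)) × Layer N =>
        (a.2, a.1.2)) (by fun_prop)
    exact measurable_dotProduct.comp (h1.prodMk h2)
  have hinner : ∀ u v : Fin N → ℝ, ∫ η, affine η u ⬝ᵥ affine η v ∂(layerLaw σw σb N) =
      N * preCov σw σb u v := by
    intro u v
    rw [← (measurePreserving_layer σw σb N).integral_comp (MeasurableEquiv.measurableEmbedding _)]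
    have e : ∀ R : Fin N → (Fin N → ℝ) × ℝ,
        affine (MeasurableEquiv.arrowProdEquivProdArrow (Fin N → ℝ) ℝ (Fin N) R) u ⬝ᵥ
        affine (MeasurableEquiv.arrowProdEquivProdArrow (Fin N → ℝ) ℝ (Fin N) R) v =
        ∑ i, neuron (R i) u * neuron (R i) v := fun R => rfl
    simp_rw [e]
    have hi : Integrable (fun r => neuron r u * neuron r v) (rowLaw σw σb N) :=
      (hnm u).integrable_mul (hnm v)
    have hp := fun i => measurePreserving_eval (fun _ : Fin N => rowLaw σw σb N) i
    rw [integral_finsetSum _ fun i _ => by exact (hp i).integrable_comp_of_integrable hi]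
    have : ∀ i, ∫ R : Fin N → (Fin N → ℝ) × ℝ, neuron (R i) u * neuron (R i) v
        ∂(Measure.pi fun _ => rowLaw σw σb N) = preCov σw σb u v := by
      intro i
      rw [← integral_mul_neuron_id σw σb u v]
      exact integral_comp_eval (μ := fun _ : Fin N => rowLaw σw σb N) (i := i)
        ((measurable_neuron u).mul (measurable_neuron v)).aestronglyMeasurable
    simp [this]
  have hpm : ∀ (z : Fin N → ℝ) (i : Fin N), MemLp (fun θ => preact φ θ z l i) 2 μ := by
    intro z i
    have hev : MeasurePreserving (fun θ : ℕ → Layer N => θ l) μ (layerLaw σw σb N) :=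
      ⟨measurable_pi_apply l, map_eval_initLaw σw σb N l⟩
    refine MemLp.add (f := fun θ : ℕ → Layer N => ∑ j, (θ l).1 i j * act φ θ z l j)
      (g := fun θ => (θ l).2 i) ?_ ?_
    · refine memLp_finsetSum _ fun j _ => ?_
      have h1 : MeasurePreserving (fun η : Layer N => η.1 i j) (layerLaw σw σb N)
          (gaussianReal 0 (σw ^ 2 / (N : ℝ≥0))) :=
        ((measurePreserving_eval (fun _ : Fin N => gaussianReal 0 (σw ^ 2 / (N : ℝ≥0))) j).comp
          (measurePreserving_eval (fun _ : Fin N => Measure.pi fun _ : Fin N =>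
            gaussianReal 0 (σw ^ 2 / (N : ℝ≥0))) i)).comp measurePreserving_fst
      have h2 : MemLp (fun θ : ℕ → Layer N => (θ l).1 i j) 2 μ :=
        (memLp_id_gaussianReal' 2 (by simp)).comp_measurePreserving (h1.comp hev)
      have h3 : MemLp (fun θ : ℕ → Layer N => act φ θ z l j) ⊤ μ :=
        .of_bound ((measurable_pi_apply j).comp (measurable_act hφ z l)).aestronglyMeasurable _
          (.of_forall fun θ => abs_act_le hφ θ z l j)
      -- The activation has a deterministic bound, so its product with a square-integrable weight is
      -- square-integrable.
      exact h3.mul h2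
    · have h1 : MeasurePreserving (fun η : Layer N => η.2 i) (layerLaw σw σb N)
          (gaussianReal 0 (σb ^ 2)) :=
        (measurePreserving_eval (fun _ : Fin N => gaussianReal 0 (σb ^ 2)) i).comp
          measurePreserving_snd
      exact (memLp_id_gaussianReal' 2 (by simp)).comp_measurePreserving (h1.comp hev)
  have hint : Integrable (fun θ => F ((act φ θ x l, act φ θ y l), θ l)) μ := by
    refine integrable_finsetSum _ fun i _ => ?_
    exact (hpm x i).integrable_mul (hpm y i)
  have hcond := integral_act_layer hφ σw σb x y l hF hint
  have hlhs : preactCorr φ σw σb x y l =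
      (∫ θ, F ((act φ θ x l, act φ θ y l), θ l) ∂μ) / N := rfl
  rw [hlhs, hcond]
  simp only [F, hinner]
  rw [integral_const_mul, mul_div_cancel_left₀ _ hN']
  simp only [preCov]
  rw [integral_add ((((memLp_act_dotProduct hφ σw σb x y l).integrable one_le_two).div_const
    _).const_mul _) (integrable_const _), integral_const_mul, integral_div]
  simp [actCorr]

/-! ### The limiting sequences and their orders of growth -/

/-- The large-width length quantities. -/
def lenSeq (φ : ℝ → ℝ) (w b p₀ : ℝ) : ℕ → ℝ
  | 0 => p₀
  | l + 1 => lenSeq φ w b p₀ l + W φ (w * lenSeq φ w b p₀ l + b) (w * lenSeq φ w b p₀ l + b)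

/-- The large-width correlation quantities. -/
def corrSeq (φ : ℝ → ℝ) (w b p₀ γ₀ : ℝ) : ℕ → ℝ
  | 0 => γ₀
  | l + 1 => corrSeq φ w b p₀ γ₀ l +
      W φ (w * lenSeq φ w b p₀ l + b) (w * corrSeq φ w b p₀ γ₀ l + b)

section Sequences

variable {w b p₀ γ₀ : ℝ}

theorem lenSeq_pos (hφ : TanhLike φ) (hw : 0 ≤ w) (hb : 0 ≤ b) (hp : 0 < p₀) (l : ℕ) :
    0 < lenSeq φ w b p₀ l := by
  induction l with
  | zero => exact hp
  | succ l ih =>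
    have := W_diag_nonneg hφ (q := w * lenSeq φ w b p₀ l + b) (by positivity)
    simp only [lenSeq]
    linarith

theorem abs_affine_le {p γ : ℝ} (hw : 0 ≤ w) (hb : 0 ≤ b) (h : |γ| ≤ p) :
    |w * γ + b| ≤ w * p + b := by
  obtain ⟨h1, h2⟩ := abs_le.1 h
  rw [abs_le]
  constructor <;> nlinarith

theorem abs_corrSeq_le (hφ : TanhLike φ) (hw : 0 ≤ w) (hb : 0 ≤ b) (hγ : |γ₀| ≤ p₀) (l : ℕ) :
    |corrSeq φ w b p₀ γ₀ l| ≤ lenSeq φ w b p₀ l := by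
  induction l with
  | zero => exact hγ
  | succ l ih =>
    simp only [corrSeq, lenSeq]
    have := abs_W_le_W_diag hφ (abs_affine_le hw hb ih)
    have := abs_add_le (corrSeq φ w b p₀ γ₀ l)
      (W φ (w * lenSeq φ w b p₀ l + b) (w * corrSeq φ w b p₀ γ₀ l + b))
    linarith

theorem corrSeq_self (φ : ℝ → ℝ) (w b p₀ : ℝ) (l : ℕ) :
    corrSeq φ w b p₀ p₀ l = lenSeq φ w b p₀ l := by
  induction l with
  | zero => rfl
  | succ l ih => simp only [corrSeq, lenSeq, ih]

theorem lenSeq_le (hφ : TanhLike φ) (l : ℕ) : lenSeq φ w b p₀ l ≤ p₀ + l := by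
  induction l with
  | zero => simp [lenSeq]
  | succ l ih =>
    have := W_diag_le_one hφ (w * lenSeq φ w b p₀ l + b)
    simp only [lenSeq]
    push_cast
    linarith

theorem corrSeq_of_zero (φ : ℝ → ℝ) (b p₀ γ₀ : ℝ) (l : ℕ) :
    corrSeq φ 0 b p₀ γ₀ l = l * W φ b b + γ₀ := by
  induction l with
  | zero => simp [corrSeq]
  | succ l ih =>
    simp only [corrSeq, ih, zero_mul, zero_add]
    push_cast
    ring

theorem preRec (hw : 0 < w) (hb : 0 ≤ b) (hp : 0 < p₀) (hγ : |γ₀| ≤ p₀) :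
    PreRec φ w (fun l => w * lenSeq φ w b p₀ l + b) (fun l => w * corrSeq φ w b p₀ γ₀ l + b) where
  w_pos := hw
  q_zero := by simp only [lenSeq]; positivity
  abs_zero := abs_affine_le hw.le hb hγ
  q_succ l := by simp only [lenSeq]; ring
  c_succ l := by simp only [corrSeq]; ring

theorem exists_linear_le_lenSeq_sub (hφ : TanhLike φ) (hw : 0 < w) (hb : 0 ≤ b) (hp : 0 < p₀)
    (hγ : |γ₀| ≤ p₀) (h : γ₀ < p₀) :
    ∃ k > 0, ∀ l : ℕ, k * l ≤ lenSeq φ w b p₀ l - corrSeq φ w b p₀ γ₀ l := by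
  obtain ⟨k, hk, H⟩ := (preRec (φ := φ) hw hb hp hγ).exists_linear_le_sub hφ
    (by simp only [corrSeq, lenSeq]; nlinarith)
  refine ⟨k / w, by positivity, fun l => ?_⟩
  have := H l
  rw [div_mul_eq_mul_div, div_le_iff₀ hw]
  linarith

theorem isBigO_lenSeq (hφ : TanhLike φ) (hw : 0 ≤ w) (hb : 0 ≤ b) (hp : 0 < p₀) :
    lenSeq φ w b p₀ =O[atTop] (fun l : ℕ => (l : ℝ)) := by
  refine .of_bound (p₀ + 1) ?_
  filter_upwards [eventually_ge_atTop 1] with l hl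
  have hl' : (1 : ℝ) ≤ l := by exact_mod_cast hl
  rw [Real.norm_of_nonneg (lenSeq_pos hφ hw hb hp l).le, Real.norm_of_nonneg (by positivity)]
  have := lenSeq_le hφ (w := w) (b := b) (p₀ := p₀) l
  nlinarith

theorem isBigO_sub_lenSeq (hφ : TanhLike φ) (hw : 0 ≤ w) (hb : 0 ≤ b) (hγ : |γ₀| ≤ p₀) :
    (fun l => lenSeq φ w b p₀ l - corrSeq φ w b p₀ γ₀ l) =O[atTop] lenSeq φ w b p₀ := by
  refine .of_bound 2 (.of_forall fun l => ?_)
  have h := abs_corrSeq_le hφ hw hb hγ l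
  obtain ⟨h1, h2⟩ := abs_le.1 h
  rw [Real.norm_of_nonneg (by linarith), Real.norm_of_nonneg ((abs_nonneg _).trans h)]
  linarith

theorem isBigO_natCast_sub (hφ : TanhLike φ) (hw : 0 < w) (hb : 0 ≤ b) (hp : 0 < p₀)
    (hγ : |γ₀| ≤ p₀) (h : γ₀ < p₀) :
    (fun l : ℕ => (l : ℝ)) =O[atTop] fun l => lenSeq φ w b p₀ l - corrSeq φ w b p₀ γ₀ l := by
  obtain ⟨k, hk, H⟩ := exists_linear_le_lenSeq_sub hφ hw hb hp hγ h
  refine .of_bound k⁻¹ (.of_forall fun l => ?_)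
  have := H l
  have h0 : 0 ≤ k * (l : ℝ) := by positivity
  rw [Real.norm_of_nonneg (by positivity), Real.norm_of_nonneg (h0.trans this),
    ← div_eq_inv_mul, le_div_iff₀ hk]
  linarith

theorem sub_isTheta_natCast (hφ : TanhLike φ) (hw : 0 < w) (hb : 0 ≤ b) (hp : 0 < p₀)
    (hγ : |γ₀| ≤ p₀) (h : γ₀ < p₀) :
    (fun l => lenSeq φ w b p₀ l - corrSeq φ w b p₀ γ₀ l) =Θ[atTop] (fun l : ℕ => (l : ℝ)) :=
  ⟨(isBigO_sub_lenSeq hφ hw.le hb hγ).trans (isBigO_lenSeq hφ hw.le hb hp),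
    isBigO_natCast_sub hφ hw hb hp hγ h⟩

theorem sub_isTheta_lenSeq (hφ : TanhLike φ) (hw : 0 < w) (hb : 0 ≤ b) (hp : 0 < p₀)
    (hγ : |γ₀| ≤ p₀) (h : γ₀ < p₀) :
    (fun l => lenSeq φ w b p₀ l - corrSeq φ w b p₀ γ₀ l) =Θ[atTop] lenSeq φ w b p₀ :=
  ⟨isBigO_sub_lenSeq hφ hw.le hb hγ,
    (isBigO_lenSeq hφ hw.le hb hp).trans (isBigO_natCast_sub hφ hw hb hp hγ h)⟩

theorem cosDist_self (hφ : TanhLike φ) (hw : 0 ≤ w) (hb : 0 ≤ b) (hp : 0 < p₀) (γ : ℕ → ℝ) (l : ℕ) :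
    cosDist (lenSeq φ w b p₀) (lenSeq φ w b p₀) γ l = γ l / lenSeq φ w b p₀ l := by
  rw [cosDist, Real.sqrt_mul_self (lenSeq_pos hφ hw hb hp l).le]

/-- From `c / q → 0` and `q → ∞`, through `γ / p = (c - b) / (q - b)`. -/
theorem tendsto_corrSeq_div (hφ : TanhLike φ) (hw : 0 < w) (hb : 0 ≤ b) (hp : 0 < p₀)
    (hγ : |γ₀| ≤ p₀) (h : |w * γ₀ + b| < w * p₀ + b) :
    Tendsto (fun l => corrSeq φ w b p₀ γ₀ l / lenSeq φ w b p₀ l) atTop (𝓝 0) := by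
  have hr := preRec (φ := φ) hw hb hp hγ
  have h1 := (hr.abs hφ).tendsto_ratio hφ (abs_nonneg _) h
  have h2 : Tendsto (fun l => b / (w * lenSeq φ w b p₀ l + b)) atTop (𝓝 0) :=
    (hr.tendsto_q hφ).const_div_atTop b
  have h3 : Tendsto (fun l => (w * corrSeq φ w b p₀ γ₀ l + b) / (w * lenSeq φ w b p₀ l + b)) atTop
      (𝓝 0) := by
    refine squeeze_zero_norm (fun l => ?_) h1
    rw [norm_div, Real.norm_eq_abs, Real.norm_of_nonneg (hr.q_pos hφ l).le]
  have h4 := (h3.sub h2).div (tendsto_const_nhds.sub h2) (show (1 : ℝ) - 0 ≠ 0 by norm_num)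
  simp only [sub_zero, zero_div] at h4
  refine h4.congr fun l => ?_
  have hq := hr.q_pos hφ l
  have hpl := lenSeq_pos hφ hw.le hb hp l
  simp only [Pi.div_apply] at hq ⊢
  have e1 : 1 - b / (w * lenSeq φ w b p₀ l + b) =
      w * lenSeq φ w b p₀ l / (w * lenSeq φ w b p₀ l + b) := by
    field_simp
    ring
  rw [e1, ← sub_div, add_sub_cancel_right, div_div_div_cancel_right₀ hq.ne',
    mul_div_mul_left _ _ hw.ne']

theorem two_div_pi_lt_one : 2 / Real.pi < 1 := by
  rw [div_lt_one Real.pi_pos]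
  linarith [Real.pi_gt_three]

theorem isBigO_rpow_rpow {a a' : ℝ} (h : a ≤ a') :
    (fun l : ℕ => (l : ℝ) ^ a) =O[atTop] fun l : ℕ => (l : ℝ) ^ a' := by
  refine .of_bound 1 ?_
  filter_upwards [eventually_ge_atTop 1] with l hl
  have hl' : (1 : ℝ) ≤ l := by exact_mod_cast hl
  rw [one_mul, Real.norm_of_nonneg (by positivity), Real.norm_of_nonneg (by positivity)]
  exact Real.rpow_le_rpow_of_exponent_le hl' h

theorem isBigO_corrSeq (hφ : TanhLike φ) (hw : 0 < w) (hb : 0 ≤ b) (hp : 0 < p₀)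
    (hγ : |γ₀| ≤ p₀) (h : |w * γ₀ + b| < w * p₀ + b) {a : ℝ} (ha : 2 / Real.pi < a) :
    corrSeq φ w b p₀ γ₀ =O[atTop] fun l : ℕ => (l : ℝ) ^ a := by
  -- The growth lemma needs an exponent at most `1`; a larger `a` only weakens the claim.
  have ha' : 2 / Real.pi < min a 1 := lt_min ha two_div_pi_lt_one
  refine IsBigO.trans ?_ (isBigO_rpow_rpow (min_le_left a 1))
  have ha0 : 0 < min a 1 := (div_pos two_pos Real.pi_pos).trans ha'
  obtain ⟨C, hC, H⟩ := ((preRec (φ := φ) hw hb hp hγ).abs hφ).exists_le_rpow hφ (abs_nonneg _) h ha'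
    (min_le_right a 1)
  refine .of_bound ((C + b) / w) ?_
  filter_upwards [H, eventually_ge_atTop 1] with l hl hl1
  have hl' : (1 : ℝ) ≤ l := by exact_mod_cast hl1
  have h1 : 1 ≤ (l : ℝ) ^ min a 1 := Real.one_le_rpow hl' ha0.le
  rw [Real.norm_of_nonneg (by positivity : 0 ≤ (l : ℝ) ^ min a 1), Real.norm_eq_abs,
    div_mul_eq_mul_div, le_div_iff₀ hw]
  have h2 : |w * corrSeq φ w b p₀ γ₀ l| ≤ |w * corrSeq φ w b p₀ γ₀ l + b| + b := by
    have := abs_sub_abs_le_abs_sub (w * corrSeq φ w b p₀ γ₀ l) (-b)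
    rw [sub_neg_eq_add, abs_neg, abs_of_nonneg hb] at this
    linarith
  rw [abs_mul, abs_of_pos hw] at h2
  nlinarith

theorem isBigO_rpow_corrSeq (hφ : TanhLike φ) (hw : 0 < w) (hb : 0 ≤ b) (hp : 0 < p₀)
    (hγ : |γ₀| ≤ p₀) (h : |w * γ₀ + b| < w * p₀ + b) (h0 : w * γ₀ + b ≠ 0) {a : ℝ}
    (ha : a < 2 / Real.pi) :
    (fun l : ℕ => (l : ℝ) ^ a) =O[atTop] corrSeq φ w b p₀ γ₀ := by
  have hpi : 0 < 2 / Real.pi := div_pos two_pos Real.pi_pos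
  -- The exponent is raised to a positive one still below `2/π`. The power then diverges, and half
  -- of it absorbs the bias `b`, whence the constant `2 * w / C`.
  refine (isBigO_rpow_rpow (le_max_left a (1 / Real.pi))).trans ?_
  set a' := max a (1 / Real.pi) with ha'
  have h1 : a' < 2 / Real.pi := max_lt ha (by gcongr; norm_num)
  have h2 : 0 < a' := (by positivity : (0 : ℝ) < 1 / Real.pi).trans_le (le_max_right _ _)
  obtain ⟨C, hC, H⟩ := ((preRec (φ := φ) hw hb hp hγ).abs hφ).exists_rpow_le hφ
    (abs_pos.2 h0) h h1 h2
  have hlim : Tendsto (fun l : ℕ => C * (l : ℝ) ^ a') atTop atTop :=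
    ((tendsto_rpow_atTop h2).comp tendsto_natCast_atTop_atTop).const_mul_atTop hC
  refine .of_bound (2 * w / C) ?_
  filter_upwards [H, hlim.eventually (eventually_ge_atTop (2 * b))] with l hl hl2
  rw [Real.norm_of_nonneg (by positivity), Real.norm_eq_abs, div_mul_eq_mul_div, le_div_iff₀ hC]
  have h3 := abs_add_le (w * corrSeq φ w b p₀ γ₀ l) b
  rw [abs_mul, abs_of_pos hw, abs_of_nonneg hb] at h3
  linarith

theorem isThetaCheck_corrSeq (hφ : TanhLike φ) (hw : 0 < w) (hb : 0 ≤ b) (hp : 0 < p₀)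
    (hγ : |γ₀| ≤ p₀) (h : |w * γ₀ + b| < w * p₀ + b) (h0 : w * γ₀ + b ≠ 0) :
    IsThetaCheck (corrSeq φ w b p₀ γ₀) fun l : ℕ => (l : ℝ) ^ (2 / Real.pi) := by
  have e : ∀ δ : ℝ, (fun l : ℕ => (l : ℝ) ^ (2 / Real.pi) * (l : ℝ) ^ δ) =ᶠ[atTop]
      fun l : ℕ => (l : ℝ) ^ (2 / Real.pi + δ) := by
    intro δ
    filter_upwards [eventually_gt_atTop 0] with l hl
    rw [Real.rpow_add (by exact_mod_cast hl)]
  intro ε hε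
  refine ⟨?_, ?_⟩
  · exact (isBigO_corrSeq hφ hw hb hp hγ h (by linarith)).trans_eventuallyEq (e ε).symm
  · exact (e (-ε)).trans_isBigO (isBigO_rpow_corrSeq hφ hw hb hp hγ h h0 (by linarith))

theorem isThetaCheck_corrSeq_div (hφ : TanhLike φ) (hw : 0 < w) (hb : 0 ≤ b) (hp : 0 < p₀)
    (hγ : |γ₀| ≤ p₀) (h : |w * γ₀ + b| < w * p₀ + b) (h0 : w * γ₀ + b ≠ 0) (hlt : γ₀ < p₀) :
    IsThetaCheck (fun l => corrSeq φ w b p₀ γ₀ l / lenSeq φ w b p₀ l)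
      fun l : ℕ => (l : ℝ) ^ (2 / Real.pi - 1) := by
  have hΘ : lenSeq φ w b p₀ =Θ[atTop] fun l : ℕ => (l : ℝ) :=
    (sub_isTheta_lenSeq hφ hw hb hp hγ hlt).symm.trans (sub_isTheta_natCast hφ hw hb hp hγ hlt)
  have hinv := hΘ.inv
  have e : ∀ δ : ℝ, (fun l : ℕ => (l : ℝ) ^ (2 / Real.pi - 1) * (l : ℝ) ^ δ) =ᶠ[atTop]
      fun l : ℕ => (l : ℝ) ^ (2 / Real.pi) * (l : ℝ) ^ δ * (l : ℝ)⁻¹ := by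
    intro δ
    filter_upwards [eventually_gt_atTop 0] with l hl
    have hl' : (l : ℝ) ≠ 0 := by exact_mod_cast hl.ne'
    rw [Real.rpow_sub_one hl']
    ring
  intro ε hε
  obtain ⟨h1, h2⟩ := isThetaCheck_corrSeq hφ hw hb hp hγ h h0 ε hε
  simp only [div_eq_mul_inv (corrSeq φ w b p₀ γ₀ _)]
  exact ⟨(h1.mul hinv.1).trans_eventuallyEq (e ε).symm,
    (e (-ε)).trans_isBigO (h2.mul hinv.2)⟩

theorem one_sub_cosDist_isTheta {p₀ γ₀ v : ℝ} (hp : 0 < p₀) (hγ : γ₀ < p₀) (hv : 0 < v) :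
    (fun l : ℕ => 1 - (l * v + γ₀) / (l * v + p₀)) =Θ[atTop] fun l : ℕ => (l : ℝ)⁻¹ := by
  have e : (fun l : ℕ => 1 - (l * v + γ₀) / (l * v + p₀)) =
      fun l : ℕ => (p₀ - γ₀) * (l * v + p₀)⁻¹ := by
    ext l
    have : (l : ℝ) * v + p₀ ≠ 0 := by positivity
    field_simp
    ring
  rw [e]
  refine IsTheta.trans ?_ (IsTheta.inv (f := fun l : ℕ => (l : ℝ) * v + p₀) ⟨?_, ?_⟩)
  · exact (isTheta_const_mul_left (sub_pos.2 hγ).ne').2 (isTheta_refl _ _)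
  · refine .of_bound (v + p₀) ?_
    filter_upwards [eventually_ge_atTop 1] with l hl
    have hl' : (1 : ℝ) ≤ l := by exact_mod_cast hl
    rw [Real.norm_of_nonneg (by positivity), Real.norm_of_nonneg (by positivity)]
    nlinarith
  · refine .of_bound v⁻¹ (.of_forall fun l => ?_)
    rw [Real.norm_of_nonneg (by positivity), Real.norm_of_nonneg (by positivity),
      ← div_eq_inv_mul, le_div_iff₀ hv]
    linarith

theorem tendsto_affine_div {p₀ γ₀ v : ℝ} (hv : 0 < v) :
    Tendsto (fun l : ℕ => (l * v + γ₀) / (l * v + p₀)) atTop (𝓝 1) := by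
  have h1 : Tendsto (fun l : ℕ => (l : ℝ) * v + p₀) atTop atTop :=
    tendsto_atTop_add_const_right _ _ (tendsto_natCast_atTop_atTop.atTop_mul_const hv)
  have h2 := (h1.const_div_atTop (γ₀ - p₀)).const_add 1
  rw [add_zero] at h2
  refine h2.congr' ?_
  filter_upwards [h1.eventually (eventually_gt_atTop 0)] with l hl
  field_simp
  ring

end Sequences

/-! ### Convergence at every layer and the conclusion -/

theorem tendsto_mse (hφ : TanhLike φ) (σw σb : ℝ≥0) {x y : (N : ℕ) → Fin N → ℝ} {p₀ γ₀ : ℝ}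
    (hp : 0 < p₀) (hγ : |γ₀| ≤ p₀)
    (hx : Tendsto (fun N : ℕ => (x N ⬝ᵥ x N) / (N : ℝ)) atTop (𝓝 p₀))
    (hy : Tendsto (fun N : ℕ => (y N ⬝ᵥ y N) / (N : ℝ)) atTop (𝓝 p₀))
    (hxy : Tendsto (fun N : ℕ => (x N ⬝ᵥ y N) / (N : ℝ)) atTop (𝓝 γ₀)) (l : ℕ) :
    Tendsto (fun N => mse φ σw σb (x N) (x N) l
        (lenSeq φ ((σw : ℝ) ^ 2) ((σb : ℝ) ^ 2) p₀ l)) atTop (𝓝 0) ∧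
      Tendsto (fun N => mse φ σw σb (y N) (y N) l
        (lenSeq φ ((σw : ℝ) ^ 2) ((σb : ℝ) ^ 2) p₀ l)) atTop (𝓝 0) ∧
      Tendsto (fun N => mse φ σw σb (x N) (y N) l
        (corrSeq φ ((σw : ℝ) ^ 2) ((σb : ℝ) ^ 2) p₀ γ₀ l)) atTop (𝓝 0) := by
  induction l with
  | zero =>
    have key : ∀ {u : ℕ → ℝ} {a : ℝ}, Tendsto u atTop (𝓝 a) →
        Tendsto (fun N => (u N - a) ^ 2) atTop (𝓝 0) := by
      intro u a h
      have := (h.sub_const a).pow 2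
      simpa using this
    simp only [mse_zero, lenSeq, corrSeq]
    exact ⟨key hx, key hy, key hxy⟩
  | succ l ih =>
    obtain ⟨h1, h2, h3⟩ := ih
    have hpl := lenSeq_pos hφ (sq_nonneg (σw : ℝ)) (sq_nonneg (σb : ℝ)) hp l
    have hγl := abs_corrSeq_le hφ (sq_nonneg (σw : ℝ)) (sq_nonneg (σb : ℝ)) hγ l
    have hpp := (abs_of_pos hpl).le
    exact ⟨tendsto_mse_succ hφ σw σb hpl hpp h1 h1 h1, tendsto_mse_succ hφ σw σb hpl hpp h2 h2 h2,
      tendsto_mse_succ hφ σw σb hpl hγl h1 h2 h3⟩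

theorem abs_limit_le {x y : (N : ℕ) → Fin N → ℝ} {p₀ γ₀ : ℝ}
    (hx : Tendsto (fun N : ℕ => (x N ⬝ᵥ x N) / (N : ℝ)) atTop (𝓝 p₀))
    (hy : Tendsto (fun N : ℕ => (y N ⬝ᵥ y N) / (N : ℝ)) atTop (𝓝 p₀))
    (hxy : Tendsto (fun N : ℕ => (x N ⬝ᵥ y N) / (N : ℝ)) atTop (𝓝 γ₀)) : |γ₀| ≤ p₀ := by
  have h1 := (hx.add hy).div_const 2
  rw [add_self_div_two] at h1
  refine le_of_tendsto_of_tendsto' hxy.abs h1 fun N => ?_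
  rw [abs_div, Nat.abs_cast, ← add_div, div_right_comm]
  gcongr
  simp only [dotProduct]
  refine (Finset.abs_sum_le_sum_abs _ _).trans ?_
  rw [← Finset.sum_add_distrib, Finset.sum_div]
  refine Finset.sum_le_sum fun i _ => ?_
  rw [abs_mul]
  nlinarith [sq_nonneg (|x N i| - |y N i|), abs_mul_abs_self (x N i), abs_mul_abs_self (y N i)]

end RRN

end

theorem mainTheorem3 (φ : ℝ → ℝ) (hφ : RRN.TanhLike φ) (σw σb : ℝ≥0)
    (x x' : (N : ℕ) → Fin N → ℝ) (p₀ γ₀ : ℝ) (hp₀ : 0 < p₀)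
    (hx : Tendsto (fun N : ℕ => (x N ⬝ᵥ x N) / (N : ℝ)) atTop (𝓝 p₀))
    (hx' : Tendsto (fun N : ℕ => (x' N ⬝ᵥ x' N) / (N : ℝ)) atTop (𝓝 p₀))
    (hxx' : Tendsto (fun N : ℕ => (x N ⬝ᵥ x' N) / (N : ℝ)) atTop (𝓝 γ₀))
    (he : γ₀ / p₀ < 1) :
    ∃ p p' γ lam : ℕ → ℝ,
      RRN.IsLargeWidthLimit φ σw σb x x' p p' γ lam ∧
      (∀ l, p' l = p l) ∧
      (∀ l, RRN.metricExpr p p' γ l = p l * (1 - RRN.cosDist p p' γ l)) ∧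
      (σw = 0 →
        (∀ l : ℕ, γ l = l * RRN.W φ ((σb : ℝ) ^ 2) ((σb : ℝ) ^ 2) + γ₀) ∧
        (∀ l : ℕ, γ l = l * RRN.V φ (σb ^ 2) + γ₀) ∧
        (∀ l : ℕ, 1 ≤ l → lam l = (σb : ℝ) ^ 2) ∧
        (0 < σb →
          Tendsto (RRN.cosDist p p' γ) atTop (𝓝 1) ∧
          (fun l : ℕ => 1 - RRN.cosDist p p' γ l) =Θ[atTop] (fun l : ℕ => (l : ℝ)⁻¹)) ∧
        RRN.metricExpr p p' γ =Θ[atTop] (fun _ : ℕ => (1 : ℝ))) ∧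
      (0 < σw →
        RRN.metricExpr p p' γ =Θ[atTop] p ∧
        RRN.metricExpr p p' γ =Θ[atTop] (fun l : ℕ => (l : ℝ)) ∧
        (¬ (σb = 0 ∧ γ₀ = -p₀) →
          Tendsto (RRN.cosDist p p' γ) atTop (𝓝 0) ∧
          ((σw : ℝ) ^ 2 * γ₀ + (σb : ℝ) ^ 2 ≠ 0 →
            RRN.IsThetaCheck γ (fun l : ℕ => (l : ℝ) ^ (2 / Real.pi)) ∧
            RRN.IsThetaCheck (RRN.cosDist p p' γ)
              (fun l : ℕ => (l : ℝ) ^ (2 / Real.pi - 1))))) := by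
  set w : ℝ := (σw : ℝ) ^ 2 with hw_def
  set b : ℝ := (σb : ℝ) ^ 2 with hb_def
  have hw0 : 0 ≤ w := sq_nonneg _
  have hb0 : 0 ≤ b := sq_nonneg _
  have hγ : |γ₀| ≤ p₀ := RRN.abs_limit_le hx hx' hxx'
  have hlt : γ₀ < p₀ := by rwa [div_lt_one hp₀] at he
  have hmse := RRN.tendsto_mse hφ σw σb hp₀ hγ hx hx' hxx'
  have hcorr := fun l => RRN.tendsto_actCorr_of_mse hφ σw σb (hmse l).2.2
  have hcos := RRN.cosDist_self hφ hw0 hb0 hp₀ (RRN.corrSeq φ w b p₀ γ₀)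
  have hmetric : RRN.metricExpr (RRN.lenSeq φ w b p₀) (RRN.lenSeq φ w b p₀)
      (RRN.corrSeq φ w b p₀ γ₀) =
      fun l => RRN.lenSeq φ w b p₀ l - RRN.corrSeq φ w b p₀ γ₀ l := by
    ext l
    rw [RRN.metricExpr, add_self_div_two]
  refine ⟨RRN.lenSeq φ w b p₀, RRN.lenSeq φ w b p₀, RRN.corrSeq φ w b p₀ γ₀,
    -- Layer `l` is fed by the activations of layer `l - 1`; the value at `l = 0` is arbitrary.
    fun l => w * RRN.corrSeq φ w b p₀ γ₀ (l - 1) + b, ⟨fun l => ?_, fun l => ?_, hcorr, fun l => ?_⟩,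
    fun _ => rfl, fun l => ?_, fun hσ => ?_, fun hσ => ?_⟩
  · exact RRN.tendsto_actCorr_of_mse hφ σw σb (hmse l).1
  · exact RRN.tendsto_actCorr_of_mse hφ σw σb (hmse l).2.1
  · refine (((hcorr l).const_mul w).add_const b).congr' ?_
    filter_upwards [eventually_gt_atTop 0] with N hN
    rw [RRN.preactCorr_eq hφ σw σb hN]
  · have := RRN.lenSeq_pos hφ hw0 hb0 hp₀ l
    rw [hmetric, hcos]
    field_simp
  · have hw : w = 0 := by simp [hw_def, hσ]
    rw [hw] at hcos hmetric ⊢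
    have hc := RRN.corrSeq_of_zero φ b p₀ γ₀
    have hl : ∀ l, RRN.lenSeq φ 0 b p₀ l = l * RRN.W φ b b + p₀ := fun l => by
      rw [← RRN.corrSeq_self, RRN.corrSeq_of_zero]
    have hV : RRN.W φ b b = RRN.V φ (σb ^ 2) := by
      rw [← RRN.W_diag_eq_V hφ, NNReal.coe_pow]
    refine ⟨hc, fun l => by rw [hc, hV], fun l _ => by simp only [zero_mul, zero_add], fun hσb => ?_, ?_⟩
    · have hWpos : 0 < RRN.W φ b b := RRN.W_diag_pos hφ (by positivity)
      have e : RRN.cosDist (RRN.lenSeq φ 0 b p₀) (RRN.lenSeq φ 0 b p₀)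
          (RRN.corrSeq φ 0 b p₀ γ₀) =
          fun l : ℕ => (l * RRN.W φ b b + γ₀) / (l * RRN.W φ b b + p₀) := by
        ext l
        rw [hcos, hc, hl]
      rw [e]
      exact ⟨RRN.tendsto_affine_div hWpos, RRN.one_sub_cosDist_isTheta hp₀ hlt hWpos⟩
    · have e : (fun l => RRN.lenSeq φ 0 b p₀ l - RRN.corrSeq φ 0 b p₀ γ₀ l) =
          fun _ => p₀ - γ₀ := by
        ext l
        rw [hc, hl]
        ring
      rw [hmetric, e]
      exact isTheta_const_const (sub_ne_zero.2 hlt.ne') one_ne_zero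
  · have hw : 0 < w := by positivity
    rw [hmetric, funext hcos]
    refine ⟨RRN.sub_isTheta_lenSeq hφ hw hb0 hp₀ hγ hlt,
      RRN.sub_isTheta_natCast hφ hw hb0 hp₀ hγ hlt, fun hnot => ?_⟩
    -- The upper inequality is `γ₀ < p₀`. Failure of the lower one would give `w (γ₀ + p₀) ≤ -2b`,
    -- hence `b = 0` and `γ₀ = -p₀`, the excluded case of antipodal inputs without bias.
    have h : |w * γ₀ + b| < w * p₀ + b := by
      obtain ⟨h1, -⟩ := abs_le.1 hγ
      refine abs_lt.2 ⟨?_, by gcongr⟩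
      by_contra! hle
      have h2 : 0 ≤ w * (γ₀ + p₀) := mul_nonneg hw0 (by linarith)
      have hb : b = 0 := by linarith
      have h3 : w * (γ₀ + p₀) = 0 := by linarith
      refine hnot ⟨by simpa [hb_def] using hb, ?_⟩
      rcases mul_eq_zero.1 h3 with h4 | h4 <;> linarith
    exact ⟨RRN.tendsto_corrSeq_div hφ hw hb0 hp₀ hγ h, fun h0 =>
      ⟨RRN.isThetaCheck_corrSeq hφ hw hb0 hp₀ hγ h h0,
        RRN.isThetaCheck_corrSeq_div hφ hw hb0 hp₀ hγ h h0 hlt⟩⟩
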